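/- **Setting.** For each $n\ge 1$ let $N=N(n)\le n$ with $N/n\to c\in(0,1]$ as $n\to\infty$, and let $X=X_n$ be random complex $N\times n$ matrices, all defined on one probability space, such that: (i) $X_n$ is bi-unitarily invariant: $X_n=L_n\Gamma_nR_n^*$ where $L_n,\Gamma_n,R_n$ are independent, $L_n$ is Haar distributed on the unitary group $\mathcal U(N)$, $\Gamma_n$ is an $N\times N$ diagonal matrix with nonnegative entries, and $R_n$ is an $n\times N$ submatrix of a Haar distributed matrix on $\mathcal U(n)$; (ii) with $Q(z)=(XX^*-zI_N)^{-1}$ and $\alpha(z)=N^{-1}\operatorname{tr}Q(z)$, for every $z\in\mathbb C$ with $\Im z>0$, almost surely $\alpha(z)\to m(z)$ as $n\to\infty$, where $m(z)=\int (x-z)^{-1}\,\pi(dx)$ is the Stieltjes transform of a probability measure $\pi$ supported by a compact interval $[\lambda_-,\lambda_+]$; (iii) almost surely $\|XX^*\|\to\lambda_+$ as $n\to\infty$ (spectral norm). Let $\widetilde Q(z)=(X^*X-zI_n)^{-1}$ and $\tilde\alpha(z)=n^{-1}\operatorname{tr}\widetilde Q(z)$. For a nonnegative Hermitian matrix $R$,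 $\mathcal{CN}(0,R)$ denotes the law of a complex random vector $\eta$ such that $(\Re\eta,\Im\eta)$ has the real Gaussian law $\mathcal N\Bigl(0,\tfrac12\begin{bmatrix}\Re R&-\Im R\\ \Im R&\Re R\end{bmatrix}\Bigr)$. **Proposition.** Let $t$ be a fixed integer and, for all $n$ large enough (so that $t\le N$), let $W=[w_1,\dots,w_t]$ and $\widetilde W=[\tilde w_1,\dots,\tilde w_t]$ be deterministic isometry matrices of dimensions $N\times t$ and $n\times t$ (that is, $W^*W=\widetilde W^*\widetilde W=I_t$). 1. For every real $\rho>\lambda_+$, the sequence $$\xi_n=\sqrt n\left(W^*\bigl(Q(\rho)-\alpha(\rho)I_N\bigr)W,\ \widetilde W^*\bigl(\widetilde Q(\rho)-\tilde\alpha(\rho)I_n\bigr)\widetilde W,\ W^*X\widetilde Q(\rho)\widetilde W\right)$$ is tight. 2. Assume that $t$ is even, and let $\rho_1,\dots,\rho_{t/2}$ be real numbers, all strictly greater than $\lambda_+$. Then the $t\times1$ random vector $$\eta_n=\left[\sqrt N\left(w_k^*Q(\rho_k)w_{t/2+k}\right)_{1\le k\le t/2},\ \sqrt n\left(w_k^*X\widetilde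 Q(\rho_k)\tilde w_k\right)_{1\le k\le t/2}\right]^{T}$$ converges in distribution as $n\to\infty$ to $\mathcal{CN}(0,R)$, where $$R=\begin{bmatrix}\operatorname{diag}\bigl(m'(\rho_k)-m(\rho_k)^2\bigr)_{k=1}^{t/2}&0\\0&\operatorname{diag}\bigl(m(\rho_k)+\rho_km'(\rho_k)\bigr)_{k=1}^{t/2}\end{bmatrix}$$ is a nonnegative Hermitian matrix. -/

import Mathlib

open MeasureTheory ProbabilityTheory Filter Topology
open scoped Matrix ComplexOrder

noncomputable section

namespace SpikedHaar

/-- Complex matrices carry the product (equivalently, Borel) σ-algebra. -/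
instance instMeasurableSpaceMatrix {m n : Type*} : MeasurableSpace (Matrix m n ℂ) :=
  inferInstanceAs (MeasurableSpace (m → n → ℂ))

instance instBorelSpaceMatrix {m n : Type*} [Countable m] [Countable n] :
    BorelSpace (Matrix m n ℂ) :=
  inferInstanceAs (BorelSpace (m → n → ℂ))

/-- Spectral norm of a square complex matrix: operator norm on Euclidean space. -/
def spectralNorm {p : ℕ} (A : Matrix (Fin p) (Fin p) ℂ) : ℝ :=
  ‖Matrix.toEuclideanCLM (n := Fin p) (𝕜 := ℂ) A‖

/-- `Q(z) = (X X* - z I)⁻¹`. -/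
def Q {p q : ℕ} (X : Matrix (Fin p) (Fin q) ℂ) (z : ℂ) : Matrix (Fin p) (Fin p) ℂ :=
  (X * Xᴴ - z • (1 : Matrix (Fin p) (Fin p) ℂ))⁻¹

/-- `Q̃(z) = (X* X - z I)⁻¹`. -/
def Qt {p q : ℕ} (X : Matrix (Fin p) (Fin q) ℂ) (z : ℂ) : Matrix (Fin q) (Fin q) ℂ :=
  (Xᴴ * X - z • (1 : Matrix (Fin q) (Fin q) ℂ))⁻¹

/-- `α(z) = N⁻¹ tr Q(z)`. -/
def alpha {p q : ℕ} (X : Matrix (Fin p) (Fin q) ℂ) (z : ℂ) : ℂ :=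
  (p : ℂ)⁻¹ * (Q X z).trace

/-- `α̃(z) = n⁻¹ tr Q̃(z)`. -/
def alphat {p q : ℕ} (X : Matrix (Fin p) (Fin q) ℂ) (z : ℂ) : ℂ :=
  (q : ℂ)⁻¹ * (Qt X z).trace

/-- Stieltjes transform of a measure on the real line. -/
def stieltjes (π : Measure ℝ) (z : ℂ) : ℂ := ∫ x : ℝ, 1 / ((x : ℂ) - z) ∂π

/-- Bi-unitarily invariant random `p × q` matrix (`p ≤ q`): almost surely `X = L Γ R*`, where
`L` is Haar distributed on `U(p)`, `Γ` is diagonal with nonnegative real entries, `R` is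
distributed as the first `p` columns of a Haar distributed element of `U(q)`, and `L`, `Γ`, `R`
are (mutually) independent. -/
def IsBiUnitarilyInvariant {Ω : Type*} [MeasurableSpace Ω] (P : Measure Ω) {p q : ℕ} (hpq : p ≤ q)
    (X : Ω → Matrix (Fin p) (Fin q) ℂ) : Prop :=
  ∃ (L : Ω → Matrix.unitaryGroup (Fin p) ℂ) (Γ : Ω → Fin p → ℝ)
    (R : Ω → Matrix (Fin q) (Fin p) ℂ) (haarq : Measure (Matrix.unitaryGroup (Fin q) ℂ)),
    Measurable L ∧ Measurable Γ ∧ Measurable R ∧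
    (P.map L).IsHaarMeasure ∧
    (∀ ω i, 0 ≤ Γ ω i) ∧
    haarq.IsHaarMeasure ∧ IsProbabilityMeasure haarq ∧
    P.map R = haarq.map
      (fun V : Matrix.unitaryGroup (Fin q) ℂ => (V : Matrix (Fin q) (Fin q) ℂ).submatrix id (Fin.castLE hpq)) ∧
    IndepFun L (fun ω => (Γ ω, R ω)) P ∧ IndepFun Γ R P ∧
    ∀ᵐ ω ∂P, X ω =
      (L ω : Matrix (Fin p) (Fin p) ℂ) * Matrix.diagonal (fun i => (Γ ω i : ℂ)) * (R ω)ᴴ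

/-- A sequence of random elements is tight: the set of their laws is tight. -/
def IsTightSeq {Ω E : Type*} [MeasurableSpace Ω] [TopologicalSpace E] [MeasurableSpace E]
    (P : Measure Ω) (Y : ℕ → Ω → E) : Prop :=
  (∀ n, AEMeasurable (Y n) P) ∧ IsTightMeasureSet (Set.range fun n => P.map (Y n))

/-- The real covariance matrix `½ [[Re R, -Im R], [Im R, Re R]]`. -/
def realCov {ι : Type*} (R : Matrix ι ι ℂ) : Matrix (ι ⊕ ι) (ι ⊕ ι) ℝ :=
  (1 / 2 : ℝ) • Matrix.fromBlocks (R.map Complex.re) (-R.map Complex.im)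
    (R.map Complex.im) (R.map Complex.re)

/-- The law `CN(0, R)` for a nonnegative Hermitian matrix `R`: the law of `η` such that
`(Re η, Im η)` has the law `N(0, ½ [[Re R, -Im R], [Im R, Re R]])`. -/
def complexGaussian {ι : Type*} [Fintype ι] [DecidableEq ι] (R : Matrix ι ι ℂ) :
    Measure (ι → ℂ) :=
  (multivariateGaussian 0 (realCov R)).map
    (fun x i => (x (Sum.inl i) : ℂ) + (x (Sum.inr i) : ℂ) * Complex.I)

instance instIsProbabilityMeasureComplexGaussian {ι : Type*} [Fintype ι] [DecidableEq ι]
    (R : Matrix ι ι ℂ) : IsProbabilityMeasure (complexGaussian R) :=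
  Measure.isProbabilityMeasure_map (by fun_prop)

/-- `ξ = √n (W* (Q(ρ) - α(ρ) I) W, W̃* (Q̃(ρ) - α̃(ρ) I) W̃, W* X Q̃(ρ) W̃)` for an `N × n` matrix
`X`; here `p = N` and `q = n`. -/
def xi {p q t : ℕ} (X : Matrix (Fin p) (Fin q) ℂ) (W : Matrix (Fin p) (Fin t) ℂ)
    (Wt : Matrix (Fin q) (Fin t) ℂ) (ρ : ℝ) :
    Matrix (Fin t) (Fin t) ℂ × Matrix (Fin t) (Fin t) ℂ × Matrix (Fin t) (Fin t) ℂ :=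
  (((√(q : ℝ) : ℝ) : ℂ) • (Wᴴ * (Q X ρ - alpha X ρ • (1 : Matrix (Fin p) (Fin p) ℂ)) * W),
   ((√(q : ℝ) : ℝ) : ℂ) • (Wtᴴ * (Qt X ρ - alphat X ρ • (1 : Matrix (Fin q) (Fin q) ℂ)) * Wt),
   ((√(q : ℝ) : ℝ) : ℂ) • (Wᴴ * X * Qt X ρ * Wt))

/-- The index `k` among the columns. -/
def fstIdx {t : ℕ} (k : Fin (t / 2)) : Fin t := ⟨k, by omega⟩

/-- The index `t/2 + k` among the columns. -/
def sndIdx {t : ℕ} (k : Fin (t / 2)) : Fin t := ⟨t / 2 + k, by omega⟩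

/-- The vector with the entries `√N w_k* Q(ρ_k) w_{t/2+k}`, then `√n w_k* X Q̃(ρ_k) w̃_k`. -/
def eta {p q t : ℕ} (X : Matrix (Fin p) (Fin q) ℂ) (W : Matrix (Fin p) (Fin t) ℂ)
    (Wt : Matrix (Fin q) (Fin t) ℂ) (ρ : Fin (t / 2) → ℝ) : Fin (t / 2) ⊕ Fin (t / 2) → ℂ :=
  Sum.elim
    (fun k => ((√(p : ℝ) : ℝ) : ℂ) * (Wᴴ * Q X (ρ k) * W) (fstIdx k) (sndIdx k))
    (fun k => ((√(q : ℝ) : ℝ) : ℂ) * (Wᴴ * X * Qt X (ρ k) * Wt) (fstIdx k) (fstIdx k))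

/-- The block diagonal matrix with blocks `diag(m'(ρ_k) - m(ρ_k)²)` and
`diag(m(ρ_k) + ρ_k m'(ρ_k))`. -/
def limitCov {s : ℕ} (m : ℂ → ℂ) (ρ : Fin s → ℝ) : Matrix (Fin s ⊕ Fin s) (Fin s ⊕ Fin s) ℂ :=
  Matrix.fromBlocks
    (Matrix.diagonal fun k => deriv m (ρ k) - m (ρ k) ^ 2) 0
    0 (Matrix.diagonal fun k => m (ρ k) + (ρ k : ℂ) * deriv m (ρ k))

end SpikedHaar

end

/-! Write `X = L Γ R*`, `S = L* W` and `S̃ = R* W̃`. Up to scalar centring terms, the blocks of `ξ`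
and the entries of `η` are bilinear forms `S* D S`, `S̃* D S̃` and `S* D S̃`, where the diagonal
matrix `D` depends on `Γ` only (`block_left_of_svd`, `block_right_of_svd`, `block_mixed_of_svd`).
What has to be understood is therefore the joint law of `Γ` and of the Haar isometries.

These are replaced by Gaussian matrices, exactly and for each large `n`. Let `Y` be an independent
`N × t` Gaussian matrix with entries of variance `1/N`, and `A = (Y* Y)^(1/2)`. Then `W A` and `Y`
have the same Gram matrix, so they differ by a unitary factor on the left and the Haar average over
`L` does not distinguish `L* W A` from `L* Y`; by unitary invariance `L* Y` has the law of `Y`. Done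
on both sides at once, this shows that `(Γ, S A, S̃ Ã)` has the law of `(Γ, Y, top rows of Ỹ)`
(`map_haar_mul_gramSqrt_eq`). Since `A` and `Ã` tend to the identity in probability, a form in `S`,
`S̃` differs negligibly from its whitened version once the latter is bounded in probability
(`stochNull_sub_of_sandwich`).

Boundedness is a second moment computation for Gaussian sums (`IsGaussianFamily.stochBdd_sum`). The
left form is centred because its weights have sum zero, the mixed one because it pairs independent
columns; the right one needs a correction by the Gram matrix, which is within `O(1/√n)` of the
identity.

For the limit law, condition on the first column of each pair: the Gaussian sums become exactly
Gaussian, with variance a weighted average of squared moduli. These variances converge in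
probability, hence so does the characteristic function (`IsGaussianFamily.integral_exp_bilinSum`,
`IsGaussianFamily.tendstoInDistribution_bilinSum`). Distinct second columns make the limiting
covariance diagonal. Its entries are limits of averages of squared weights, namely `m' - m²` and `m
+ ρ m'`.

Two facts about the singular values enter. With probability tending to one they satisfy `Γ i ^ 2 ≤
b` for a fixed `b` between `lamPlus` and `ρ`, so the weights may be cut off at `b` and are then
bounded everywhere. The convergence of the resolvent traces in the upper half plane also extends to
the real point `ρ`, for the resolvent and for its square (`tendsto_average_resolvent`). -/

noncomputable section

namespace SpikedHaar

/-! ### Measurability of elementary matrix operations. -/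

section Measurability

variable {α : Type*} [MeasurableSpace α]

lemma measurable_matrix_iff {m n : Type*} {f : α → Matrix m n ℂ} :
    Measurable f ↔ ∀ i j, Measurable fun x => f x i j :=
  ⟨fun h i j => (measurable_pi_apply j).comp ((measurable_pi_apply i).comp h),
    fun h => measurable_pi_lambda _ fun i => measurable_pi_lambda _ fun j => h i j⟩

@[fun_prop]
lemma measurable_matrix_mul {m n o : Type*} [Fintype n] {f : α → Matrix m n ℂ}
    {g : α → Matrix n o ℂ} (hf : Measurable f) (hg : Measurable g) :
    Measurable fun x => f x * g x := by
  refine measurable_matrix_iff.2 fun i j => ?_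
  simp only [Matrix.mul_apply]
  exact Finset.measurable_sum _ fun k _ =>
    (measurable_matrix_iff.1 hf i k).mul (measurable_matrix_iff.1 hg k j)

@[fun_prop]
lemma measurable_matrix_conjTranspose {m n : Type*} {f : α → Matrix m n ℂ} (hf : Measurable f) :
    Measurable fun x => (f x)ᴴ := by
  refine measurable_matrix_iff.2 fun i j => ?_
  simp only [Matrix.conjTranspose_apply]
  exact Complex.continuous_conj.measurable.comp (measurable_matrix_iff.1 hf j i)

@[fun_prop]
lemma measurable_matrix_submatrix {m n m' n' : Type*} (e : m' → m) (e' : n' → n)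
    {f : α → Matrix m n ℂ} (hf : Measurable f) :
    Measurable fun x => (f x).submatrix e e' :=
  measurable_matrix_iff.2 fun i j => measurable_matrix_iff.1 hf (e i) (e' j)

end Measurability

/-! ### Unitary equivalence of matrices with equal Gram matrices. -/

/-- Two matrices with the same Gram matrix differ by a unitary factor on the left. -/
lemma exists_unitary_mul_eq {p t : ℕ} (a b : Matrix (Fin p) (Fin t) ℂ) (hab : aᴴ * a = bᴴ * b) :
    ∃ V : Matrix.unitaryGroup (Fin p) ℂ, a = (V : Matrix (Fin p) (Fin p) ℂ) * b := by
  have hgram : ∀ (m : Matrix (Fin p) (Fin t) ℂ) (x : EuclideanSpace ℂ (Fin t)),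
      ((‖Matrix.toEuclideanLin m x‖ ^ 2 : ℝ) : ℂ) = star x.ofLp ⬝ᵥ ((mᴴ * m) *ᵥ x.ofLp) := by
    intro m x
    rw [EuclideanSpace.norm_sq_eq, ← Matrix.mulVec_mulVec, Matrix.dotProduct_mulVec,
      Matrix.vecMul_conjTranspose, star_star]
    simp only [dotProduct, Matrix.toLpLin_apply, Pi.star_apply, Complex.ofReal_sum]
    refine Finset.sum_congr rfl fun i _ => ?_
    rw [Complex.star_def, ← Complex.normSq_eq_conj_mul_self, Complex.normSq_eq_norm_sq]
  have hnorm : ∀ x, ‖Matrix.toEuclideanLin a x‖ = ‖Matrix.toEuclideanLin b x‖ := by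
    intro x
    have h : ‖Matrix.toEuclideanLin a x‖ ^ 2 = ‖Matrix.toEuclideanLin b x‖ ^ 2 := by
      have := (hgram a x).trans ((hab ▸ rfl : _ = _).trans (hgram b x).symm)
      exact_mod_cast this
    exact (sq_eq_sq₀ (norm_nonneg _) (norm_nonneg _)).1 h
  set fa := Matrix.toEuclideanLin a
  set fb := Matrix.toEuclideanLin b
  -- Equality of norms makes `b x ↦ a x` a well defined isometry on the range of `b`. It is built
  -- from a linear section `s` of `b` and then extended to the whole space.
  obtain ⟨s, hs⟩ := fb.rangeRestrict.exists_rightInverse_of_surjective fb.range_rangeRestrict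
  have hs' : ∀ y, fb (s y) = y := fun y => congrArg Subtype.val (LinearMap.congr_fun hs y)
  let g : LinearMap.range fb →ₗᵢ[ℂ] EuclideanSpace ℂ (Fin p) :=
    { toLinearMap := fa ∘ₗ s
      norm_map' := fun y => by simp [hnorm, hs'] }
  have hg : ∀ x, g.extend (fb x) = fa x := by
    intro x
    have h1 := g.extend_apply ⟨fb x, LinearMap.mem_range_self fb x⟩
    -- The vectors `s (b x)` and `x` have the same image under `b`, and the kernels of `a` and `b`
    -- coincide.
    have h2 : fa (s ⟨fb x, LinearMap.mem_range_self fb x⟩) = fa x := by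
      rw [← sub_eq_zero, ← map_sub, ← norm_eq_zero, hnorm, map_sub, hs', sub_self, norm_zero]
    exact h1.trans h2
  let V := (Matrix.toEuclideanCLM (n := Fin p) (𝕜 := ℂ)).symm g.extend.toContinuousLinearMap
  have hV : Matrix.toEuclideanCLM (n := Fin p) (𝕜 := ℂ) V = g.extend.toContinuousLinearMap := by
    simp [V]
  refine ⟨⟨V, ?_⟩, ?_⟩
  · rw [Matrix.mem_unitaryGroup_iff']
    apply (Matrix.toEuclideanCLM (n := Fin p) (𝕜 := ℂ)).injective
    change Matrix.toEuclideanCLM (n := Fin p) (𝕜 := ℂ) (star V * V) =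
      Matrix.toEuclideanCLM (n := Fin p) (𝕜 := ℂ) 1
    rw [map_mul, map_star, hV, map_one]
    exact (ContinuousLinearMap.norm_map_iff_adjoint_comp_self _).1 g.extend.norm_map
  · apply Matrix.toEuclideanLin.injective
    ext1 x
    change fa x = _
    rw [← hg x]
    have h3 : Matrix.toEuclideanCLM (n := Fin p) (𝕜 := ℂ) V (fb x) = g.extend (fb x) := by
      rw [hV]; rfl
    rw [← h3]
    ext i
    simp [fb, Matrix.toLpLin_apply, Matrix.mulVec_mulVec]

/-! ### The square root of the Gram matrix and its continuity. -/

open scoped MatrixOrder in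
/-- The positive semidefinite square root of the Gram matrix. -/
def gramSqrt {p t : ℕ} (y : Matrix (Fin p) (Fin t) ℂ) : Matrix (Fin t) (Fin t) ℂ :=
  CFC.sqrt (yᴴ * y)

open scoped MatrixOrder in
lemma gram_nonneg {p t : ℕ} (y : Matrix (Fin p) (Fin t) ℂ) : 0 ≤ yᴴ * y :=
  Matrix.nonneg_iff_posSemidef.2 (Matrix.posSemidef_conjTranspose_mul_self y)

open scoped MatrixOrder in
lemma conjTranspose_gramSqrt {p t : ℕ} (y : Matrix (Fin p) (Fin t) ℂ) :
    (gramSqrt y)ᴴ = gramSqrt y :=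
  (Matrix.nonneg_iff_posSemidef.1 (CFC.sqrt_nonneg (yᴴ * y))).isHermitian

open scoped MatrixOrder in
lemma gramSqrt_mul_self {p t : ℕ} (y : Matrix (Fin p) (Fin t) ℂ) :
    (gramSqrt y)ᴴ * gramSqrt y = yᴴ * y := by
  rw [conjTranspose_gramSqrt]
  exact CFC.sqrt_mul_sqrt_self _ (gram_nonneg y)

open scoped MatrixOrder Matrix.Norms.L2Operator in
lemma continuousOn_matrix_sqrt (t : ℕ) :
    ContinuousOn (CFC.sqrt : Matrix (Fin t) (Fin t) ℂ → Matrix (Fin t) (Fin t) ℂ) {a | 0 ≤ a} :=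
  CFC.continuousOn_sqrt

lemma continuous_gramSqrt (p t : ℕ) :
    Continuous (gramSqrt : Matrix (Fin p) (Fin t) ℂ → Matrix (Fin t) (Fin t) ℂ) :=
  (continuousOn_matrix_sqrt t).comp_continuous (by fun_prop) gram_nonneg

@[fun_prop]
lemma measurable_gramSqrt (p t : ℕ) :
    Measurable (gramSqrt : Matrix (Fin p) (Fin t) ℂ → Matrix (Fin t) (Fin t) ℂ) :=
  (continuous_gramSqrt p t).measurable

open scoped Matrix.Norms.Elementwise in
lemma exists_entrywise_ball_subset {t : ℕ} {m : Matrix (Fin t) (Fin t) ℂ}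
    {s : Set (Matrix (Fin t) (Fin t) ℂ)} (hs : s ∈ 𝓝 m) :
    ∃ δ > 0, ∀ a : Matrix (Fin t) (Fin t) ℂ, (∀ k l, ‖a k l - m k l‖ < δ) → a ∈ s := by
  obtain ⟨δ, hδ, h⟩ := Metric.mem_nhds_iff.1 hs
  refine ⟨δ, hδ, fun a ha => h ?_⟩
  rw [Metric.mem_ball, dist_eq_norm, Matrix.norm_lt_iff hδ]
  exact ha

open scoped Matrix.Norms.L2Operator in
lemma tendsto_matrix_inv_one (t : ℕ) :
    Tendsto (fun a : Matrix (Fin t) (Fin t) ℂ => a⁻¹) (𝓝 1) (𝓝 1) := by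
  have := NormedRing.inverse_continuousAt (1 : (Matrix (Fin t) (Fin t) ℂ)ˣ)
  simp only [Units.val_one, ContinuousAt, Ring.inverse_one] at this
  rwa [show (fun a : Matrix (Fin t) (Fin t) ℂ => a⁻¹) = Ring.inverse from
    funext Matrix.nonsing_inv_eq_ringInverse]

open scoped MatrixOrder in
/-- If the Gram matrix is close to the identity, then its square root is invertible, with an inverse
close to the identity. -/
lemma exists_gramSqrt_inv_close (t : ℕ) {ε : ℝ} (hε : 0 < ε) :
    ∃ δ > 0, ∀ (p : ℕ) (y : Matrix (Fin p) (Fin t) ℂ),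
      (∀ k l, ‖(yᴴ * y) k l - (1 : Matrix (Fin t) (Fin t) ℂ) k l‖ < δ) →
      IsUnit (gramSqrt y).det ∧
        ∀ k l, ‖(gramSqrt y)⁻¹ k l - (1 : Matrix (Fin t) (Fin t) ℂ) k l‖ < ε := by
  have h0 : (1 : Matrix (Fin t) (Fin t) ℂ) ∈ {a : Matrix (Fin t) (Fin t) ℂ | 0 ≤ a} :=
    Matrix.nonneg_iff_posSemidef.2 Matrix.PosSemidef.one
  have hs : Tendsto (CFC.sqrt : Matrix (Fin t) (Fin t) ℂ → Matrix (Fin t) (Fin t) ℂ)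
      (𝓝[{a | 0 ≤ a}] 1) (𝓝 1) := by
    have := continuousOn_matrix_sqrt t 1 h0
    rwa [ContinuousWithinAt, CFC.sqrt_one] at this
  have hdet : Tendsto (fun a : Matrix (Fin t) (Fin t) ℂ => a.det) (𝓝 1) (𝓝 1) := by
    have : Continuous fun a : Matrix (Fin t) (Fin t) ℂ => a.det := by fun_prop
    simpa using this.tendsto 1
  have hE : ∀ᶠ a in 𝓝[{a : Matrix (Fin t) (Fin t) ℂ | 0 ≤ a}] 1, IsUnit (CFC.sqrt a).det ∧
      ∀ k l, ‖(CFC.sqrt a)⁻¹ k l - (1 : Matrix (Fin t) (Fin t) ℂ) k l‖ < ε := by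
    have h1 := (hdet.comp hs).eventually (isOpen_ne.mem_nhds (one_ne_zero' ℂ))
    refine (h1.mono fun a ha => isUnit_iff_ne_zero.2 ha).and ?_
    rw [eventually_all]; intro k
    rw [eventually_all]; intro l
    have h2 := (tendsto_matrix_inv_one t).comp hs
    have h3 : Tendsto (fun a => (CFC.sqrt a)⁻¹ k l) (𝓝[{a : Matrix (Fin t) (Fin t) ℂ | 0 ≤ a}] 1)
        (𝓝 ((1 : Matrix (Fin t) (Fin t) ℂ) k l)) :=
      ((continuous_id.matrix_elem k l).tendsto (1 : Matrix (Fin t) (Fin t) ℂ)).comp h2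
    simpa [dist_eq_norm] using Metric.tendsto_nhds.1 h3 ε hε
  -- The radius depends on `t` and `ε` only, since the estimate concerns `t × t` matrices: it serves
  -- for all numbers of rows `p` at once.
  obtain ⟨δ, hδ, h⟩ := exists_entrywise_ball_subset (mem_nhdsWithin_iff_eventually.1 hE)
  exact ⟨δ, hδ, fun p y hy => h _ hy (gram_nonneg y)⟩

/-! ### Haar averages and the exchange of Haar isometries for Gaussian matrices. -/

/-- For a Haar distributed `l`, the law of `l* y` only depends on the Gram matrix of `y`. -/
lemma lintegral_haar_mul_eq {p t : ℕ} (h : Measure (Matrix.unitaryGroup (Fin p) ℂ))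
    [h.IsMulLeftInvariant] (a b : Matrix (Fin p) (Fin t) ℂ) (hab : aᴴ * a = bᴴ * b)
    (f : Matrix (Fin p) (Fin t) ℂ → ENNReal) :
    ∫⁻ l, f ((l : Matrix (Fin p) (Fin p) ℂ)ᴴ * a) ∂h =
      ∫⁻ l, f ((l : Matrix (Fin p) (Fin p) ℂ)ᴴ * b) ∂h := by
  obtain ⟨V, rfl⟩ := exists_unitary_mul_eq a b hab
  -- The substitution `l ↦ V l`, allowed by left invariance, makes `V* V` appear and cancel.
  rw [← lintegral_mul_left_eq_self _ V]
  refine lintegral_congr fun l => ?_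
  have hV : (V : Matrix (Fin p) (Fin p) ℂ)ᴴ * (V : Matrix (Fin p) (Fin p) ℂ) = 1 :=
    Matrix.mem_unitaryGroup_iff'.1 V.2
  congr 1
  simp only [Submonoid.coe_mul, Matrix.conjTranspose_mul]
  rw [Matrix.mul_assoc, ← Matrix.mul_assoc _ _ b, hV, Matrix.one_mul]

/-- A submatrix of a Haar distributed unitary matrix is an isometry. -/
lemma ae_conjTranspose_mul_self_eq_one {Ω : Type*} [MeasurableSpace Ω]
    {P : Measure Ω} {p q : ℕ} (hpq : p ≤ q)
    {R : Ω → Matrix (Fin q) (Fin p) ℂ} {haarq : Measure (Matrix.unitaryGroup (Fin q) ℂ)}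
    (hR : Measurable R)
    (hRlaw : P.map R = haarq.map (fun V : Matrix.unitaryGroup (Fin q) ℂ =>
      (V : Matrix (Fin q) (Fin q) ℂ).submatrix id (Fin.castLE hpq))) :
    ∀ᵐ ω ∂P, (R ω)ᴴ * R ω = 1 := by
  have hms : MeasurableSet {r : Matrix (Fin q) (Fin p) ℂ | rᴴ * r = 1} :=
    (isClosed_eq (by fun_prop) continuous_const).measurableSet
  have hsub : Measurable fun V : Matrix.unitaryGroup (Fin q) ℂ =>
      (V : Matrix (Fin q) (Fin q) ℂ).submatrix id (Fin.castLE hpq) :=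
    measurable_matrix_submatrix _ _ measurable_subtype_coe
  rw [← ae_map_iff hR.aemeasurable hms, hRlaw, ae_map_iff hsub.aemeasurable hms]
  refine Eventually.of_forall fun V => ?_
  have hV : (V : Matrix (Fin q) (Fin q) ℂ)ᴴ * (V : Matrix (Fin q) (Fin q) ℂ) = 1 :=
    Matrix.mem_unitaryGroup_iff'.1 V.2
  rw [Matrix.conjTranspose_submatrix, Matrix.submatrix_mul _ _ _ _ _ Function.bijective_id |>.symm,
    hV, Matrix.submatrix_one _ (Fin.castLE_injective hpq)]

/-- An isometry is made of the first columns of a unitary matrix. -/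
lemma exists_unitary_submatrix_eq {p q : ℕ} (hpq : p ≤ q) {r : Matrix (Fin q) (Fin p) ℂ}
    (hr : rᴴ * r = 1) : ∃ V : Matrix.unitaryGroup (Fin q) ℂ,
      r = (V : Matrix (Fin q) (Fin q) ℂ).submatrix id (Fin.castLE hpq) := by
  obtain ⟨V, hV⟩ := exists_unitary_mul_eq r
    ((1 : Matrix (Fin q) (Fin q) ℂ).submatrix id (Fin.castLE hpq)) (by
      rw [hr, Matrix.conjTranspose_submatrix,
        Matrix.submatrix_mul _ _ _ _ _ Function.bijective_id |>.symm, Matrix.conjTranspose_one,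
        Matrix.one_mul, Matrix.submatrix_one _ (Fin.castLE_injective hpq)])
  refine ⟨V, hV.trans ?_⟩
  ext i j
  simp [Matrix.mul_apply, Matrix.one_apply]

/-- Multiplying an orbit of an isometry under Haar distributed unitary matrices by the square root
of an independent Gram matrix restores a unitarily invariant law. -/
lemma map_haar_mul_gramSqrt_eq {Ω Ω' : Type*} [MeasurableSpace Ω] [MeasurableSpace Ω']
    (P : Measure Ω) (G : Measure Ω') [IsProbabilityMeasure P] [IsProbabilityMeasure G]
    {p q t : ℕ} (hpq : p ≤ q) {L : Ω → Matrix.unitaryGroup (Fin p) ℂ} {Γ : Ω → Fin p → ℝ}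
    {R : Ω → Matrix (Fin q) (Fin p) ℂ} {haarq : Measure (Matrix.unitaryGroup (Fin q) ℂ)}
    (hL : Measurable L) (hΓ : Measurable Γ) (hR : Measurable R)
    [(P.map L).IsMulLeftInvariant] [haarq.IsMulLeftInvariant] [IsProbabilityMeasure haarq]
    (hRlaw : P.map R = haarq.map (fun V : Matrix.unitaryGroup (Fin q) ℂ =>
      (V : Matrix (Fin q) (Fin q) ℂ).submatrix id (Fin.castLE hpq)))
    (hind : IndepFun L (fun ω => (Γ ω, R ω)) P) (hind' : IndepFun Γ R P)
    {Y : Ω' → Matrix (Fin p) (Fin t) ℂ} {Yt : Ω' → Matrix (Fin q) (Fin t) ℂ}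
    (hY : Measurable Y) (hYt : Measurable Yt) (hYY : IndepFun Y Yt G)
    (hYinv : ∀ V : Matrix.unitaryGroup (Fin p) ℂ,
      (G.map Y).map (fun y => (V : Matrix (Fin p) (Fin p) ℂ)ᴴ * y) = G.map Y)
    (hYtinv : ∀ V : Matrix.unitaryGroup (Fin q) ℂ,
      (G.map Yt).map (fun y => (V : Matrix (Fin q) (Fin q) ℂ)ᴴ * y) = G.map Yt)
    {W : Matrix (Fin p) (Fin t) ℂ} {Wt : Matrix (Fin q) (Fin t) ℂ}
    (hW : Wᴴ * W = 1) (hWt : Wtᴴ * Wt = 1) :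
    (P.prod G).map (fun x => (Γ x.1,
        ((L x.1 : Matrix (Fin p) (Fin p) ℂ)ᴴ * W) * gramSqrt (Y x.2),
        ((R x.1)ᴴ * Wt) * gramSqrt (Yt x.2))) =
      (P.prod G).map (fun x => (Γ x.1, Y x.2, (Yt x.2).submatrix (Fin.castLE hpq) id)) := by
  have : IsProbabilityMeasure (P.map L) := Measure.isProbabilityMeasure_map hL.aemeasurable
  have : IsProbabilityMeasure (P.map Γ) := Measure.isProbabilityMeasure_map hΓ.aemeasurable
  have : IsProbabilityMeasure (P.map R) := Measure.isProbabilityMeasure_map hR.aemeasurable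
  have : IsProbabilityMeasure (G.map Y) := Measure.isProbabilityMeasure_map hY.aemeasurable
  have : IsProbabilityMeasure (G.map Yt) := Measure.isProbabilityMeasure_map hYt.aemeasurable
  have hcoe : ∀ k, Measurable fun V : Matrix.unitaryGroup (Fin k) ℂ =>
    (V : Matrix (Fin k) (Fin k) ℂ) := fun k => measurable_subtype_coe
  have hcoep := hcoe p
  have hcoeq := hcoe q
  have hlaw : P.map (fun ω => (L ω, Γ ω, R ω)) = (P.map L).prod ((P.map Γ).prod (P.map R)) := by
    rw [(indepFun_iff_map_prod_eq_prod_map_map hL.aemeasurable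
      (hΓ.prodMk hR).aemeasurable).1 hind, (indepFun_iff_map_prod_eq_prod_map_map hΓ.aemeasurable
      hR.aemeasurable).1 hind']
  have hlaw' : G.map (fun ω => (Y ω, Yt ω)) = (G.map Y).prod (G.map Yt) :=
    (indepFun_iff_map_prod_eq_prod_map_map hY.aemeasurable hYt.aemeasurable).1 hYY
  have htop : ∀ (V : Matrix (Fin q) (Fin q) ℂ) (a : Matrix (Fin q) (Fin t) ℂ),
      (V.submatrix id (Fin.castLE hpq))ᴴ * a = (Vᴴ * a).submatrix (Fin.castLE hpq) id := by
    intro V a; ext i j; simp [Matrix.mul_apply]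
  -- integrals over the first space, for fixed matrices on the right
  have hfst : ∀ (f : (Fin p → ℝ) × Matrix (Fin p) (Fin t) ℂ × Matrix (Fin p) (Fin t) ℂ → ENNReal),
      Measurable f → ∀ (a : Matrix (Fin p) (Fin t) ℂ) (b : Matrix (Fin q) (Fin t) ℂ),
      ∫⁻ ω, f (Γ ω, (L ω : Matrix (Fin p) (Fin p) ℂ)ᴴ * a, (R ω)ᴴ * b) ∂P =
        ∫⁻ l, ∫⁻ g, ∫⁻ V, f (g, (l : Matrix (Fin p) (Fin p) ℂ)ᴴ * a,
          ((V : Matrix (Fin q) (Fin q) ℂ)ᴴ * b).submatrix (Fin.castLE hpq) id)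
          ∂haarq ∂(P.map Γ) ∂(P.map L) := by
    intro f hf a b
    have hm : Measurable fun z : Matrix.unitaryGroup (Fin p) ℂ × (Fin p → ℝ) ×
        Matrix (Fin q) (Fin p) ℂ => f (z.2.1, (z.1 : Matrix (Fin p) (Fin p) ℂ)ᴴ * a, z.2.2ᴴ * b) :=
      hf.comp (by fun_prop)
    rw [← lintegral_map (f := fun z : Matrix.unitaryGroup (Fin p) ℂ × (Fin p → ℝ) ×
        Matrix (Fin q) (Fin p) ℂ => f (z.2.1, (z.1 : Matrix (Fin p) (Fin p) ℂ)ᴴ * a, z.2.2ᴴ * b))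
        (g := fun ω => (L ω, Γ ω, R ω)) hm (by fun_prop), hlaw,
      lintegral_prod _ hm.aemeasurable]
    refine lintegral_congr fun l => ?_
    rw [lintegral_prod _ (by exact (hm.comp measurable_prodMk_left).aemeasurable)]
    refine lintegral_congr fun g => ?_
    have hm2 : Measurable fun r : Matrix (Fin q) (Fin p) ℂ =>
        f (g, (l : Matrix (Fin p) (Fin p) ℂ)ᴴ * a, rᴴ * b) := hf.comp (by fun_prop)
    rw [hRlaw, lintegral_map hm2 (by fun_prop)]
    simp only [htop]
  refine Measure.ext_of_lintegral _ fun f hf => ?_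
  rw [lintegral_map hf (by fun_prop), lintegral_map hf (by fun_prop)]
  have hgm : Measurable fun x : Ω × Ω' => f (Γ x.1,
      (L x.1 : Matrix (Fin p) (Fin p) ℂ)ᴴ * W * gramSqrt (Y x.2),
      (R x.1)ᴴ * Wt * gramSqrt (Yt x.2)) := hf.comp (by fun_prop)
  have hgm' : Measurable fun x : Ω × Ω' => f (Γ x.1,
      (L x.1 : Matrix (Fin p) (Fin p) ℂ)ᴴ * Y x.2, (R x.1)ᴴ * Yt x.2) := hf.comp (by fun_prop)
  have hgm'' : Measurable fun x : Ω × Ω' => f (Γ x.1, Y x.2,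
      (Yt x.2).submatrix (Fin.castLE hpq) id) := hf.comp (by fun_prop)
  have hiso : ∀ {k : ℕ} (w y : Matrix (Fin k) (Fin t) ℂ), wᴴ * w = 1 →
      (w * gramSqrt y)ᴴ * (w * gramSqrt y) = yᴴ * y := by
    intro k w y hw
    rw [Matrix.conjTranspose_mul, Matrix.mul_assoc, ← Matrix.mul_assoc wᴴ, hw, Matrix.one_mul,
      gramSqrt_mul_self]
  -- The intermediate law is that of `(Γ, L* Y, R* Ỹ)`. With the Gaussian matrices fixed, Haar
  -- averages see Gram matrices only, and those of `W A` and `Y` agree. With `Γ`, `L` and `R` fixed,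
  -- the unitary invariance of the Gaussian laws removes `L` and `R`.
  trans ∫⁻ x, f (Γ x.1, (L x.1 : Matrix (Fin p) (Fin p) ℂ)ᴴ * Y x.2, (R x.1)ᴴ * Yt x.2) ∂(P.prod G)
  · rw [lintegral_prod_symm _ hgm.aemeasurable, lintegral_prod_symm _ hgm'.aemeasurable]
    refine lintegral_congr fun ω' => ?_
    simp only [Matrix.mul_assoc]
    rw [hfst f hf, hfst f hf]
    have h1 : ∀ (g : Fin p → ℝ) (c : Matrix (Fin p) (Fin t) ℂ),
        ∫⁻ V, f (g, c, ((V : Matrix (Fin q) (Fin q) ℂ)ᴴ * (Wt * gramSqrt (Yt ω'))).submatrix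
          (Fin.castLE hpq) id) ∂haarq =
        ∫⁻ V, f (g, c, ((V : Matrix (Fin q) (Fin q) ℂ)ᴴ * Yt ω').submatrix
          (Fin.castLE hpq) id) ∂haarq := fun g c =>
      lintegral_haar_mul_eq haarq _ _ (hiso Wt _ hWt)
        (fun m => f (g, c, m.submatrix (Fin.castLE hpq) id))
    simp only [h1]
    exact lintegral_haar_mul_eq (P.map L) _ _ (hiso W _ hW)
      (fun m => ∫⁻ g, ∫⁻ V, f (g, m, ((V : Matrix (Fin q) (Fin q) ℂ)ᴴ * Yt ω').submatrix
          (Fin.castLE hpq) id) ∂haarq ∂(P.map Γ))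
  · rw [lintegral_prod _ hgm'.aemeasurable, lintegral_prod _ hgm''.aemeasurable]
    refine lintegral_congr_ae ?_
    filter_upwards [ae_conjTranspose_mul_self_eq_one hpq hR hRlaw] with ω hω
    -- Completing `R ω` to a unitary `V` turns `R*` into `V*` followed by truncation to the first
    -- `p` rows, so that the invariance under `V` can be used.
    obtain ⟨V, hV⟩ := exists_unitary_submatrix_eq hpq hω
    simp only [hV, htop]
    have hm : ∀ (l : Matrix (Fin p) (Fin p) ℂ) (v : Matrix (Fin q) (Fin q) ℂ),
        Measurable fun z : Matrix (Fin p) (Fin t) ℂ × Matrix (Fin q) (Fin t) ℂ =>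
          f (Γ ω, lᴴ * z.1, (vᴴ * z.2).submatrix (Fin.castLE hpq) id) :=
      fun l v => hf.comp (by fun_prop)
    have hexp : ∀ (l : Matrix (Fin p) (Fin p) ℂ) (v : Matrix (Fin q) (Fin q) ℂ),
        ∫⁻ ω', f (Γ ω, lᴴ * Y ω', (vᴴ * Yt ω').submatrix (Fin.castLE hpq) id) ∂G =
          ∫⁻ y, ∫⁻ y', f (Γ ω, lᴴ * y, (vᴴ * y').submatrix (Fin.castLE hpq) id)
            ∂(G.map Yt) ∂(G.map Y) := by
      intro l v
      rw [← lintegral_prod _ (hm l v).aemeasurable, ← hlaw', lintegral_map (hm l v) (by fun_prop)]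
    have h1 := hexp 1 1
    simp only [Matrix.conjTranspose_one, Matrix.one_mul] at h1
    rw [hexp, h1]
    have h2 : ∀ y, ∫⁻ y', f (Γ ω, y, ((V : Matrix (Fin q) (Fin q) ℂ)ᴴ * y').submatrix
        (Fin.castLE hpq) id) ∂(G.map Yt) =
        ∫⁻ y', f (Γ ω, y, y'.submatrix (Fin.castLE hpq) id) ∂(G.map Yt) := by
      intro y
      conv_rhs => rw [← hYtinv V]
      exact (lintegral_map (f := fun y' : Matrix (Fin q) (Fin t) ℂ =>
          f (Γ ω, y, y'.submatrix (Fin.castLE hpq) id))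
        (hf.comp (by fun_prop)) (by fun_prop)).symm
    simp only [h2]
    conv_rhs => rw [← hYinv (L ω)]
    refine (lintegral_map (f := fun y => ∫⁻ y', f (Γ ω, y, y'.submatrix (Fin.castLE hpq) id)
      ∂(G.map Yt)) ?_ (by fun_prop)).symm
    have := (hm 1 1).lintegral_prod_right' (ν := G.map Yt)
    simpa only [Matrix.conjTranspose_one, Matrix.one_mul] using this

/-! ### Standard complex Gaussian variables and independent families of them. -/

/-- The standard complex Gaussian law: independent real and imaginary parts of variance `1/2`. -/
def cgauss : Measure ℂ := (stdGaussian ℂ).map (fun z => (√2)⁻¹ • z)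

instance isGaussian_cgauss : IsGaussian cgauss := by
  have h : (fun z : ℂ => (√2)⁻¹ • z) =
      ⇑((√2)⁻¹ • ContinuousLinearMap.id ℝ ℂ : ℂ →L[ℝ] ℂ) := by ext; simp
  rw [cgauss, h]
  infer_instance

/-- The factor `1/4` is half of the variance `1/2` of each real coordinate. -/
lemma charFun_cgauss (w : ℂ) : charFun cgauss w = Complex.exp (-(‖w‖ ^ 2 / 4 : ℝ)) := by
  rw [cgauss, charFun_map_smul, charFun_stdGaussian, norm_smul]
  congr 1
  push_cast
  rw [mul_pow]
  simp only [norm_inv, Real.norm_eq_abs, abs_of_nonneg (Real.sqrt_nonneg 2)]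
  have h : ((√2 : ℝ) : ℂ) ^ 2 = 2 := by norm_cast; simp
  push_cast
  rw [inv_pow, h]
  ring

lemma integral_cgauss : ∫ z, z ∂cgauss = 0 := by
  rw [cgauss, integral_map (by fun_prop) (by fun_prop), integral_smul]
  simp

lemma integral_sq_norm_cgauss : ∫ z, ‖z‖ ^ 2 ∂cgauss = 1 := by
  have h2 : MemLp (fun z : ℂ => z) 2 (stdGaussian ℂ) := IsGaussian.memLp_id _ 2 (by simp)
  have hre : ∫ z, z.re ^ 2 ∂(stdGaussian ℂ) = 1 := by
    have := variance_dual_stdGaussian (E := ℂ) Complex.reCLM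
    rw [variance_of_integral_eq_zero (by fun_prop) (integral_strongDual_stdGaussian _)] at this
    simpa using this
  have him : ∫ z, z.im ^ 2 ∂(stdGaussian ℂ) = 1 := by
    have := variance_dual_stdGaussian (E := ℂ) Complex.imCLM
    rw [variance_of_integral_eq_zero (by fun_prop) (integral_strongDual_stdGaussian _)] at this
    simpa using this
  rw [cgauss, integral_map (by fun_prop) (by fun_prop)]
  have h : ∀ z : ℂ, ‖(√2)⁻¹ • z‖ ^ 2 = 2⁻¹ * (z.re ^ 2 + z.im ^ 2) := by
    intro z
    rw [norm_smul, mul_pow, norm_inv, Real.norm_eq_abs, abs_of_nonneg (Real.sqrt_nonneg 2), inv_pow,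
      Real.sq_sqrt (by norm_num), ← Complex.normSq_eq_norm_sq, Complex.normSq_apply]
    ring
  simp only [h]
  have hire : Integrable (fun z : ℂ => z.re ^ 2) (stdGaussian ℂ) := h2.re.integrable_sq
  have hiim : Integrable (fun z : ℂ => z.im ^ 2) (stdGaussian ℂ) := h2.im.integrable_sq
  rw [integral_const_mul, integral_add hire hiim, hre, him]
  norm_num

lemma integrable_norm_pow_cgauss (k : ℕ) : Integrable (fun z : ℂ => ‖z‖ ^ k) cgauss :=
  (IsGaussian.memLp_id cgauss k (by simp)).integrable_norm_pow'

/-- A family of independent standard complex Gaussian random variables. -/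
structure IsGaussianFamily {Ω ι : Type*} [MeasurableSpace Ω] (ζ : ι → Ω → ℂ) (G : Measure Ω) :
    Prop where
  measurable : ∀ j, Measurable (ζ j)
  hasLaw : ∀ j, HasLaw (ζ j) cgauss G
  indep : iIndepFun ζ G

section Family

variable {Ω ι : Type*} [MeasurableSpace Ω] {G : Measure Ω} {ζ : ι → Ω → ℂ}

lemma IsGaussianFamily.map_pi [IsProbabilityMeasure G] (h : IsGaussianFamily ζ G) {J : Type*}
    [Fintype J] {g : J → ι}
    (hg : Function.Injective g) :
    G.map (fun ω j => ζ (g j) ω) = Measure.pi fun _ : J => cgauss := by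
  rw [(iIndepFun_iff_map_fun_eq_pi_map (fun j => (h.measurable (g j)).aemeasurable)).1
    (h.indep.precomp hg)]
  simp only [(h.hasLaw _).map_eq]

/-- This is the characteristic function of the product law, written with explicit sums so that the
coefficients `e` can later be functions of other, independent variables. -/
lemma integral_exp_linear_pi {J : Type*} [Fintype J] (e : J → ℂ) :
    ∫ z, Complex.exp (((∑ j, inner ℝ (z j) (e j) : ℝ) : ℂ) * Complex.I)
      ∂(Measure.pi fun _ : J => cgauss) = Complex.exp (-((∑ j, ‖e j‖ ^ 2) / 4 : ℝ)) := by
  have h := charFun_pi (μ := fun _ : J => cgauss) (WithLp.toLp 2 e)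
  rw [charFun_apply, integral_map (by fun_prop) (by fun_prop)] at h
  simp only [PiLp.inner_apply, charFun_cgauss, ← Complex.exp_sum] at h
  rw [h]
  congr 1
  push_cast
  rw [Finset.sum_div, Finset.sum_neg_distrib]

/-- Independence is taken between the finite images of `g₁` and `g₂`, so neither map has to be
injective. This matters because the columns used for conditioning repeat. -/
lemma IsGaussianFamily.indepFun_disjoint (h : IsGaussianFamily ζ G) {J₁ J₂ : Type*} [Fintype J₁]
    [Fintype J₂] (g₁ : J₁ → ι) (g₂ : J₂ → ι) (hd : ∀ i j, g₁ i ≠ g₂ j) :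
    IndepFun (fun ω j => ζ (g₁ j) ω) (fun ω j => ζ (g₂ j) ω) G := by
  classical
  have := h.indep.indepFun_finset (Finset.univ.image g₁) (Finset.univ.image g₂) (by
    rw [Finset.disjoint_left]
    intro a ha hb
    simp only [Finset.mem_image, Finset.mem_univ, true_and] at ha hb
    obtain ⟨i, rfl⟩ := ha
    obtain ⟨j, hj⟩ := hb
    exact hd i j hj.symm) h.measurable
  exact this.comp
    (φ := fun x j => x ⟨g₁ j, Finset.mem_image_of_mem _ (Finset.mem_univ j)⟩)
    (ψ := fun x j => x ⟨g₂ j, Finset.mem_image_of_mem _ (Finset.mem_univ j)⟩)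
    (by fun_prop) (by fun_prop)

/-- Characteristic function of a linear form in Gaussian variables whose coefficients are functions
of other, independent, variables of the family. -/
lemma IsGaussianFamily.integral_exp_conditional [IsProbabilityMeasure G] (h : IsGaussianFamily ζ G)
    {J₁ J₂ : Type*}
    [Fintype J₁] [Fintype J₂] {g₁ : J₁ → ι} {g₂ : J₂ → ι}
    (hg₂ : Function.Injective g₂) (hd : ∀ i j, g₁ i ≠ g₂ j) (e : (J₁ → ℂ) → J₂ → ℂ)
    (he : Measurable e) :
    ∫ ω, Complex.exp (((∑ j, inner ℝ (ζ (g₂ j) ω) (e (fun i => ζ (g₁ i) ω) j) : ℝ) : ℂ)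
        * Complex.I) ∂G =
      ∫ ω, Complex.exp (-((∑ j, ‖e (fun i => ζ (g₁ i) ω) j‖ ^ 2) / 4 : ℝ)) ∂G := by
  have hm₁ : Measurable fun ω j => ζ (g₁ j) ω := measurable_pi_lambda _ fun j => h.measurable _
  have hm₂ : Measurable fun ω j => ζ (g₂ j) ω := measurable_pi_lambda _ fun j => h.measurable _
  have hlaw := (indepFun_iff_map_prod_eq_prod_map_map hm₁.aemeasurable hm₂.aemeasurable).1
    (h.indepFun_disjoint g₁ g₂ hd)
  have : IsProbabilityMeasure (G.map fun ω j => ζ (g₁ j) ω) :=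
    Measure.isProbabilityMeasure_map hm₁.aemeasurable
  have he' : ∀ j, Measurable fun z => e z j := fun j => (measurable_pi_apply j).comp he
  have hF : Measurable fun x : (J₁ → ℂ) × (J₂ → ℂ) =>
      Complex.exp (((∑ j, inner ℝ (x.2 j) (e x.1 j) : ℝ) : ℂ) * Complex.I) := by
    have : Measurable fun x : (J₁ → ℂ) × (J₂ → ℂ) => ∑ j, inner ℝ (x.2 j) (e x.1 j) := by
      fun_prop
    fun_prop
  have h1 := integral_map (φ := fun ω => (fun j => ζ (g₁ j) ω, fun j => ζ (g₂ j) ω)) (μ := G)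
    (hm₁.prodMk hm₂).aemeasurable hF.aestronglyMeasurable
  rw [← h1, hlaw, h.map_pi hg₂, integral_prod _ (by
    refine Integrable.of_bound hF.aestronglyMeasurable 1 (Eventually.of_forall fun x => ?_)
    rw [Complex.norm_exp_ofReal_mul_I])]
  simp only [integral_exp_linear_pi]
  rw [integral_map hm₁.aemeasurable]
  refine Measurable.aestronglyMeasurable ?_
  fun_prop

/-- Unitary invariance of the law of a Gaussian matrix. -/
lemma IsGaussianFamily.map_unitary_mul [IsProbabilityMeasure G] (h : IsGaussianFamily ζ G) {p t : ℕ}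
    {g : Fin p × Fin t → ι} (hg : Function.Injective g) (c : ℂ)
    (V : Matrix.unitaryGroup (Fin p) ℂ) :
    (G.map fun ω => (Matrix.of fun i k => c * ζ (g (i, k)) ω)).map
        (fun y => (V : Matrix (Fin p) (Fin p) ℂ)ᴴ * y) =
      G.map fun ω => (Matrix.of fun i k => c * ζ (g (i, k)) ω) := by
  have hinner : ∀ a b : Matrix (Fin p) (Fin t) ℂ,
      ∑ j : Fin p × Fin t, inner ℝ (a j.1 j.2) (b j.1 j.2) = (aᴴ * b).trace.re := by
    intro a b
    simp only [Matrix.trace, Matrix.diag, Matrix.mul_apply, Matrix.conjTranspose_apply,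
      Complex.re_sum, Complex.inner]
    rw [Fintype.sum_prod_type_right]
    simp [mul_comm]
  have hsq : ∀ b : Matrix (Fin p) (Fin t) ℂ,
      ∑ j : Fin p × Fin t, ‖b j.1 j.2‖ ^ 2 = (bᴴ * b).trace.re := by
    intro b
    rw [← hinner]
    simp only [real_inner_self_eq_norm_sq]
  let T : (Fin p × Fin t → ℂ) → Fin p × Fin t → ℂ := fun z j =>
    ((V : Matrix (Fin p) (Fin p) ℂ)ᴴ * Matrix.of fun i k => z (i, k)) j.1 j.2
  have hT : Measurable T := by
    refine measurable_pi_lambda _ fun j => ?_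
    simp only [T, Matrix.mul_apply, Matrix.of_apply]
    fun_prop
  have hVV : (V : Matrix (Fin p) (Fin p) ℂ)ᴴ * (V : Matrix (Fin p) (Fin p) ℂ) = 1 :=
    Matrix.mem_unitaryGroup_iff'.1 V.2
  have hpi : (Measure.pi fun _ : Fin p × Fin t => cgauss).map T =
      Measure.pi fun _ : Fin p × Fin t => cgauss := by
    have : IsProbabilityMeasure ((Measure.pi fun _ : Fin p × Fin t => cgauss).map T) :=
      Measure.isProbabilityMeasure_map hT.aemeasurable
    -- In the pairing `re tr (a* b)`, the factor `V*` moves to the frequency as `V`, which preserves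
    -- the Frobenius norm. The two characteristic functions therefore agree.
    rw [← charFun_eq_pi_iff]
    intro w
    rw [charFun_apply, integral_map (by fun_prop) (by fun_prop), integral_map hT.aemeasurable
      (by fun_prop)]
    let wm : Matrix (Fin p) (Fin t) ℂ := Matrix.of fun i k => w.ofLp (i, k)
    have h1 : ∀ z : Fin p × Fin t → ℂ, inner ℝ (WithLp.toLp 2 (T z)) w =
        ∑ j, inner ℝ (z j) (((V : Matrix (Fin p) (Fin p) ℂ) * wm) j.1 j.2) := by
      intro z
      have h2 := hinner ((V : Matrix (Fin p) (Fin p) ℂ)ᴴ * Matrix.of fun i k => z (i, k)) wm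
      rw [Matrix.conjTranspose_mul, Matrix.conjTranspose_conjTranspose, Matrix.mul_assoc,
        ← hinner] at h2
      simpa [PiLp.inner_apply, wm, T] using h2
    simp only [h1, charFun_cgauss, ← Complex.exp_sum]
    rw [integral_exp_linear_pi, hsq, Matrix.conjTranspose_mul, Matrix.mul_assoc,
      ← Matrix.mul_assoc _ _ wm, hVV, Matrix.one_mul, ← hsq]
    congr 1
    push_cast
    rw [Finset.sum_div, Finset.sum_neg_distrib]
    rfl
  let φ : (Fin p × Fin t → ℂ) → Matrix (Fin p) (Fin t) ℂ := fun z =>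
    Matrix.of fun i k => c * z (i, k)
  have hφ : Measurable φ := measurable_matrix_iff.2 fun i k => by
    simp only [φ, Matrix.of_apply]; fun_prop
  have hm : Measurable fun ω j => ζ (g j) ω := measurable_pi_lambda _ fun j => h.measurable _
  have hZ : G.map (fun ω => (Matrix.of fun i k => c * ζ (g (i, k)) ω)) =
      (Measure.pi fun _ : Fin p × Fin t => cgauss).map φ := by
    rw [← h.map_pi hg, Measure.map_map hφ hm]
    rfl
  rw [hZ, Measure.map_map (by fun_prop) hφ]
  conv_rhs => rw [← hpi, Measure.map_map hφ hT]
  congr 1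
  ext z i k
  simp only [φ, T, Function.comp_apply, Matrix.mul_apply, Matrix.of_apply, Finset.mul_sum]
  refine Finset.sum_congr rfl fun x _ => ?_
  ring

lemma IsGaussianFamily.integrable_norm_pow (h : IsGaussianFamily ζ G) (k : ℕ) (j : ι) :
    Integrable (fun ω => ‖ζ j ω‖ ^ k) G :=
  Integrable.comp_measurable (g := fun z : ℂ => ‖z‖ ^ k)
    (by rw [(h.hasLaw j).map_eq]; exact integrable_norm_pow_cgauss k) (h.measurable j)

end Family

/-! ### Second moments of weighted sums of centred products. -/

section SecondMoment

variable {Ω κ : Type*} [MeasurableSpace Ω] {G : Measure Ω} [DecidableEq κ] {ζ : ℕ × κ → Ω → ℂ}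

/-- Centered product of two entries of the same row. -/
def rowDev {Ω : Type*} (ζ : ℕ × κ → Ω → ℂ) (a b : κ) (i : ℕ) (ω : Ω) : ℂ :=
  star (ζ (i, a) ω) * ζ (i, b) ω - if a = b then 1 else 0

/-- A bound for the second moment of `rowDev`. -/
def rowDevBound : ℝ := 2 * ∫ z, ‖z‖ ^ 4 ∂cgauss + 2

lemma IsGaussianFamily.measurable_rowDev (h : IsGaussianFamily ζ G) (a b : κ) (i : ℕ) :
    Measurable (rowDev ζ a b i) := by
  have h1 := h.measurable (i, a)
  have h2 := h.measurable (i, b)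
  have h3 : Measurable fun ω => star (ζ (i, a) ω) := Complex.continuous_conj.measurable.comp h1
  exact (h3.mul h2).sub_const _

lemma norm_rowDev_sq_le {Ω : Type*} (ζ : ℕ × κ → Ω → ℂ) (a b : κ) (i : ℕ) (ω : Ω) :
    ‖rowDev ζ a b i ω‖ ^ 2 ≤ ‖ζ (i, a) ω‖ ^ 4 + ‖ζ (i, b) ω‖ ^ 4 + 2 := by
  have h1 : ‖rowDev ζ a b i ω‖ ≤ ‖ζ (i, a) ω‖ * ‖ζ (i, b) ω‖ + 1 := by
    refine (norm_sub_le _ _).trans (add_le_add ?_ ?_)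
    · rw [norm_mul, norm_star]
    · split_ifs <;> simp
  have h2 := pow_le_pow_left₀ (norm_nonneg _) h1 2
  -- `(x y + 1)² ≤ 2 x² y² + 2 ≤ x⁴ + y⁴ + 2`.
  nlinarith [sq_nonneg (‖ζ (i, a) ω‖ * ‖ζ (i, b) ω‖ - 1),
    sq_nonneg (‖ζ (i, a) ω‖ ^ 2 - ‖ζ (i, b) ω‖ ^ 2)]

lemma IsGaussianFamily.memLp_rowDev [IsProbabilityMeasure G] (h : IsGaussianFamily ζ G) (a b : κ)
    (i : ℕ) :
    MemLp (rowDev ζ a b i) 2 G := by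
  rw [memLp_two_iff_integrable_sq_norm (h.measurable_rowDev a b i).aestronglyMeasurable]
  refine Integrable.mono' (((h.integrable_norm_pow 4 (i, a)).add
    (h.integrable_norm_pow 4 (i, b))).add (integrable_const 2))
    ((h.measurable_rowDev a b i).norm.pow_const 2).aestronglyMeasurable
    (Eventually.of_forall fun ω => ?_)
  rw [Real.norm_of_nonneg (by positivity)]
  exact norm_rowDev_sq_le ζ a b i ω

lemma IsGaussianFamily.integral_norm_rowDev_sq_le [IsProbabilityMeasure G]
    (h : IsGaussianFamily ζ G) (a b : κ) (i : ℕ) :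
    ∫ ω, ‖rowDev ζ a b i ω‖ ^ 2 ∂G ≤ rowDevBound := by
  have h4 : ∀ j, ∫ ω, ‖ζ j ω‖ ^ 4 ∂G = ∫ z, ‖z‖ ^ 4 ∂cgauss := fun j =>
    (h.hasLaw j).integral_comp (f := fun z => ‖z‖ ^ 4) (by fun_prop)
  have hi : Integrable (fun ω => ‖ζ (i, a) ω‖ ^ 4 + ‖ζ (i, b) ω‖ ^ 4) G :=
    (h.integrable_norm_pow 4 (i, a)).add (h.integrable_norm_pow 4 (i, b))
  calc ∫ ω, ‖rowDev ζ a b i ω‖ ^ 2 ∂G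
      ≤ ∫ ω, (‖ζ (i, a) ω‖ ^ 4 + ‖ζ (i, b) ω‖ ^ 4 + 2) ∂G :=
        integral_mono (h.memLp_rowDev a b i).integrable_norm_pow' (hi.add (integrable_const 2))
          (norm_rowDev_sq_le ζ a b i)
    _ = rowDevBound := by
        rw [integral_add hi (integrable_const 2), integral_add (h.integrable_norm_pow 4 _)
          (h.integrable_norm_pow 4 _), h4, h4, rowDevBound]
        simp
        ring

/-- On the diagonal this is the unit second moment of the entries; off it, their independence and
centring. -/
lemma IsGaussianFamily.integral_rowDev [IsProbabilityMeasure G] (h : IsGaussianFamily ζ G)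
    (a b : κ) (i : ℕ) :
    ∫ ω, rowDev ζ a b i ω ∂G = 0 := by
  have h1 : ∀ j, ∫ ω, ζ j ω ∂G = 0 := fun j =>
    ((h.hasLaw j).integral_comp (f := fun z => z) (by fun_prop)).trans integral_cgauss
  by_cases hab : a = b
  · subst hab
    have h2 : ∀ ω, rowDev ζ a a i ω = ((‖ζ (i, a) ω‖ ^ 2 - 1 : ℝ) : ℂ) := by
      intro ω
      simp only [rowDev, Complex.star_def, if_true, ← Complex.normSq_eq_conj_mul_self,
        Complex.normSq_eq_norm_sq]
      push_cast
      rfl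
    simp only [h2]
    have h3 : ∫ ω, ‖ζ (i, a) ω‖ ^ 2 ∂G = 1 :=
      ((h.hasLaw (i, a)).integral_comp (f := fun z => ‖z‖ ^ 2) (by fun_prop)).trans
        integral_sq_norm_cgauss
    rw [integral_complex_ofReal, integral_sub (h.integrable_norm_pow 2 _) (integrable_const 1), h3]
    simp
  · have hind : IndepFun (fun ω => star (ζ (i, a) ω)) (ζ (i, b)) G :=
      (h.indep.indepFun (by simpa using hab : (i, a) ≠ (i, b))).comp
        Complex.continuous_conj.measurable measurable_id
    simp only [rowDev, if_neg hab, sub_zero]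
    have h3 := hind.integral_mul_eq_mul_integral
      (Complex.continuous_conj.measurable.comp (h.measurable _)).aestronglyMeasurable
      (h.measurable _).aestronglyMeasurable
    simp only [Pi.mul_apply] at h3
    rw [h3, h1, mul_zero]

/-- Distinct rows have no entry in common. -/
lemma IsGaussianFamily.indepFun_rowDev (h : IsGaussianFamily ζ G) (a b : κ) {i j : ℕ}
    (hij : i ≠ j) : IndepFun (rowDev ζ a b i) (rowDev ζ a b j) G := by
  have h1 := h.indep.indepFun_prodMk_prodMk h.measurable (i, a) (i, b) (j, a) (j, b)
    (by simp [hij]) (by simp [hij]) (by simp [hij]) (by simp [hij])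
  have hφ : Measurable fun x : ℂ × ℂ => star x.1 * x.2 - if a = b then 1 else 0 := by
    have : Continuous fun x : ℂ × ℂ => star x.1 * x.2 - if a = b then 1 else 0 := by fun_prop
    exact this.measurable
  exact h1.comp hφ hφ

/-- The summands are centred, so the second moment is a variance, and pairwise independence makes it
additive. -/
lemma integral_sum_sq_le_of_indep [IsProbabilityMeasure G] {m : ℕ} {x : ℕ → Ω → ℝ} {V C : ℝ}
    (c : Fin m → ℝ)
    (hx : ∀ i, MemLp (x i) 2 G) (hind : ∀ i j, i ≠ j → IndepFun (x i) (x j) G)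
    (h0 : ∀ i, ∫ ω, x i ω ∂G = 0) (hV : ∀ i, ∫ ω, x i ω ^ 2 ∂G ≤ V) (hc : ∀ i, |c i| ≤ C) :
    ∫ ω, (∑ i : Fin m, c i * x i ω) ^ 2 ∂G ≤ m * (C ^ 2 * V) := by
  let y : Fin m → Ω → ℝ := fun i ω => c i * x i ω
  have hy : ∀ i ∈ Finset.univ, MemLp (y i) 2 G := fun i _ => (hx i).const_mul (c i)
  have hvar := IndepFun.variance_sum hy (fun i _ j _ hij =>
    (hind i j (fun h => hij (Fin.ext h))).comp (measurable_const_mul (c i))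
      (measurable_const_mul (c j)))
  have hsum_int : ∫ ω, (∑ i, y i) ω ∂G = 0 := by
    simp only [Finset.sum_apply, y]
    rw [integral_finsetSum _ fun (i : Fin m) _ => ((hx i).integrable one_le_two).const_mul (c i)]
    simp [integral_const_mul, h0]
  rw [variance_of_integral_eq_zero (memLp_finsetSum' _ hy).aestronglyMeasurable.aemeasurable
    hsum_int]
    at hvar
  simp only [Finset.sum_apply, y] at hvar
  rw [hvar]
  calc ∑ i : Fin m, Var[fun ω => c i * x i ω; G] ≤ ∑ _i : Fin m, C ^ 2 * V := by
        refine Finset.sum_le_sum fun i _ => ?_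
        rw [variance_const_mul, variance_of_integral_eq_zero (hx
          i).aestronglyMeasurable.aemeasurable
          (h0 i)]
        exact mul_le_mul (sq_le_sq' (by linarith [abs_le.1 (hc i)]) (abs_le.1 (hc i)).2) (hV i)
          (integral_nonneg fun ω => sq_nonneg _) (sq_nonneg _)
    _ = m * (C ^ 2 * V) := by simp

/-- Second moment bound for weighted sums of the variables `rowDev`. -/
lemma IsGaussianFamily.lintegral_sum_rowDev_le [IsProbabilityMeasure G] (h : IsGaussianFamily ζ G)
    (a b : κ) {m : ℕ}
    {C : ℝ} (c : Fin m → ℝ) (hc : ∀ i, |c i| ≤ C) :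
    ∫⁻ ω, ‖∑ i : Fin m, (c i : ℂ) * rowDev ζ a b i ω‖ₑ ^ 2 ∂G ≤
      ENNReal.ofReal (m * (2 * C ^ 2 * rowDevBound)) := by
  have hV : ∀ i, ∫ ω, (rowDev ζ a b i ω).re ^ 2 ∂G ≤ rowDevBound ∧
      ∫ ω, (rowDev ζ a b i ω).im ^ 2 ∂G ≤ rowDevBound := by
    intro i
    have hm := h.memLp_rowDev a b i
    refine ⟨(integral_mono hm.re.integrable_sq hm.integrable_norm_pow' fun ω => ?_).trans
      (h.integral_norm_rowDev_sq_le a b i), (integral_mono hm.im.integrable_sq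
      hm.integrable_norm_pow' fun ω => ?_).trans (h.integral_norm_rowDev_sq_le a b i)⟩
    · exact sq_le_sq.2 ((Complex.abs_re_le_norm _).trans (le_abs_self _))
    · exact sq_le_sq.2 ((Complex.abs_im_le_norm _).trans (le_abs_self _))
  have hi := fun i => (h.memLp_rowDev a b i).integrable one_le_two
  -- The variance bound is for real variables. Treating real and imaginary parts separately is the
  -- source of the factor `2`.
  have hre := integral_sum_sq_le_of_indep (G := G) (x := fun i ω => (rowDev ζ a b i ω).re) c
    (fun i => (h.memLp_rowDev a b i).re)
    (fun i j hij => (h.indepFun_rowDev a b hij).comp Complex.measurable_re Complex.measurable_re)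
    (fun i => by
      have := integral_re (hi i)
      simp only [RCLike.re_to_complex] at this
      rw [this, h.integral_rowDev]; simp) (fun i => (hV i).1) hc
  have him := integral_sum_sq_le_of_indep (G := G) (x := fun i ω => (rowDev ζ a b i ω).im) c
    (fun i => (h.memLp_rowDev a b i).im)
    (fun i j hij => (h.indepFun_rowDev a b hij).comp Complex.measurable_im Complex.measurable_im)
    (fun i => by
      have := integral_im (hi i)
      simp only [RCLike.im_to_complex] at this
      rw [this, h.integral_rowDev]; simp) (fun i => (hV i).2) hc
  let S : Ω → ℂ := fun ω => ∑ i : Fin m, (c i : ℂ) * rowDev ζ a b i ω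
  have hS : MemLp S 2 G := memLp_finsetSum _ fun i _ => (h.memLp_rowDev a b i).const_mul _
  have hSn : ∀ ω, ‖S ω‖ ^ 2 = (∑ i : Fin m, c i * (rowDev ζ a b i ω).re) ^ 2 +
      (∑ i : Fin m, c i * (rowDev ζ a b i ω).im) ^ 2 := by
    intro ω
    rw [← Complex.normSq_eq_norm_sq, Complex.normSq_apply]
    simp only [S, Complex.re_sum, Complex.im_sum, Complex.re_ofReal_mul, Complex.im_ofReal_mul]
    ring
  have hle : ∫ ω, ‖S ω‖ ^ 2 ∂G ≤ m * (2 * C ^ 2 * rowDevBound) := by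
    have h1 : Integrable (fun ω => (∑ i : Fin m, c i * (rowDev ζ a b i ω).re) ^ 2) G :=
      (memLp_finsetSum (f := fun (i : Fin m) ω => c i * (rowDev ζ a b i ω).re) Finset.univ
        fun i _ => (h.memLp_rowDev a b i).re.const_mul (c i)).integrable_sq
    have h2 : Integrable (fun ω => (∑ i : Fin m, c i * (rowDev ζ a b i ω).im) ^ 2) G :=
      (memLp_finsetSum (f := fun (i : Fin m) ω => c i * (rowDev ζ a b i ω).im) Finset.univ
        fun i _ => (h.memLp_rowDev a b i).im.const_mul (c i)).integrable_sq
    simp only [hSn]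
    rw [integral_add h1 h2]
    linarith
  calc ∫⁻ ω, ‖S ω‖ₑ ^ 2 ∂G = ∫⁻ ω, ENNReal.ofReal (‖S ω‖ ^ 2) ∂G := by
        refine lintegral_congr fun ω => ?_
        rw [ENNReal.ofReal_pow (norm_nonneg _), ofReal_norm]
    _ = ENNReal.ofReal (∫ ω, ‖S ω‖ ^ 2 ∂G) :=
        (ofReal_integral_eq_lintegral_ofReal hS.integrable_norm_pow'
          (Eventually.of_forall fun ω => by positivity)).symm
    _ ≤ _ := ENNReal.ofReal_le_ofReal hle

end SecondMoment

/-! ### The blocks as diagonal forms, through the singular value decomposition. -/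

/-- The sesquilinear form `a* diag(c) b`. -/
def form {p t : ℕ} (c : Fin p → ℝ) (a b : Matrix (Fin p) (Fin t) ℂ) : Matrix (Fin t) (Fin t) ℂ :=
  aᴴ * Matrix.diagonal (fun i => (c i : ℂ)) * b

lemma form_apply {p t : ℕ} (c : Fin p → ℝ) (a b : Matrix (Fin p) (Fin t) ℂ) (k l : Fin t) :
    form c a b k l = ∑ i, (c i : ℂ) * (star (a i k) * b i l) := by
  rw [form, Matrix.mul_apply]
  refine Finset.sum_congr rfl fun i _ => ?_
  rw [Matrix.mul_diagonal, Matrix.conjTranspose_apply]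
  ring

lemma form_mul {p t : ℕ} (c : Fin p → ℝ) (a b : Matrix (Fin p) (Fin t) ℂ)
    (A B : Matrix (Fin t) (Fin t) ℂ) : form c (a * A) (b * B) = Aᴴ * form c a b * B := by
  simp only [form, Matrix.conjTranspose_mul, Matrix.mul_assoc]

section SVD

variable {p q t : ℕ} {L : Matrix (Fin p) (Fin p) ℂ} {g : Fin p → ℝ} {R : Matrix (Fin q) (Fin p) ℂ}

lemma mul_diagonal_mul_mul (hR : Rᴴ * R = 1) (c d : Fin p → ℂ) (M : Matrix (Fin p) (Fin q) ℂ) :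
    R * Matrix.diagonal c * Rᴴ * (R * Matrix.diagonal d * M) =
      R * Matrix.diagonal (fun i => c i * d i) * M := by
  rw [← Matrix.diagonal_mul_diagonal]
  simp only [Matrix.mul_assoc]
  rw [← Matrix.mul_assoc Rᴴ R, hR, Matrix.one_mul]

lemma svd_mul_conjTranspose (hR : Rᴴ * R = 1) {X : Matrix (Fin p) (Fin q) ℂ}
    (hX : X = L * Matrix.diagonal (fun i => (g i : ℂ)) * Rᴴ) :
    X * Xᴴ = L * Matrix.diagonal (fun i => ((g i ^ 2 : ℝ) : ℂ)) * Lᴴ := by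
  have h : (Matrix.diagonal fun i => (g i : ℂ))ᴴ = Matrix.diagonal fun i => (g i : ℂ) := by
    rw [Matrix.diagonal_conjTranspose]; congr 1; ext i; simp
  have h2 : Matrix.diagonal (fun i => ((g i ^ 2 : ℝ) : ℂ)) =
      Matrix.diagonal (fun i => (g i : ℂ)) * Matrix.diagonal (fun i => (g i : ℂ)) := by
    rw [Matrix.diagonal_mul_diagonal]; congr 1; ext i; push_cast; ring
  rw [hX, h2]
  simp only [Matrix.conjTranspose_mul, Matrix.conjTranspose_conjTranspose, h, Matrix.mul_assoc]
  rw [← Matrix.mul_assoc Rᴴ R, hR, Matrix.one_mul]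

lemma svd_conjTranspose_mul (hL : Lᴴ * L = 1) {X : Matrix (Fin p) (Fin q) ℂ}
    (hX : X = L * Matrix.diagonal (fun i => (g i : ℂ)) * Rᴴ) :
    Xᴴ * X = R * Matrix.diagonal (fun i => ((g i ^ 2 : ℝ) : ℂ)) * Rᴴ := by
  have h : (Matrix.diagonal fun i => (g i : ℂ))ᴴ = Matrix.diagonal fun i => (g i : ℂ) := by
    rw [Matrix.diagonal_conjTranspose]; congr 1; ext i; simp
  have h2 : Matrix.diagonal (fun i => ((g i ^ 2 : ℝ) : ℂ)) =
      Matrix.diagonal (fun i => (g i : ℂ)) * Matrix.diagonal (fun i => (g i : ℂ)) := by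
    rw [Matrix.diagonal_mul_diagonal]; congr 1; ext i; push_cast; ring
  rw [hX, h2]
  simp only [Matrix.conjTranspose_mul, Matrix.conjTranspose_conjTranspose, h, Matrix.mul_assoc]
  rw [← Matrix.mul_assoc Lᴴ L, hL, Matrix.one_mul]

lemma Q_eq_of_svd (hL : Lᴴ * L = 1) (hR : Rᴴ * R = 1) {X : Matrix (Fin p) (Fin q) ℂ}
    (hX : X = L * Matrix.diagonal (fun i => (g i : ℂ)) * Rᴴ) {z : ℂ}
    (hz : ∀ i, ((g i ^ 2 : ℝ) : ℂ) ≠ z) :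
    Q X z = L * Matrix.diagonal (fun i => (((g i ^ 2 : ℝ) : ℂ) - z)⁻¹) * Lᴴ := by
  have hL' : L * Lᴴ = 1 := mul_eq_one_comm.1 hL
  rw [Q]
  apply Matrix.inv_eq_right_inv
  have h1 : z • (1 : Matrix (Fin p) (Fin p) ℂ) = L * Matrix.diagonal (fun _ => z) * Lᴴ := by
    rw [← Matrix.smul_one_eq_diagonal]; simp [hL']
  rw [svd_mul_conjTranspose hR hX, h1, ← Matrix.sub_mul, ← Matrix.mul_sub, Matrix.diagonal_sub,
    mul_diagonal_mul_mul hL]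
  have : (fun i => (((g i ^ 2 : ℝ) : ℂ) - z) * (((g i ^ 2 : ℝ) : ℂ) - z)⁻¹) = fun _ => 1 := by
    ext i; exact mul_inv_cancel₀ (sub_ne_zero.2 (hz i))
  rw [this, Matrix.diagonal_one, Matrix.mul_one, hL']

lemma alpha_eq_of_svd (hL : Lᴴ * L = 1) (hR : Rᴴ * R = 1) {X : Matrix (Fin p) (Fin q) ℂ}
    (hX : X = L * Matrix.diagonal (fun i => (g i : ℂ)) * Rᴴ) {z : ℂ}
    (hz : ∀ i, ((g i ^ 2 : ℝ) : ℂ) ≠ z) :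
    alpha X z = (p : ℂ)⁻¹ * ∑ i, (((g i ^ 2 : ℝ) : ℂ) - z)⁻¹ := by
  rw [alpha, Q_eq_of_svd hL hR hX hz, Matrix.trace_mul_comm, ← Matrix.mul_assoc, hL, Matrix.one_mul,
    Matrix.trace_diagonal]

/-- On the orthogonal complement of the range of `R`, `X* X` vanishes and the resolvent is `-z⁻¹`.
Writing it as `-z⁻¹` plus a correction carried by that range avoids completing `R` to a unitary
matrix. -/
lemma Qt_eq_of_svd (hL : Lᴴ * L = 1) (hR : Rᴴ * R = 1) {X : Matrix (Fin p) (Fin q) ℂ}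
    (hX : X = L * Matrix.diagonal (fun i => (g i : ℂ)) * Rᴴ) {z : ℂ} (hz0 : z ≠ 0)
    (hz : ∀ i, ((g i ^ 2 : ℝ) : ℂ) ≠ z) :
    Qt X z = R * Matrix.diagonal (fun i => (((g i ^ 2 : ℝ) : ℂ) - z)⁻¹ + z⁻¹) * Rᴴ
      - z⁻¹ • (1 : Matrix (Fin q) (Fin q) ℂ) := by
  rw [Qt]
  apply Matrix.inv_eq_right_inv
  rw [svd_conjTranspose_mul hL hX, Matrix.sub_mul, Matrix.mul_sub, Matrix.mul_sub,
    mul_diagonal_mul_mul hR]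
  simp only [Matrix.mul_smul, Matrix.smul_mul, Matrix.mul_one, Matrix.one_mul]
  have h1 : ∀ (c : ℂ) (d : Fin p → ℂ), c • (R * Matrix.diagonal d * Rᴴ) =
      R * Matrix.diagonal (fun i => c * d i) * Rᴴ := by
    intro c d
    rw [show (fun i => c * d i) = c • d from rfl, Matrix.diagonal_smul]
    simp
  rw [h1, h1, smul_smul, inv_mul_cancel₀ hz0, one_smul, ← Matrix.sub_mul, ← Matrix.mul_sub,
    Matrix.diagonal_sub, sub_sub_eq_add_sub, add_comm _ (1 : Matrix (Fin q) (Fin q) ℂ),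
      add_sub_assoc,
    ← Matrix.sub_mul, ← Matrix.mul_sub, Matrix.diagonal_sub]
  have : (fun i => ((g i ^ 2 : ℝ) : ℂ) * ((((g i ^ 2 : ℝ) : ℂ) - z)⁻¹ + z⁻¹) -
      z⁻¹ * ((g i ^ 2 : ℝ) : ℂ) - z * ((((g i ^ 2 : ℝ) : ℂ) - z)⁻¹ + z⁻¹)) = fun _ => (0 : ℂ) := by
    ext i
    have := sub_ne_zero.2 (hz i)
    field_simp
    ring
  rw [this]
  simp

/-- The `i`-th column of `L` is a unit eigenvector of `X X*` with eigenvalue `g i ^ 2`. -/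
lemma spectralNorm_ge_of_svd (hL : Lᴴ * L = 1) (hR : Rᴴ * R = 1) {X : Matrix (Fin p) (Fin q) ℂ}
    (hX : X = L * Matrix.diagonal (fun i => (g i : ℂ)) * Rᴴ) (i : Fin p) :
    g i ^ 2 ≤ spectralNorm (X * Xᴴ) := by
  have hmem : L ∈ Matrix.unitaryGroup (Fin p) ℂ := Matrix.mem_unitaryGroup_iff'.2 hL
  set T := Matrix.toEuclideanCLM (n := Fin p) (𝕜 := ℂ)
  let v := T L (EuclideanSpace.single i 1)
  have hLL : T Lᴴ * T L = 1 := by rw [← map_mul, hL, map_one]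
  have hv : ‖v‖ = 1 := by
    have h1 : star (T L) * T L = 1 := by rw [← map_star]; exact hLL
    have h2 := (ContinuousLinearMap.norm_map_iff_adjoint_comp_self (T L)).2 h1
      (EuclideanSpace.single i 1)
    rw [h2]; simp
  have hXv : T (X * Xᴴ) v = ((g i ^ 2 : ℝ) : ℂ) • v := by
    rw [svd_mul_conjTranspose hR hX, map_mul, map_mul]
    have h3 : T Lᴴ v = EuclideanSpace.single i 1 := by
      change (T Lᴴ * T L) _ = _
      rw [hLL]; rfl
    change T L (T (Matrix.diagonal _) (T Lᴴ v)) = _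
    rw [h3]
    have h4 : T (Matrix.diagonal fun i => ((g i ^ 2 : ℝ) : ℂ)) (EuclideanSpace.single i 1) =
        ((g i ^ 2 : ℝ) : ℂ) • EuclideanSpace.single i (1 : ℂ) := by
      ext j
      simp only [T, Matrix.ofLp_toEuclideanCLM, Matrix.mulVec_diagonal, PiLp.smul_apply,
        PiLp.single_apply, smul_eq_mul, PiLp.ofLp_single, Pi.single_apply]
      split_ifs with h
      · rw [h]
      · simp
    rw [h4, map_smul]
  have h5 := (T (X * Xᴴ)).le_opNorm v
  rw [hXv, hv, mul_one, norm_smul, hv, mul_one, Complex.norm_real,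
    Real.norm_of_nonneg (sq_nonneg _)]
    at h5
  exact h5

/-- Entries of the three blocks in terms of the singular value decomposition, for a real argument
away from the spectrum. -/
lemma block_left_of_svd (hL : Lᴴ * L = 1) (hR : Rᴴ * R = 1) {X : Matrix (Fin p) (Fin q) ℂ}
    (hX : X = L * Matrix.diagonal (fun i => (g i : ℂ)) * Rᴴ) {ρ : ℝ} (hρ : ∀ i, g i ^ 2 ≠ ρ)
    (W : Matrix (Fin p) (Fin t) ℂ) :
    Wᴴ * (Q X ρ - alpha X ρ • (1 : Matrix (Fin p) (Fin p) ℂ)) * W =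
      form (fun i => (g i ^ 2 - ρ)⁻¹ - (p : ℝ)⁻¹ * ∑ j, (g j ^ 2 - ρ)⁻¹) (Lᴴ * W) (Lᴴ * W) := by
  have hz : ∀ i, ((g i ^ 2 : ℝ) : ℂ) ≠ (ρ : ℂ) := fun i => by exact_mod_cast hρ i
  have hL' : L * Lᴴ = 1 := mul_eq_one_comm.1 hL
  rw [alpha_eq_of_svd hL hR hX hz, Q_eq_of_svd hL hR hX hz]
  set a := (p : ℂ)⁻¹ * ∑ i, (((g i ^ 2 : ℝ) : ℂ) - ρ)⁻¹ with ha
  have h1 : a • (1 : Matrix (Fin p) (Fin p) ℂ) = L * Matrix.diagonal (fun _ => a) * Lᴴ := by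
    rw [← Matrix.smul_one_eq_diagonal]; simp [hL']
  rw [h1, ← Matrix.sub_mul, ← Matrix.mul_sub, Matrix.diagonal_sub, form, Matrix.conjTranspose_mul,
    Matrix.conjTranspose_conjTranspose]
  simp only [Matrix.mul_assoc, ha]
  push_cast
  rfl

/-- The constant `-ρ⁻¹` occurs both in the resolvent and in its normalized trace, and cancels. What
remains of the trace has only `p` summands but is divided by `q`, so these weights are not centred
by their own mean. -/
lemma block_right_of_svd (hL : Lᴴ * L = 1) (hR : Rᴴ * R = 1) {X : Matrix (Fin p) (Fin q) ℂ}
    (hX : X = L * Matrix.diagonal (fun i => (g i : ℂ)) * Rᴴ) {ρ : ℝ} (hρ0 : ρ ≠ 0)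
    (hρ : ∀ i, g i ^ 2 ≠ ρ) (hq : q ≠ 0) {Wt : Matrix (Fin q) (Fin t) ℂ} (hWt : Wtᴴ * Wt = 1) :
    Wtᴴ * (Qt X ρ - alphat X ρ • (1 : Matrix (Fin q) (Fin q) ℂ)) * Wt =
      form (fun i => (g i ^ 2 - ρ)⁻¹ + ρ⁻¹) (Rᴴ * Wt) (Rᴴ * Wt) -
        (((q : ℝ)⁻¹ * ∑ j, ((g j ^ 2 - ρ)⁻¹ + ρ⁻¹) : ℝ) : ℂ) • (1 : Matrix (Fin t) (Fin t) ℂ) := by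
  have hz : ∀ i, ((g i ^ 2 : ℝ) : ℂ) ≠ (ρ : ℂ) := fun i => by exact_mod_cast hρ i
  have hz0 : (ρ : ℂ) ≠ 0 := by exact_mod_cast hρ0
  have hq' : (q : ℂ) ≠ 0 := by exact_mod_cast hq
  have hat : alphat X ρ = (((q : ℝ)⁻¹ * ∑ j, ((g j ^ 2 - ρ)⁻¹ + ρ⁻¹) : ℝ) : ℂ) - (ρ : ℂ)⁻¹ := by
    rw [alphat, Qt_eq_of_svd hL hR hX hz0 hz, Matrix.trace_sub, Matrix.trace_mul_comm,
      ← Matrix.mul_assoc, hR, Matrix.one_mul, Matrix.trace_diagonal, Matrix.trace_smul,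
      Matrix.trace_one, Fintype.card_fin]
    push_cast
    rw [mul_sub, smul_eq_mul, mul_comm _ (q : ℂ), ← mul_assoc (q : ℂ)⁻¹ (q : ℂ),
      inv_mul_cancel₀ hq',
      one_mul]
  rw [hat, Qt_eq_of_svd hL hR hX hz0 hz, sub_smul, sub_sub_sub_cancel_right, Matrix.mul_sub,
    Matrix.sub_mul]
  congr 1
  · simp only [form, Matrix.conjTranspose_mul, Matrix.conjTranspose_conjTranspose, Matrix.mul_assoc]
    push_cast
    rfl
  · simp only [Matrix.mul_smul, Matrix.smul_mul, Matrix.mul_one, hWt]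

/-- Multiplication by `X` kills the complement of the range of `R`, so the two `ρ⁻¹` terms of the
resolvent cancel. -/
lemma block_mixed_of_svd (hL : Lᴴ * L = 1) (hR : Rᴴ * R = 1) {X : Matrix (Fin p) (Fin q) ℂ}
    (hX : X = L * Matrix.diagonal (fun i => (g i : ℂ)) * Rᴴ) {ρ : ℝ} (hρ0 : ρ ≠ 0)
    (hρ : ∀ i, g i ^ 2 ≠ ρ) (W : Matrix (Fin p) (Fin t) ℂ) (Wt : Matrix (Fin q) (Fin t) ℂ) :
    Wᴴ * X * Qt X ρ * Wt = form (fun i => g i * (g i ^ 2 - ρ)⁻¹) (Lᴴ * W) (Rᴴ * Wt) := by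
  have hz : ∀ i, ((g i ^ 2 : ℝ) : ℂ) ≠ (ρ : ℂ) := fun i => by exact_mod_cast hρ i
  have hz0 : (ρ : ℂ) ≠ 0 := by exact_mod_cast hρ0
  have h1 : X * Qt X ρ = L * Matrix.diagonal (fun i => ((g i * (g i ^ 2 - ρ)⁻¹ : ℝ) : ℂ)) * Rᴴ := by
    rw [Qt_eq_of_svd hL hR hX hz0 hz, Matrix.mul_sub, Matrix.mul_smul, Matrix.mul_one]
    have h2 : X * (R * Matrix.diagonal (fun i => (((g i ^ 2 : ℝ) : ℂ) - ρ)⁻¹ + (ρ : ℂ)⁻¹) * Rᴴ) =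
        L * Matrix.diagonal (fun i => (g i : ℂ) * ((((g i ^ 2 : ℝ) : ℂ) - ρ)⁻¹ + (ρ : ℂ)⁻¹)) *
          Rᴴ := by
      rw [hX, ← Matrix.diagonal_mul_diagonal]
      simp only [Matrix.mul_assoc]
      rw [← Matrix.mul_assoc Rᴴ R, hR, Matrix.one_mul]
    have h3 : (ρ : ℂ)⁻¹ • X = L * Matrix.diagonal (fun i => (ρ : ℂ)⁻¹ * (g i : ℂ)) * Rᴴ := by
      rw [show (fun i => (ρ : ℂ)⁻¹ * (g i : ℂ)) = (ρ : ℂ)⁻¹ • fun i => (g i : ℂ) from rfl,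
        Matrix.diagonal_smul, hX]
      simp
    rw [h2, h3, ← Matrix.sub_mul, ← Matrix.mul_sub, Matrix.diagonal_sub]
    congr 3
    ext i
    push_cast
    ring
  rw [Matrix.mul_assoc Wᴴ, h1]
  simp only [form, Matrix.conjTranspose_mul, Matrix.conjTranspose_conjTranspose, Matrix.mul_assoc]

end SVD

/-! ### Convergence of resolvent averages at a real point outside the support. -/

/-- Averages of a uniform limit converge to its integral. -/
lemma tendsto_average_of_uniform_approx {m : ℕ → ℕ} {x : (n : ℕ) → Fin (m n) → ℝ} {b : ℝ}
    (hx : ∀ᶠ n in atTop, ∀ i, x n i ≤ b) {π : Measure ℝ} [IsProbabilityMeasure π]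
    (hπ : ∀ᵐ y ∂π, y ≤ b) {f : ℝ → ℂ} {F : ℕ → ℝ → ℂ} {e : ℕ → ℝ} (he : Tendsto e atTop (𝓝 0))
    (hf : Integrable f π) (hF : ∀ k, Integrable (F k) π)
    (hFf : ∀ k, ∀ y ≤ b, ‖F k y - f y‖ ≤ e k)
    (hlim : ∀ k, Tendsto (fun n => (m n : ℂ)⁻¹ * ∑ i, F k (x n i)) atTop (𝓝 (∫ y, F k y ∂π))) :
    Tendsto (fun n => (m n : ℂ)⁻¹ * ∑ i, f (x n i)) atTop (𝓝 (∫ y, f y ∂π)) := by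
  have he0 : ∀ k, 0 ≤ e k := fun k => (norm_nonneg _).trans (hFf k b le_rfl)
  rw [Metric.tendsto_nhds]
  intro ε hε
  obtain ⟨k, hk⟩ := (he.eventually (gt_mem_nhds (by positivity : 0 < ε / 3))).exists
  have h1 := (Metric.tendsto_nhds.1 (hlim k)) (ε / 3) (by positivity)
  filter_upwards [hx, h1] with n hn h1n
  have h2 : dist ((m n : ℂ)⁻¹ * ∑ i, f (x n i)) ((m n : ℂ)⁻¹ * ∑ i, F k (x n i)) ≤ e k := by
    rw [dist_comm, dist_eq_norm, ← mul_sub, ← Finset.sum_sub_distrib, norm_mul, norm_inv,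
      Complex.norm_natCast]
    have h3 : ‖∑ i, (F k (x n i) - f (x n i))‖ ≤ (m n : ℝ) * e k := by
      refine (norm_sum_le _ _).trans ((Finset.sum_le_sum fun i _ => hFf k _ (hn i)).trans ?_)
      simp
    rcases Nat.eq_zero_or_pos (m n) with h0 | h0
    · simp [h0, he0 k]
    · have h0' : (0 : ℝ) < m n := by exact_mod_cast h0
      rw [inv_mul_le_iff₀ h0']
      exact h3
  have h4 : dist (∫ y, F k y ∂π) (∫ y, f y ∂π) ≤ e k := by
    rw [dist_eq_norm, ← integral_sub (hF k) hf]
    refine (norm_integral_le_of_norm_le_const (hπ.mono fun y hy => hFf k y hy)).trans ?_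
    simp
  calc dist ((m n : ℂ)⁻¹ * ∑ i, f (x n i)) (∫ y, f y ∂π)
      ≤ dist ((m n : ℂ)⁻¹ * ∑ i, f (x n i)) ((m n : ℂ)⁻¹ * ∑ i, F k (x n i)) +
        dist ((m n : ℂ)⁻¹ * ∑ i, F k (x n i)) (∫ y, F k y ∂π) +
        dist (∫ y, F k y ∂π) (∫ y, f y ∂π) := dist_triangle4 _ _ _ _
    _ < ε := by linarith

section Resolvent

variable {b ρ : ℝ}

/-- The real part of `y - (ρ + ih)` alone has modulus at least `ρ - b`, which makes the bound
uniform in `h`. -/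
lemma norm_inv_sub_le (hb : b < ρ) {y : ℝ} (hy : y ≤ b) (h : ℝ) :
    ‖((y : ℂ) - (ρ + h * Complex.I))⁻¹‖ ≤ (ρ - b)⁻¹ := by
  have h1 : ρ - b ≤ ‖(y : ℂ) - (ρ + h * Complex.I)‖ := by
    refine le_trans ?_ (Complex.abs_re_le_norm _)
    simp only [Complex.sub_re, Complex.ofReal_re, Complex.add_re, Complex.mul_re, Complex.I_re,
      mul_zero, Complex.ofReal_im, Complex.I_im, mul_one, sub_self, add_zero]
    rw [abs_sub_comm]
    exact (by linarith : ρ - b ≤ ρ - y).trans (le_abs_self _)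
  rw [norm_inv]
  exact inv_anti₀ (by linarith) h1

/-- Resolvent identity, with both resolvents bounded by `(ρ - b)⁻¹`. -/
lemma norm_inv_sub_sub_le (hb : b < ρ) {y : ℝ} (hy : y ≤ b) (h : ℝ) :
    ‖((y : ℂ) - (ρ + h * Complex.I))⁻¹ - ((y : ℂ) - ρ)⁻¹‖ ≤ |h| * ((ρ - b)⁻¹ * (ρ - b)⁻¹) := by
  have h1 := norm_inv_sub_le hb hy h
  have h0 := norm_inv_sub_le hb hy 0
  simp only [Complex.ofReal_zero, zero_mul, add_zero] at h0
  have hne : (y : ℂ) - (ρ + h * Complex.I) ≠ 0 := by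
    intro h2
    have := congrArg Complex.re h2
    simp at this
    linarith
  have hne0 : (y : ℂ) - ρ ≠ 0 := by
    rw [← Complex.ofReal_sub]
    exact_mod_cast (by linarith : y - ρ < 0).ne
  have h3 : ((y : ℂ) - (ρ + h * Complex.I))⁻¹ - ((y : ℂ) - ρ)⁻¹ =
      (h * Complex.I) * (((y : ℂ) - (ρ + h * Complex.I))⁻¹ * ((y : ℂ) - ρ)⁻¹) := by
    field_simp
    ring
  rw [h3, norm_mul, norm_mul, norm_mul, Complex.norm_real, Complex.norm_I, mul_one,
    Real.norm_eq_abs]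
  gcongr

variable {π : Measure ℝ} [IsProbabilityMeasure π]

lemma integrable_inv_sub (hb : b < ρ) (hπ : ∀ᵐ y ∂π, y ≤ b) (h : ℝ) :
    Integrable (fun y : ℝ => ((y : ℂ) - (ρ + h * Complex.I))⁻¹) π :=
  Integrable.of_bound (by fun_prop) _ (hπ.mono fun _ hy => norm_inv_sub_le hb hy h)

lemma stieltjes_ofReal (π : Measure ℝ) (ρ : ℝ) :
    stieltjes π ρ = ((∫ y, (y - ρ)⁻¹ ∂π : ℝ) : ℂ) := by
  rw [stieltjes, ← integral_complex_ofReal]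
  simp

/-- Differentiation under the integral sign: on the disc whose radius is half of the gap `ρ - b`,
the derivative of the kernel is bounded uniformly in `y ≤ b`. -/
lemma deriv_stieltjes_ofReal (hb : b < ρ) (hπ : ∀ᵐ y ∂π, y ≤ b) :
    deriv (stieltjes π) ρ = ((∫ y, ((y - ρ)⁻¹) ^ 2 ∂π : ℝ) : ℂ) := by
  have hδ : 0 < (ρ - b) / 2 := by linarith
  have hlow : ∀ y ≤ b, ∀ z ∈ Metric.ball (ρ : ℂ) ((ρ - b) / 2), (ρ - b) / 2 ≤ ‖(y : ℂ) - z‖ := by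
    intro y hy z hz
    rw [Metric.mem_ball, dist_eq_norm] at hz
    have h1 : ‖(y : ℂ) - ρ‖ ≤ ‖(y : ℂ) - z‖ + ‖z - ρ‖ := by
      simpa using norm_add_le ((y : ℂ) - z) (z - ρ)
    have h2 : ρ - b ≤ ‖(y : ℂ) - ρ‖ := by
      rw [← Complex.ofReal_sub, Complex.norm_real, Real.norm_eq_abs, abs_sub_comm]
      exact (by linarith : ρ - b ≤ ρ - y).trans (le_abs_self _)
    linarith
  have hd := (hasDerivAt_integral_of_dominated_loc_of_deriv_le (μ := π) (𝕜 := ℂ) (x₀ := (ρ : ℂ))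
    (F := fun z y => 1 / ((y : ℂ) - z)) (F' := fun z y => (((y : ℂ) - z) ^ 2)⁻¹)
    (s := Metric.ball (ρ : ℂ) ((ρ - b) / 2)) (bound := fun _ => (((ρ - b) / 2) ^ 2)⁻¹)
    (Metric.ball_mem_nhds _ hδ) (Eventually.of_forall fun z => Measurable.aestronglyMeasurable (by
      fun_prop))
    (by simpa using integrable_inv_sub hb hπ 0) (by fun_prop)
    (hπ.mono fun y hy z hz => by
      rw [norm_inv, norm_pow]
      exact inv_anti₀ (by positivity) (pow_le_pow_left₀ hδ.le (hlow y hy z hz) 2))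
    (integrable_const _)
    (hπ.mono fun y hy z hz => by
      have hne : (y : ℂ) - z ≠ 0 := norm_pos_iff.1 (hδ.trans_le (hlow y hy z hz))
      have h1 : HasDerivAt (fun x : ℂ => ((y : ℂ) - x)⁻¹) (-(-1) / ((y : ℂ) - z) ^ 2) z :=
        ((hasDerivAt_id z).const_sub (y : ℂ)).inv hne
      simpa only [one_div, neg_neg] using h1)).2
  have := hd.deriv
  rw [show stieltjes π = fun z => ∫ y : ℝ, 1 / ((y : ℂ) - z) ∂π from rfl, this,
    ← integral_complex_ofReal]
  simp

variable {m : ℕ → ℕ} {x : (n : ℕ) → Fin (m n) → ℝ}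

/-- All points stay at distance at least `ρ - b` from `ρ`, so lowering `ρ + ir` to `ρ` is uniform in
the sample. Only rational heights `r` are used: for a random sample, countably many almost sure
events then suffice. -/
lemma tendsto_average_resolvent (hb : b < ρ) (hx : ∀ᶠ n in atTop, ∀ i, x n i ≤ b)
    (hπ : ∀ᵐ y ∂π, y ≤ b)
    (hlim : ∀ r : ℚ, 0 < r → Tendsto (fun n => (m n : ℂ)⁻¹ *
      ∑ i, ((x n i : ℂ) - (ρ + (r : ℝ) * Complex.I))⁻¹) atTop
      (𝓝 (stieltjes π (ρ + (r : ℝ) * Complex.I)))) :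
    Tendsto (fun n => (m n : ℝ)⁻¹ * ∑ i, (x n i - ρ)⁻¹) atTop (𝓝 (∫ y, (y - ρ)⁻¹ ∂π)) ∧
    Tendsto (fun n => (m n : ℝ)⁻¹ * ∑ i, ((x n i - ρ)⁻¹) ^ 2) atTop
      (𝓝 (∫ y, ((y - ρ)⁻¹) ^ 2 ∂π)) := by
  have hst : ∀ h : ℝ, stieltjes π (ρ + h * Complex.I) =
      ∫ y : ℝ, ((y : ℂ) - (ρ + h * Complex.I))⁻¹ ∂π := fun h => by simp [stieltjes]
  let r : ℕ → ℚ := fun k => 1 / (k + 1)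
  have hr : ∀ k, 0 < r k := fun k => by positivity
  have hrlim : Tendsto (fun k => ((r k : ℚ) : ℝ)) atTop (𝓝 0) := by
    have := tendsto_one_div_add_atTop_nhds_zero_nat (𝕜 := ℝ)
    simpa [r] using this
  have hi0 : Integrable (fun y : ℝ => ((y : ℂ) - ρ)⁻¹) π := by
    simpa using integrable_inv_sub hb hπ 0
  have hb0 : ∀ y ≤ b, ‖((y : ℂ) - ρ)⁻¹‖ ≤ (ρ - b)⁻¹ := fun y hy => by
    simpa using norm_inv_sub_le hb hy 0
  have hδ : 0 < (ρ - b)⁻¹ := inv_pos.2 (by linarith)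
  constructor
  · have := tendsto_average_of_uniform_approx hx hπ (f := fun y => ((y : ℂ) - ρ)⁻¹)
      (F := fun k y => ((y : ℂ) - (ρ + (r k : ℝ) * Complex.I))⁻¹)
      (e := fun k => |(r k : ℝ)| * ((ρ - b)⁻¹ * (ρ - b)⁻¹))
      (by simpa using hrlim.abs.mul_const _) hi0
      (fun k => integrable_inv_sub hb hπ _)
      (fun k y hy => norm_inv_sub_sub_le hb hy _)
      (fun k => by have := hlim (r k) (hr k); rwa [hst] at this)
    have h2 := (Complex.continuous_re.tendsto _).comp this
    have h3 : ∫ y : ℝ, ((y : ℂ) - ρ)⁻¹ ∂π = ((∫ y, (y - ρ)⁻¹ ∂π : ℝ) : ℂ) := by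
      rw [← integral_complex_ofReal]; simp
    rw [h3, Complex.ofReal_re] at h2
    refine h2.congr fun n => ?_
    rw [Function.comp_apply, ← Complex.ofReal_re ((m n : ℝ)⁻¹ * ∑ i, (x n i - ρ)⁻¹)]
    congr 1
    push_cast
    rfl
  · have hrI : ∀ k, ((r k : ℝ) : ℂ) * Complex.I ≠ 0 := fun k =>
      mul_ne_zero (by exact_mod_cast (hr k).ne') Complex.I_ne_zero
    -- The square is approximated by the product of the resolvents at heights `2r` and `r`. By the
    -- resolvent identity this product is a linear combination of the two, so its averages converge
    -- by hypothesis.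
    have hprod : ∀ k (y : ℝ), y ≤ b →
        (((r k : ℝ) : ℂ) * Complex.I)⁻¹ * (((y : ℂ) - (ρ + ((2 * r k : ℚ) : ℝ) * Complex.I))⁻¹ -
          ((y : ℂ) - (ρ + (r k : ℝ) * Complex.I))⁻¹) =
        ((y : ℂ) - (ρ + ((2 * r k : ℚ) : ℝ) * Complex.I))⁻¹ *
          ((y : ℂ) - (ρ + (r k : ℝ) * Complex.I))⁻¹ := by
      intro k y hy
      have hne : ∀ h : ℝ, (y : ℂ) - (ρ + h * Complex.I) ≠ 0 := by
        intro h h2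
        have := congrArg Complex.re h2
        simp at this
        linarith
      rw [inv_sub_inv (hne _) (hne _), ← div_eq_inv_mul, ← mul_inv, div_eq_iff (hrI k),
        div_eq_mul_inv, mul_comm _ (((r k : ℝ) : ℂ) * Complex.I)]
      congr 1
      push_cast
      ring
    have := tendsto_average_of_uniform_approx hx hπ (f := fun y => (((y : ℂ) - ρ)⁻¹) ^ 2)
      (F := fun k y => (((r k : ℝ) : ℂ) * Complex.I)⁻¹ *
        (((y : ℂ) - (ρ + ((2 * r k : ℚ) : ℝ) * Complex.I))⁻¹ -
          ((y : ℂ) - (ρ + (r k : ℝ) * Complex.I))⁻¹))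
      (e := fun k => (ρ - b)⁻¹ * (|(r k : ℝ)| * ((ρ - b)⁻¹ * (ρ - b)⁻¹)) +
        (|((2 * r k : ℚ) : ℝ)| * ((ρ - b)⁻¹ * (ρ - b)⁻¹)) * (ρ - b)⁻¹)
      (by
        have h2 : Tendsto (fun k => ((2 * r k : ℚ) : ℝ)) atTop (𝓝 0) := by
          have := hrlim.const_mul 2
          simpa using this
        have h3 := ((hrlim.abs.mul_const ((ρ - b)⁻¹ * (ρ - b)⁻¹)).const_mul (ρ - b)⁻¹).add
          ((h2.abs.mul_const ((ρ - b)⁻¹ * (ρ - b)⁻¹)).mul_const (ρ - b)⁻¹)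
        simpa using h3)
      (Integrable.of_bound (by fun_prop) (((ρ - b)⁻¹) ^ 2) (hπ.mono fun y hy => by
        rw [norm_pow]; exact pow_le_pow_left₀ (norm_nonneg _) (hb0 y hy) 2))
      (fun k => ((integrable_inv_sub hb hπ _).sub (integrable_inv_sub hb hπ _)).const_mul _)
      (fun k y hy => by
        simp only [hprod k y hy]
        set u := ((y : ℂ) - (ρ + ((2 * r k : ℚ) : ℝ) * Complex.I))⁻¹ with hu
        set v := ((y : ℂ) - (ρ + (r k : ℝ) * Complex.I))⁻¹ with hv
        set w := ((y : ℂ) - ρ)⁻¹ with hw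
        have h1 : u * v - w ^ 2 = u * (v - w) + (u - w) * w := by ring
        rw [h1]
        refine (norm_add_le _ _).trans ?_
        rw [norm_mul, norm_mul]
        exact add_le_add
          (mul_le_mul (norm_inv_sub_le hb hy _) (norm_inv_sub_sub_le hb hy _) (norm_nonneg _) hδ.le)
          (mul_le_mul (norm_inv_sub_sub_le hb hy _) (hb0 y hy) (norm_nonneg _) (by positivity)))
      (fun k => by
        have h1 := hlim (2 * r k) (by have := hr k; positivity)
        have h2 := hlim (r k) (hr k)
        rw [hst] at h1 h2
        have h3 := (h1.sub h2).const_mul (((r k : ℝ) : ℂ) * Complex.I)⁻¹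
        rw [integral_const_mul, integral_sub (integrable_inv_sub hb hπ _)
          (integrable_inv_sub hb hπ _)]
        refine h3.congr fun n => ?_
        rw [← mul_sub, ← Finset.sum_sub_distrib, ← Finset.mul_sum]
        ring)
    have h2 := (Complex.continuous_re.tendsto _).comp this
    have h3 : ∫ y : ℝ, (((y : ℂ) - ρ)⁻¹) ^ 2 ∂π = ((∫ y, ((y - ρ)⁻¹) ^ 2 ∂π : ℝ) : ℂ) := by
      rw [← integral_complex_ofReal]; simp
    rw [h3, Complex.ofReal_re] at h2
    refine h2.congr fun n => ?_
    rw [Function.comp_apply, ← Complex.ofReal_re ((m n : ℝ)⁻¹ * ∑ i, ((x n i - ρ)⁻¹) ^ 2)]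
    congr 1
    push_cast
    rfl

end Resolvent

/-! ### Calculus of boundedness and of convergence to zero in probability. -/

/-- A sequence of random elements is bounded in probability. -/
def StochBdd {Ω E : Type*} [MeasurableSpace Ω] [Norm E] (μ : Measure Ω) (Y : ℕ → Ω → E) : Prop :=
  ∀ ε : ENNReal, 0 < ε → ∃ C : ℝ, ∀ᶠ n in atTop, μ {ω | C < ‖Y n ω‖} ≤ ε

/-- A sequence of random elements converges to zero in probability. -/
def StochNull {Ω E : Type*} [MeasurableSpace Ω] [Norm E] (μ : Measure Ω) (Y : ℕ → Ω → E) : Prop :=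
  ∀ ε : ℝ, 0 < ε → Tendsto (fun n => μ {ω | ε ≤ ‖Y n ω‖}) atTop (𝓝 0)

section Calculus

variable {Ω E : Type*} [MeasurableSpace Ω] [SeminormedAddCommGroup E] {μ : Measure Ω}

lemma stochNull_iff_tendstoInMeasure {Y : ℕ → Ω → E} :
    StochNull μ Y ↔ TendstoInMeasure μ Y atTop 0 := by
  rw [tendstoInMeasure_iff_norm]
  simp [StochNull]

lemma StochNull.of_subset {Y Z : ℕ → Ω → E} (hY : StochNull μ Y)
    (h : Tendsto (fun n => μ {ω | ¬ ‖Z n ω‖ ≤ ‖Y n ω‖}) atTop (𝓝 0)) : StochNull μ Z := by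
  intro ε hε
  have h1 := (hY ε hε).add h
  rw [add_zero] at h1
  refine tendsto_of_tendsto_of_tendsto_of_le_of_le tendsto_const_nhds h1 (fun _ => zero_le)
    fun n => ?_
  refine (measure_mono fun ω hω => ?_).trans (measure_union_le _ _)
  by_cases h2 : ‖Z n ω‖ ≤ ‖Y n ω‖
  · exact Or.inl (le_trans hω h2)
  · exact Or.inr h2

lemma StochNull.congr {Y Z : ℕ → Ω → E} (hY : StochNull μ Y)
    (h : Tendsto (fun n => μ {ω | Z n ω ≠ Y n ω}) atTop (𝓝 0)) : StochNull μ Z :=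
  hY.of_subset (tendsto_of_tendsto_of_tendsto_of_le_of_le tendsto_const_nhds h
    (fun _ => zero_le) fun _ => measure_mono fun _ hω h2 => hω (by rw [h2]))

lemma StochBdd.of_norm_le {F : Type*} [SeminormedAddCommGroup F] {Y : ℕ → Ω → E} {Z : ℕ → Ω → F}
    (hY : StochBdd μ Y) (h : ∀ᶠ n in atTop, ∀ ω, ‖Z n ω‖ ≤ ‖Y n ω‖) : StochBdd μ Z := by
  intro ε hε
  obtain ⟨C, hC⟩ := hY ε hε
  refine ⟨C, ?_⟩
  filter_upwards [hC, h] with n hn hn'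
  exact (measure_mono fun ω hω => lt_of_lt_of_le hω (hn' ω)).trans hn

lemma StochBdd.congr {Y Z : ℕ → Ω → E} (hY : StochBdd μ Y)
    (h : Tendsto (fun n => μ {ω | Z n ω ≠ Y n ω}) atTop (𝓝 0)) : StochBdd μ Z := by
  intro ε hε
  obtain ⟨C, hC⟩ := hY (ε / 2) (ENNReal.half_pos hε.ne')
  refine ⟨C, ?_⟩
  filter_upwards [hC, h.eventually (ge_mem_nhds (ENNReal.half_pos hε.ne'))] with n hn hn'
  have h3 : {ω | C < ‖Z n ω‖} ⊆ {ω | C < ‖Y n ω‖} ∪ {ω | Z n ω ≠ Y n ω} := by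
    intro ω hω
    by_cases h2 : Z n ω = Y n ω
    · exact Or.inl (by rw [Set.mem_ofPred_eq, ← h2]; exact hω)
    · exact Or.inr h2
  calc μ {ω | C < ‖Z n ω‖} ≤ _ := (measure_mono h3).trans (measure_union_le _ _)
    _ ≤ ε / 2 + ε / 2 := add_le_add hn hn'
    _ = ε := ENNReal.add_halves ε

/-- Only the laws matter here; this carries the bounds for Gaussian forms over to the whitened
forms. -/
lemma StochBdd.of_identDistrib {Ω' : Type*} [MeasurableSpace Ω'] {μ' : Measure Ω'}
    [MeasurableSpace E] [OpensMeasurableSpace E] {Y : ℕ → Ω → E} {Z : ℕ → Ω' → E}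
    (hY : StochBdd μ Y) (h : ∀ᶠ n in atTop, IdentDistrib (Z n) (Y n) μ' μ) : StochBdd μ' Z := by
  intro ε hε
  obtain ⟨C, hC⟩ := hY ε hε
  refine ⟨C, ?_⟩
  filter_upwards [hC, h] with n hn hn'
  have := hn'.measure_mem_eq (s := {x | C < ‖x‖})
    (isOpen_lt continuous_const continuous_norm).measurableSet
  exact this.le.trans hn

lemma StochBdd.add {Y Z : ℕ → Ω → E} (hY : StochBdd μ Y) (hZ : StochBdd μ Z) :
    StochBdd μ (fun n ω => Y n ω + Z n ω) := by
  intro ε hε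
  obtain ⟨C, hC⟩ := hY (ε / 2) (ENNReal.half_pos hε.ne')
  obtain ⟨D, hD⟩ := hZ (ε / 2) (ENNReal.half_pos hε.ne')
  refine ⟨C + D, ?_⟩
  filter_upwards [hC, hD] with n hn hn'
  have h3 : {ω | C + D < ‖Y n ω + Z n ω‖} ⊆ {ω | C < ‖Y n ω‖} ∪ {ω | D < ‖Z n ω‖} := by
    intro ω hω
    by_contra h
    simp only [Set.mem_union, Set.mem_ofPred_eq, not_or, not_lt] at h hω
    linarith [norm_add_le (Y n ω) (Z n ω)]
  calc μ {ω | C + D < ‖Y n ω + Z n ω‖} ≤ _ := (measure_mono h3).trans (measure_union_le _ _)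
    _ ≤ ε / 2 + ε / 2 := add_le_add hn hn'
    _ = ε := ENNReal.add_halves ε

lemma StochNull.add {Y Z : ℕ → Ω → E} (hY : StochNull μ Y) (hZ : StochNull μ Z) :
    StochNull μ (fun n ω => Y n ω + Z n ω) := by
  intro ε hε
  have h1 := (hY (ε / 2) (half_pos hε)).add (hZ (ε / 2) (half_pos hε))
  rw [add_zero] at h1
  refine tendsto_of_tendsto_of_tendsto_of_le_of_le tendsto_const_nhds h1 (fun _ => zero_le)
    fun n => (measure_mono fun ω hω => ?_).trans (measure_union_le _ _)
  by_contra h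
  simp only [Set.mem_union, Set.mem_ofPred_eq, not_or, not_le] at h hω
  linarith [norm_add_le (Y n ω) (Z n ω)]

lemma stochNull_zero : StochNull μ (fun _ _ => (0 : E)) := by
  intro ε hε
  simp [hε.not_ge]

lemma StochNull.sum {ι : Type*} (s : Finset ι) {Y : ι → ℕ → Ω → E}
    (hY : ∀ i ∈ s, StochNull μ (Y i)) : StochNull μ (fun n ω => ∑ i ∈ s, Y i n ω) := by
  classical
  induction s using Finset.induction_on with
  | empty => simpa using stochNull_zero
  | insert a s ha ih =>
    simp only [Finset.sum_insert ha]
    exact (hY a (Finset.mem_insert_self a s)).add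
      (ih fun i hi => hY i (Finset.mem_insert_of_mem hi))

lemma StochNull.stochBdd {Y : ℕ → Ω → E} (hY : StochNull μ Y) : StochBdd μ Y := by
  intro ε hε
  refine ⟨1, ?_⟩
  filter_upwards [(hY 1 one_pos).eventually (ge_mem_nhds hε)] with n hn
  refine le_trans (measure_mono ?_) hn
  exact fun ω (hω : 1 < ‖Y n ω‖) => hω.le

lemma StochNull.norm_le {F : Type*} [SeminormedAddCommGroup F] {Y : ℕ → Ω → E} {Z : ℕ → Ω → F}
    (hY : StochNull μ Y) (h : ∀ n ω, ‖Z n ω‖ ≤ ‖Y n ω‖) : StochNull μ Z := by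
  intro ε hε
  exact tendsto_of_tendsto_of_tendsto_of_le_of_le tendsto_const_nhds (hY ε hε)
    (fun _ => zero_le) fun n => measure_mono fun ω hω => le_trans hω (h n ω)

lemma StochBdd.mul_stochNull {Y Z : ℕ → Ω → ℂ} (hY : StochBdd μ Y) (hZ : StochNull μ Z) :
    StochNull μ (fun n ω => Y n ω * Z n ω) := by
  intro ε hε
  rw [ENNReal.tendsto_nhds_zero]
  intro δ hδ
  obtain ⟨C, hC⟩ := hY (δ / 2) (ENNReal.half_pos hδ.ne')
  -- The bound `C` need not be positive, and it serves as a divisor below.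
  have hC' : 0 < |C| + 1 := by positivity
  filter_upwards [hC, (hZ (ε / (|C| + 1)) (by positivity)).eventually
    (ge_mem_nhds (ENNReal.half_pos hδ.ne'))] with n hn hn'
  have h3 : {ω | ε ≤ ‖Y n ω * Z n ω‖} ⊆ {ω | C < ‖Y n ω‖} ∪ {ω | ε / (|C| + 1) ≤ ‖Z n ω‖} := by
    intro ω hω
    by_contra h
    simp only [Set.mem_union, Set.mem_ofPred_eq, not_or, not_lt, not_le, norm_mul] at h hω
    have h4 : ‖Y n ω‖ < |C| + 1 := by linarith [h.1, le_abs_self C]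
    have h5 := (lt_div_iff₀ hC').1 h.2
    nlinarith [norm_nonneg (Z n ω), norm_nonneg (Y n ω)]
  calc μ {ω | ε ≤ ‖Y n ω * Z n ω‖} ≤ _ := (measure_mono h3).trans (measure_union_le _ _)
    _ ≤ δ / 2 + δ / 2 := add_le_add hn hn'
    _ = δ := ENNReal.add_halves δ

lemma stochBdd_of_norm_le [IsZeroOrProbabilityMeasure μ] {Y : ℕ → Ω → E} {C : ℝ}
    (h : ∀ n ω, ‖Y n ω‖ ≤ C) : StochBdd μ Y := by
  intro ε hε
  refine ⟨C, Eventually.of_forall fun n => ?_⟩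
  have : {ω | C < ‖Y n ω‖} = ∅ := Set.eq_empty_of_forall_notMem fun ω hω => not_le.2 hω (h n ω)
  simp [this]

/-- A bounded multiple of a sequence that is bounded in probability is bounded in probability. -/
lemma StochBdd.bdd_mul {Y U : ℕ → Ω → ℂ} (hY : StochBdd μ Y) {C : ℝ}
    (hU : ∀ᶠ n in atTop, ∀ ω, ‖U n ω‖ ≤ C) : StochBdd μ (fun n ω => U n ω * Y n ω) := by
  intro ε hε
  obtain ⟨D, hD⟩ := hY ε hε
  refine ⟨(|C|) * |D|, ?_⟩
  filter_upwards [hD, hU] with n hn hn'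
  refine (measure_mono fun ω hω => ?_).trans hn
  simp only [Set.mem_ofPred_eq, norm_mul] at hω ⊢
  by_contra h
  have h1 : ‖U n ω‖ ≤ |C| := (hn' ω).trans (le_abs_self C)
  have h2 : ‖Y n ω‖ ≤ |D| := (not_lt.1 h).trans (le_abs_self D)
  exact absurd (mul_le_mul h1 h2 (norm_nonneg _) (abs_nonneg _)) (not_le.2 hω)

lemma stochNull_of_tendsto {c : ℕ → E} (hc : Tendsto c atTop (𝓝 0)) :
    StochNull μ (fun n _ => c n) := by
  intro ε hε
  refine tendsto_const_nhds.congr' ?_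
  filter_upwards [hc.norm.eventually (gt_mem_nhds (by simpa using hε))] with n hn
  simp [hn.not_ge]

lemma stochBdd_of_lintegral_le {Y : ℕ → Ω → ℂ} (hY : ∀ n, AEMeasurable (Y n) μ) {K : ENNReal}
    (hK : K ≠ ⊤) (h : ∀ᶠ n in atTop, ∫⁻ ω, ‖Y n ω‖ₑ ^ 2 ∂μ ≤ K) : StochBdd μ Y := by
  intro ε hε
  -- Since `N ≥ 1`, `‖Y‖ > N` implies `‖Y‖² ≥ N`, and Markov's inequality at a level `N > K / ε` is
  -- enough.
  obtain ⟨N, hN⟩ := ENNReal.exists_nat_gt (ENNReal.div_ne_top hK hε.ne')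
  have hN0 : (N : ENNReal) ≠ 0 := (lt_of_le_of_lt zero_le hN).ne'
  refine ⟨N, ?_⟩
  filter_upwards [h] with n hn
  have h1 : {ω | (N : ℝ) < ‖Y n ω‖} ⊆ {ω | (N : ENNReal) ≤ ‖Y n ω‖ₑ ^ 2} := by
    intro ω hω
    simp only [Set.mem_ofPred_eq] at hω ⊢
    have hN1 : (1 : ℝ) ≤ N := by
      exact_mod_cast Nat.one_le_iff_ne_zero.2 (by exact_mod_cast hN0)
    rw [← ofReal_norm, ← ENNReal.ofReal_pow (norm_nonneg _), ← ENNReal.ofReal_natCast]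
    exact ENNReal.ofReal_le_ofReal (by nlinarith)
  refine (measure_mono h1).trans
    ((meas_ge_le_lintegral_div ((hY n).enorm.pow_const 2) hN0 (by simp)).trans ?_)
  refine (ENNReal.div_le_div_right hn _).trans ?_
  rw [ENNReal.div_le_iff hN0 (by simp)]
  by_cases hε' : ε = ⊤
  · simp [hε', ENNReal.top_mul hN0]
  · rw [ENNReal.div_lt_iff (Or.inl hε.ne') (Or.inl hε')] at hN
    rw [mul_comm]
    exact hN.le

/-- An eventual bound is enough: closed balls are compact, and the finitely many remaining laws are
each tight. -/
lemma isTightMeasureSet_of_stochBdd [IsProbabilityMeasure μ] {F : Type*} [NormedAddCommGroup F]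
    [ProperSpace F] [MeasurableSpace F] [BorelSpace F] {Y : ℕ → Ω → F}
    (hm : ∀ n, AEMeasurable (Y n) μ) (hY : StochBdd μ Y) :
    IsTightMeasureSet (Set.range fun n => μ.map (Y n)) := by
  have : ∀ n, IsProbabilityMeasure (μ.map (Y n)) := fun n => Measure.isProbabilityMeasure_map (hm n)
  refine isTightMeasureSet_range_of_tendsto_limsup_measure_norm_gt ?_
  rw [ENNReal.tendsto_nhds_zero]
  intro ε hε
  obtain ⟨C, hC⟩ := hY ε hε
  filter_upwards [eventually_ge_atTop C] with r hr
  refine limsup_le_of_le (by isBoundedDefault) ?_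
  filter_upwards [hC] with n hn
  rw [Measure.map_apply_of_aemeasurable (hm n)
    (isOpen_lt continuous_const continuous_norm).measurableSet]
  exact (measure_mono fun ω hω => lt_of_le_of_lt hr hω).trans hn

/-- Boundedness in probability is checked on finitely many components. -/
lemma StochBdd.of_forall_finite {ι : Type*} [Finite ι] {F : Type*} [SeminormedAddCommGroup F]
    {Y : ι → ℕ → Ω → E} {Z : ℕ → Ω → F}
    (hY : ∀ i, StochBdd μ (Y i))
    (h : ∀ (C : ℝ) n ω, 0 ≤ C → (∀ i, ‖Y i n ω‖ ≤ C) → ‖Z n ω‖ ≤ C) : StochBdd μ Z := by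
  have := Fintype.ofFinite ι
  intro ε hε
  obtain ⟨δ, hδ, hδε⟩ : ∃ δ : ENNReal, 0 < δ ∧ (Fintype.card ι : ENNReal) * δ ≤ ε := by
    refine ⟨ε / (Fintype.card ι + 1), ENNReal.div_pos hε.ne' (by simp), ?_⟩
    rw [mul_comm]
    calc ε / (Fintype.card ι + 1) * Fintype.card ι
        ≤ ε / (Fintype.card ι + 1) * (Fintype.card ι + 1) := by gcongr; exact le_self_add
      _ = ε := ENNReal.div_mul_cancel (by simp) (by simp)
  choose C hC using fun i => hY i δ hδ
  refine ⟨∑ i, |C i|, ?_⟩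
  filter_upwards [eventually_all.2 hC] with n hn
  have h3 : {ω | ∑ i, |C i| < ‖Z n ω‖} ⊆ ⋃ i, {ω | C i < ‖Y i n ω‖} := by
    intro ω hω
    by_contra h4
    simp only [Set.mem_iUnion, Set.mem_ofPred_eq, not_exists, not_lt] at h4 hω
    refine absurd (h _ n ω (Finset.sum_nonneg fun i _ => abs_nonneg _) fun i => ?_) (not_le.2 hω)
    exact (h4 i).trans ((le_abs_self _).trans
      (Finset.single_le_sum (f := fun i => |C i|) (fun j _ => abs_nonneg _) (Finset.mem_univ i)))
  calc μ {ω | ∑ i, |C i| < ‖Z n ω‖} ≤ μ (⋃ i, {ω | C i < ‖Y i n ω‖}) := measure_mono h3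
    _ ≤ ∑ i, μ {ω | C i < ‖Y i n ω‖} := measure_iUnion_fintype_le _ _
    _ ≤ ∑ _i : ι, δ := Finset.sum_le_sum fun i _ => hn i
    _ = Fintype.card ι * δ := by simp
    _ ≤ ε := hδε

/-- If `M = B* K B'` with high probability, where `K` is bounded in probability and `B`, `B'` tend
to the identity, then `M - K` tends to zero. -/
lemma stochNull_sub_of_sandwich {t : ℕ} {M K B B' : ℕ → Ω → Matrix (Fin t) (Fin t) ℂ}
    (hK : ∀ k l, StochBdd μ (fun n ω => K n ω k l))
    (hB : ∀ k l, StochNull μ (fun n ω => B n ω k l - (1 : Matrix (Fin t) (Fin t) ℂ) k l))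
    (hB' : ∀ k l, StochNull μ (fun n ω => B' n ω k l - (1 : Matrix (Fin t) (Fin t) ℂ) k l))
    (hM : Tendsto (fun n => μ {ω | M n ω ≠ (B n ω)ᴴ * K n ω * B' n ω}) atTop (𝓝 0))
    (k l : Fin t) : StochNull μ (fun n ω => M n ω k l - K n ω k l) := by
  set I := (1 : Matrix (Fin t) (Fin t) ℂ) with hI
  have hBs : ∀ k l, StochNull μ (fun n ω => star (B n ω k l) - I k l) := by
    intro k l
    refine (hB k l).norm_le fun n ω => le_of_eq ?_
    have : star (I k l) = I k l := by rw [hI, Matrix.one_apply]; split_ifs <;> simp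
    rw [← norm_star (B n ω k l - I k l), star_sub, this]
  -- This is the coefficient of `K a b` in the `(k, l)` entry of `B* K B' - K`. Expanding around the
  -- identity leaves three terms, each with a factor that tends to zero.
  have hcoef : ∀ a b, StochNull μ (fun n ω => star (B n ω a k) * B' n ω b l - I a k * I b l) := by
    intro a b
    have h1 := (hBs a k).stochBdd.mul_stochNull (hB' b l)
    have h2 := (hB' b l).norm_le (Z := fun n ω => I a k * (B' n ω b l - I b l)) fun n ω => by
      rw [norm_mul]
      refine mul_le_of_le_one_left (norm_nonneg _) ?_
      rw [hI, Matrix.one_apply]; split_ifs <;> simp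
    have h3 := (hBs a k).norm_le (Z := fun n ω => (star (B n ω a k) - I a k) * I b l)
      fun n ω => by
      rw [norm_mul]
      refine mul_le_of_le_one_right (norm_nonneg _) ?_
      rw [hI, Matrix.one_apply]; split_ifs <;> simp
    have h4 := (h1.add h2).add h3
    refine h4.norm_le fun n ω => le_of_eq ?_
    congr 1
    ring
  have hsum := StochNull.sum (μ := μ) (Finset.univ : Finset (Fin t)) fun a _ =>
    StochNull.sum (μ := μ) (Finset.univ : Finset (Fin t)) fun b _ =>
      (hK a b).mul_stochNull (hcoef a b)
  refine hsum.congr (tendsto_of_tendsto_of_tendsto_of_le_of_le tendsto_const_nhds hM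
    (fun _ => zero_le) fun n => measure_mono fun ω hω hMω => hω ?_)
  rw [hMω]
  have h5 : K n ω k l = ∑ a, ∑ b, K n ω a b * (I a k * I b l) := by
    simp [hI, Matrix.one_apply]
  rw [h5]
  simp only [Matrix.mul_apply, Matrix.conjTranspose_apply, mul_sub, Finset.sum_sub_distrib,
    Finset.sum_mul]
  congr 1
  rw [Finset.sum_comm]
  exact Finset.sum_congr rfl fun a _ => Finset.sum_congr rfl fun b _ => by ring

end Calculus

/-! ### Normalized Gaussian sums with random weights. -/

section GaussianSums

variable {Ω Ω' κ : Type*} [MeasurableSpace Ω] [MeasurableSpace Ω'] {P : Measure Ω} {G : Measure Ω'}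
  [IsProbabilityMeasure P] [IsProbabilityMeasure G] [DecidableEq κ] {ζ : ℕ × κ → Ω' → ℂ}

/-- Normalized weighted sums of the variables `rowDev` are bounded in probability. -/
lemma IsGaussianFamily.stochBdd_sum (h : IsGaussianFamily ζ G) (a b : κ) {m : ℕ → ℕ}
    {θ : (n : ℕ) → Ω → Fin (m n) → ℝ} (hθ : ∀ n, Measurable (θ n)) {C : ℝ}
    (hC : ∀ n ω i, |θ n ω i| ≤ C) {s : ℕ → ℂ} (hs : ∀ᶠ n in atTop, ‖s n‖ ^ 2 * m n ≤ 1) :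
    StochBdd (P.prod G) (fun n x => s n * ∑ i : Fin (m n), (θ n x.1 i : ℂ) *
      rowDev ζ a b i x.2) := by
  have hmeas : ∀ n, Measurable fun x : Ω × Ω' =>
      s n * ∑ i : Fin (m n), (θ n x.1 i : ℂ) * rowDev ζ a b i x.2 := by
    intro n
    refine (Finset.measurable_sum _ fun i _ => ?_).const_mul _
    refine Measurable.mul ?_ ((h.measurable_rowDev a b i).comp measurable_snd)
    exact Complex.measurable_ofReal.comp
      ((measurable_pi_apply i).comp ((hθ n).comp measurable_fst))
  refine stochBdd_of_lintegral_le (fun n => (hmeas n).aemeasurable)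
    (K := ENNReal.ofReal (2 * C ^ 2 * rowDevBound)) ENNReal.ofReal_ne_top ?_
  filter_upwards [hs] with n hn
  rw [lintegral_prod _ ((hmeas n).enorm.pow_const 2).aemeasurable]
  have hVn : 0 ≤ rowDevBound := by unfold rowDevBound; positivity
  -- For fixed `ω` the weights are constants, and the resulting bound does not depend on `ω`.
  have h1 : ∀ ω, ∫⁻ ω', ‖s n * ∑ i : Fin (m n), (θ n ω i : ℂ) * rowDev ζ a b i ω'‖ₑ ^ 2 ∂G ≤
      ENNReal.ofReal (2 * C ^ 2 * rowDevBound) := by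
    intro ω
    simp only [enorm_mul, mul_pow]
    rw [lintegral_const_mul']
    · refine (mul_le_mul_right (h.lintegral_sum_rowDev_le a b _ (hC n ω)) _).trans ?_
      rw [← ofReal_norm, ← ENNReal.ofReal_pow (norm_nonneg _),
        ← ENNReal.ofReal_mul (by positivity), ← mul_assoc]
      refine ENNReal.ofReal_le_ofReal (mul_le_of_le_one_left (by positivity) hn)
    · simp
  refine (lintegral_mono h1).trans ?_
  simp

end GaussianSums

/-! ### Characteristic functions and the conditional central limit theorem. -/

lemma realCov_diagonal {ι : Type*} [DecidableEq ι] (r : ι → ℝ) :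
    realCov (Matrix.diagonal fun i => (r i : ℂ)) =
      Matrix.diagonal (Sum.elim (fun i => r i / 2) (fun i => r i / 2)) := by
  have h1 : (Matrix.diagonal fun i => (r i : ℂ)).map Complex.re = Matrix.diagonal r := by
    rw [Matrix.diagonal_map (by simp)]; rfl
  have h2 : (Matrix.diagonal fun i => (r i : ℂ)).map Complex.im = 0 := by
    rw [Matrix.diagonal_map (by simp)]; simp
  rw [realCov, h1, h2, neg_zero, Matrix.fromBlocks_diagonal, ← Matrix.diagonal_smul]
  congr 1
  ext (i | i) <;> simp <;> ring

lemma posSemidef_realCov_diagonal {ι : Type*} [Fintype ι] [DecidableEq ι] {r : ι → ℝ}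
    (hr : ∀ i, 0 ≤ r i) : (realCov (Matrix.diagonal fun i => (r i : ℂ))).PosSemidef := by
  rw [realCov_diagonal]
  refine Matrix.PosSemidef.diagonal fun i => ?_
  rcases i with i | i <;> exact div_nonneg (hr i) (by norm_num)

/-- The two real frequencies of each index are regrouped into one complex frequency, which is the
shape produced by conditioning on Gaussian columns. -/
lemma charFun_multivariateGaussian_realCov_diagonal {ι : Type*} [Fintype ι] [DecidableEq ι]
    {r : ι → ℝ} (hr : ∀ i, 0 ≤ r i) (u : EuclideanSpace ℝ (ι ⊕ ι)) :
    charFun (multivariateGaussian 0 (realCov (Matrix.diagonal fun i => (r i : ℂ)))) u =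
      Complex.exp (-((∑ i, ‖(⟨u (Sum.inl i), u (Sum.inr i)⟩ : ℂ)‖ ^ 2 * r i) / 4 : ℝ)) := by
  rw [charFun_multivariateGaussian (posSemidef_realCov_diagonal hr), realCov_diagonal]
  congr 1
  have h : u.ofLp ⬝ᵥ (Matrix.diagonal (Sum.elim (fun i => r i / 2) fun i => r i / 2)) *ᵥ u.ofLp =
      (∑ i, ‖(⟨u (Sum.inl i), u (Sum.inr i)⟩ : ℂ)‖ ^ 2 * r i) / 2 := by
    simp only [dotProduct, Matrix.mulVec_diagonal, Fintype.sum_sum_type, Sum.elim_inl, Sum.elim_inr,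
      ← Finset.sum_add_distrib, Finset.sum_div]
    refine Finset.sum_congr rfl fun i _ => ?_
    rw [← Complex.normSq_eq_norm_sq, Complex.normSq_mk]
    ring
  rw [h]
  simp
  ring

/-- Bounded convergence for `exp (-Y)` under convergence in probability. -/
lemma tendsto_integral_exp_neg {Ω : Type*} [MeasurableSpace Ω] {μ : Measure Ω}
    [IsProbabilityMeasure μ] {Y : ℕ → Ω → ℝ} (hm : ∀ n, Measurable (Y n)) (h0 : ∀ n ω, 0 ≤ Y n ω)
    {c : ℝ} (hc : 0 ≤ c) (h : StochNull μ (fun n ω => Y n ω - c)) :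
    Tendsto (fun n => ∫ ω, Real.exp (-Y n ω) ∂μ) atTop (𝓝 (Real.exp (-c))) := by
  have h1 : TendstoInMeasure μ Y atTop (fun _ => c) := by
    rw [tendstoInMeasure_iff_norm]; exact h
  have h2 := (h1.tendstoInDistribution fun n => (hm n).aemeasurable).tendsto
  -- The function `exp (-|x|)` is bounded on the whole line and agrees with `exp (-x)` on the
  -- nonnegative values taken by `Y`.
  let f : BoundedContinuousFunction ℝ ℝ := BoundedContinuousFunction.ofNormedAddCommGroup
    (fun x => Real.exp (-|x|)) (by fun_prop) 1 (fun x => by simp)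
  have h3 := ProbabilityMeasure.tendsto_iff_forall_integral_tendsto.1 h2 f
  simp only [ProbabilityMeasure.coe_mk] at h3
  rw [integral_map (by fun_prop) f.continuous.measurable.aestronglyMeasurable] at h3
  simp only [integral_const, probReal_univ, one_smul] at h3
  have hfc : f c = Real.exp (-c) := by simp [f, abs_of_nonneg hc]
  rw [hfc] at h3
  refine h3.congr fun n => ?_
  rw [integral_map (hm n).aemeasurable f.continuous.measurable.aestronglyMeasurable]
  refine integral_congr_ae (Eventually.of_forall fun ω => ?_)
  simp [f, abs_of_nonneg (h0 n ω)]

section GaussianLimit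

variable {Ω Ω' κ ι : Type*} [MeasurableSpace Ω] [MeasurableSpace Ω'] {P : Measure Ω}
  {G : Measure Ω'} {ζ : ℕ × κ → Ω' → ℂ}

/-- Weighted bilinear sums in the columns `a j` and `b j` of a Gaussian array. -/
def bilinSum {Ω Ω' κ ι : Type*} (ζ : ℕ × κ → Ω' → ℂ) (a b : ι → κ) {m : ℕ}
    (c : Ω → ι → Fin m → ℝ) (x : Ω × Ω') (j : ι) : ℂ :=
  ((√(m : ℝ))⁻¹ : ℝ) * ∑ i : Fin m, (c x.1 j i : ℂ) * (star (ζ (i, a j) x.2) * ζ (i, b j) x.2)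

/-- The conditional variance of `bilinSum`. -/
def condVar {Ω Ω' κ ι : Type*} (ζ : ℕ × κ → Ω' → ℂ) (a : ι → κ) {m : ℕ}
    (c : Ω → ι → Fin m → ℝ) (x : Ω × Ω') (j : ι) : ℝ :=
  (m : ℝ)⁻¹ * ∑ i : Fin m, c x.1 j i ^ 2 * ‖ζ (i, a j) x.2‖ ^ 2

lemma IsGaussianFamily.measurable_bilinSum (h : IsGaussianFamily ζ G) (a b : ι → κ) {m : ℕ}
    {c : Ω → ι → Fin m → ℝ} (hc : ∀ j, Measurable fun ω => c ω j) (j : ι) :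
    Measurable fun x => bilinSum ζ a b c x j := by
  refine (Finset.measurable_sum _ fun i _ => ?_).const_mul _
  have h1 : Measurable fun x : Ω × Ω' => ζ (i, a j) x.2 := (h.measurable _).comp measurable_snd
  have h2 : Measurable fun x : Ω × Ω' => ζ (i, b j) x.2 := (h.measurable _).comp measurable_snd
  have h3 : Measurable fun x : Ω × Ω' => star (ζ (i, a j) x.2) :=
    Complex.continuous_conj.measurable.comp h1
  exact (Complex.measurable_ofReal.comp
      ((measurable_pi_apply i).comp ((hc j).comp measurable_fst))).mul (h3.mul h2)

lemma IsGaussianFamily.measurable_condVar (h : IsGaussianFamily ζ G) (a : ι → κ) {m : ℕ}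
    {c : Ω → ι → Fin m → ℝ} (hc : ∀ j, Measurable fun ω => c ω j) (j : ι) :
    Measurable fun x => condVar ζ a c x j := by
  refine (Finset.measurable_sum _ fun i _ => ?_).const_mul _
  have h1 : Measurable fun x : Ω × Ω' => ζ (i, a j) x.2 := (h.measurable _).comp measurable_snd
  exact (((measurable_pi_apply i).comp ((hc j).comp measurable_fst)).pow_const 2).mul
    (h1.norm.pow_const 2)

lemma condVar_nonneg {Ω Ω' κ ι : Type*} (ζ : ℕ × κ → Ω' → ℂ) (a : ι → κ) {m : ℕ}
    (c : Ω → ι → Fin m → ℝ) (x : Ω × Ω') (j : ι) : 0 ≤ condVar ζ a c x j := by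
  unfold condVar; positivity

/-- The characteristic function of `bilinSum`, by conditioning on the columns `a j`. -/
lemma IsGaussianFamily.integral_exp_bilinSum [IsProbabilityMeasure P] [IsProbabilityMeasure G]
    [Fintype ι] (h : IsGaussianFamily ζ G) {a b : ι → κ}
    (hb : Function.Injective b) (hab : ∀ i j, a i ≠ b j) {m : ℕ}
    {c : Ω → ι → Fin m → ℝ} (hc : ∀ j, Measurable fun ω => c ω j) (w : ι → ℂ) :
    ∫ x, Complex.exp (((∑ j, inner ℝ (bilinSum ζ a b c x j) (w j) : ℝ) : ℂ) * Complex.I)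
        ∂(P.prod G) =
      ((∫ x, Real.exp (-((∑ j, ‖w j‖ ^ 2 * condVar ζ a c x j) / 4)) ∂(P.prod G) : ℝ) : ℂ) := by
  have hm1 : Measurable fun x : Ω × Ω' => ∑ j, inner ℝ (bilinSum ζ a b c x j) (w j) :=
    Finset.measurable_sum _ fun j _ => (h.measurable_bilinSum a b hc j).inner measurable_const
  have hm2 : Measurable fun x : Ω × Ω' => (∑ j, ‖w j‖ ^ 2 * condVar ζ a c x j) / 4 :=
    (Finset.measurable_sum _ fun j _ => (h.measurable_condVar a hc j).const_mul _).div_const _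
  rw [← integral_complex_ofReal]
  rw [integral_prod _ (Integrable.of_bound (Measurable.aestronglyMeasurable (by fun_prop)) 1
      (Eventually.of_forall fun x => by rw [Complex.norm_exp_ofReal_mul_I])),
    integral_prod _ (Integrable.of_bound (Measurable.aestronglyMeasurable (by fun_prop)) 1
      (Eventually.of_forall fun x => by
        rw [Complex.norm_real, Real.norm_of_nonneg (Real.exp_pos _).le, Real.exp_le_one_iff,
          neg_nonpos]
        exact div_nonneg (Finset.sum_nonneg fun j _ =>
          mul_nonneg (by positivity) (condVar_nonneg ζ a c x j)) (by norm_num)))]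
  congr 1
  ext ω
  -- For fixed weights, the exponent is real linear in the columns `b j`, with coefficients built
  -- from the columns `a j`. Only `b` has to be injective: the columns `a j` may repeat.
  have hcond := h.integral_exp_conditional (J₁ := ι × Fin m) (J₂ := ι × Fin m)
    (g₁ := fun j => ((j.2 : ℕ), a j.1)) (g₂ := fun j => ((j.2 : ℕ), b j.1))
    (fun j j' hj => by
      simp only [Prod.mk.injEq] at hj
      exact Prod.ext (hb hj.2) (Fin.ext hj.1))
    (fun j j' hj => hab _ _ (congrArg Prod.snd hj))
    (fun z j => ((√(m : ℝ))⁻¹ * c ω j.1 j.2 : ℝ) * (z j * w j.1))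
    (measurable_pi_lambda _ fun j => by fun_prop)
  have hl : ∀ ω', ∑ j : ι × Fin m, inner ℝ (ζ ((j.2 : ℕ), b j.1) ω')
      (((√(m : ℝ))⁻¹ * c ω j.1 j.2 : ℝ) * (ζ ((j.2 : ℕ), a j.1) ω' * w j.1)) =
      ∑ j, inner ℝ (bilinSum ζ a b c (ω, ω') j) (w j) := by
    intro ω'
    rw [Fintype.sum_prod_type]
    refine Finset.sum_congr rfl fun j _ => ?_
    rw [bilinSum, Finset.mul_sum, sum_inner]
    refine Finset.sum_congr rfl fun i _ => ?_
    simp only [Complex.inner]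
    congr 1
    simp only [map_mul, Complex.conj_ofReal, Complex.star_def, Complex.conj_conj]
    push_cast
    ring
  have hr : ∀ ω', (∑ j : ι × Fin m, ‖((√(m : ℝ))⁻¹ * c ω j.1 j.2 : ℝ) *
      (ζ ((j.2 : ℕ), a j.1) ω' * w j.1)‖ ^ 2) = ∑ j, ‖w j‖ ^ 2 * condVar ζ a c (ω, ω') j := by
    intro ω'
    rw [Fintype.sum_prod_type]
    refine Finset.sum_congr rfl fun j _ => ?_
    rw [condVar, Finset.mul_sum, Finset.mul_sum]
    refine Finset.sum_congr rfl fun i _ => ?_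
    rw [norm_mul, norm_mul, Complex.norm_real, Real.norm_eq_abs, mul_pow, sq_abs, mul_pow, mul_pow,
      inv_pow, Real.sq_sqrt (Nat.cast_nonneg m)]
    ring
  simp only [hl, hr] at hcond
  rw [hcond]
  push_cast
  rfl

/-- Conditionally on the weights, the weighted bilinear sums are asymptotically Gaussian. -/
lemma IsGaussianFamily.tendstoInDistribution_bilinSum [IsProbabilityMeasure P]
    [IsProbabilityMeasure G] [DecidableEq κ] [Fintype ι] [DecidableEq ι]
    (h : IsGaussianFamily ζ G) {a b : ι → κ}
    (hb : Function.Injective b) (hab : ∀ i j, a i ≠ b j) {m : ℕ → ℕ} (hmlim : Tendsto m atTop atTop)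
    {c : (n : ℕ) → Ω → ι → Fin (m n) → ℝ} (hc : ∀ n j, Measurable fun ω => c n ω j) {C : ℝ}
    (hC : ∀ n ω j i, |c n ω j i| ≤ C) {r : ι → ℝ}
    (hr : ∀ j, ∀ᵐ ω ∂P, Tendsto (fun n => (m n : ℝ)⁻¹ * ∑ i, c n ω j i ^ 2) atTop (𝓝 (r j)))
    (hr0 : ∀ j, 0 ≤ r j) :
    TendstoInDistribution (fun n x => bilinSum ζ a b (c n) x) atTop (id : (ι → ℂ) → (ι → ℂ))
      (fun _ => P.prod G) (complexGaussian (Matrix.diagonal fun j => (r j : ℂ))) := by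
  -- convergence of the conditional variances
  have hcv : ∀ j, StochNull (P.prod G) (fun n x => condVar ζ a (c n) x j - r j) := by
    intro j
    have hsq : ∀ n ω i, |c n ω j i ^ 2| ≤ C ^ 2 := fun n ω i => by
      rw [abs_pow]; exact pow_le_pow_left₀ (abs_nonneg _) (hC n ω j i) 2
    have hcm : ∀ n, Measurable fun ω i => c n ω j i ^ 2 := fun n =>
      measurable_pi_lambda _ fun i => ((measurable_pi_apply i).comp (hc n j)).pow_const 2
    have hb1 := h.stochBdd_sum (P := P) (a j) (a j) (m := m) (θ := fun n ω i => c n ω j i ^ 2) hcm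
      hsq
      (s := fun n => ((√(m n : ℝ))⁻¹ : ℝ)) (Eventually.of_forall fun n => by
        rw [Complex.norm_real, Real.norm_eq_abs, sq_abs, inv_pow, Real.sq_sqrt (Nat.cast_nonneg _)]
        exact inv_mul_le_one)
    have hz : Tendsto (fun n => (((√(m n : ℝ))⁻¹ : ℝ) : ℂ)) atTop (𝓝 0) := by
      have h1 : Tendsto (fun n => (√(m n : ℝ))⁻¹) atTop (𝓝 0) :=
        tendsto_inv_atTop_zero.comp (Real.tendsto_sqrt_atTop.comp
          (tendsto_natCast_atTop_atTop.comp hmlim))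
      exact_mod_cast (Complex.continuous_ofReal.tendsto 0).comp h1
    -- One factor `1/√m` keeps the centred sum bounded in probability; the second one yields a law
    -- of large numbers for the conditional variance.
    have hn1 := hb1.mul_stochNull (stochNull_of_tendsto (μ := P.prod G) hz)
    have hn2 : StochNull (P.prod G)
        (fun n (x : Ω × Ω') => ((m n : ℝ)⁻¹ * ∑ i, c n x.1 j i ^ 2) - r j) := by
      have hae : ∀ᵐ x ∂(P.prod G), Tendsto (fun n => (m n : ℝ)⁻¹ * ∑ i, c n x.1 j i ^ 2) atTop
          (𝓝 (r j)) := Measure.quasiMeasurePreserving_fst.ae (hr j)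
      have hmm : ∀ n, Measurable fun x : Ω × Ω' => (m n : ℝ)⁻¹ * ∑ i, c n x.1 j i ^ 2 := fun n =>
        (Finset.measurable_sum _ fun i _ =>
          ((measurable_pi_apply i).comp (hcm n)).comp measurable_fst).const_mul _
      have := tendstoInMeasure_of_tendsto_ae (fun n => (hmm n).aestronglyMeasurable) hae
      rw [tendstoInMeasure_iff_norm] at this
      exact this
    have hn1' : StochNull (P.prod G) (fun n (x : Ω × Ω') =>
        condVar ζ a (c n) x j - ((m n : ℝ)⁻¹ * ∑ i, c n x.1 j i ^ 2)) := by
      refine hn1.norm_le fun n x => le_of_eq ?_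
      rw [← Complex.norm_real]
      congr 1
      have hrow : ∀ i : Fin (m n), rowDev ζ (a j) (a j) i x.2 =
          ((‖ζ (i, a j) x.2‖ ^ 2 - 1 : ℝ) : ℂ) := by
        intro i
        simp only [rowDev, Complex.star_def, if_true, ← Complex.normSq_eq_conj_mul_self,
          Complex.normSq_eq_norm_sq]
        push_cast
        rfl
      simp only [hrow]
      have hsm : (((√(m n : ℝ))⁻¹ : ℝ) : ℂ) * (((√(m n : ℝ))⁻¹ : ℝ) : ℂ) = ((m n : ℝ)⁻¹ : ℝ) := by
        rw [← Complex.ofReal_mul, ← mul_inv, Real.mul_self_sqrt (Nat.cast_nonneg _)]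
      rw [mul_right_comm, hsm, condVar, ← mul_sub, ← Finset.sum_sub_distrib]
      push_cast
      congr 1
      exact Finset.sum_congr rfl fun i _ => by ring
    refine (hn1'.add hn2).norm_le fun n x => le_of_eq ?_
    congr 1
    ring
  -- The continuity theorem for characteristic functions is applied to the real coordinates, and the
  -- result is mapped back to `ι → ℂ` continuously.
  let g : EuclideanSpace ℝ (ι ⊕ ι) → (ι → ℂ) := fun x i =>
    (x (Sum.inl i) : ℂ) + (x (Sum.inr i) : ℂ) * Complex.I
  have hg : Continuous g := by fun_prop
  let V : ℕ → Ω × Ω' → EuclideanSpace ℝ (ι ⊕ ι) := fun n x =>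
    WithLp.toLp 2 (Sum.elim (fun j => (bilinSum ζ a b (c n) x j).re)
      (fun j => (bilinSum ζ a b (c n) x j).im))
  have hV : ∀ n, Measurable (V n) := by
    intro n
    refine (WithLp.measurable_toLp 2 _).comp (measurable_pi_lambda _ fun j => ?_)
    rcases j with j | j
    · exact Complex.measurable_re.comp (h.measurable_bilinSum a b (hc n) j)
    · exact Complex.measurable_im.comp (h.measurable_bilinSum a b (hc n) j)
  have hVlim : TendstoInDistribution V atTop (id : EuclideanSpace ℝ (ι ⊕ ι) → _)
      (fun _ => P.prod G)
      (multivariateGaussian 0 (realCov (Matrix.diagonal fun j => (r j : ℂ)))) := by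
    refine ⟨fun n => (hV n).aemeasurable, aemeasurable_id, ?_⟩
    refine ProbabilityMeasure.tendsto_iff_tendsto_charFun.2 fun u => ?_
    simp only [ProbabilityMeasure.coe_mk, Measure.map_id]
    rw [charFun_multivariateGaussian_realCov_diagonal hr0]
    let w : ι → ℂ := fun j => ⟨u (Sum.inl j), u (Sum.inr j)⟩
    have hcf : ∀ n, charFun ((P.prod G).map (V n)) u =
        ((∫ x, Real.exp (-((∑ j, ‖w j‖ ^ 2 *
          condVar ζ a (c n) x j) / 4)) ∂(P.prod G) : ℝ) : ℂ) := by
      intro n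
      rw [← h.integral_exp_bilinSum hb hab (hc n) w, charFun_apply,
        integral_map (hV n).aemeasurable (by fun_prop)]
      congr 1
      ext x
      congr 3
      simp only [V, w, PiLp.inner_apply, Fintype.sum_sum_type, Sum.elim_inl, Sum.elim_inr,
        ← Finset.sum_add_distrib]
      refine Finset.sum_congr rfl fun j _ => ?_
      simp [Complex.inner]
    simp only [hcf]
    rw [← Complex.ofReal_neg, ← Complex.ofReal_exp]
    refine (Complex.continuous_ofReal.tendsto _).comp ?_
    refine tendsto_integral_exp_neg (fun n => ?_) (fun n x => ?_) ?_ ?_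
    · exact (Finset.measurable_sum _ fun j _ =>
        (h.measurable_condVar a (hc n) j).const_mul _).div_const _
    · exact div_nonneg (Finset.sum_nonneg fun j _ =>
          mul_nonneg (by positivity) (condVar_nonneg ζ a (c n) x j)) (by norm_num)
    · exact div_nonneg (Finset.sum_nonneg fun j _ => mul_nonneg (by positivity) (hr0 j))
        (by norm_num)
    · have hsum := StochNull.sum (μ := P.prod G) (Finset.univ : Finset ι) fun j _ =>
        (stochBdd_of_norm_le (μ := P.prod G) (Y := fun _ _ => ((‖w j‖ ^ 2 / 4 : ℝ) : ℂ))
          (fun _ _ => le_rfl)).mul_stochNull ((hcv j).norm_le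
            (Z := fun n x => ((condVar ζ a (c n) x j - r j : ℝ) : ℂ))
            fun n x => by rw [Complex.norm_real])
      refine hsum.norm_le fun n x => le_of_eq ?_
      rw [← Complex.norm_real]
      congr 1
      push_cast
      rw [← sub_div, ← Finset.sum_sub_distrib, Finset.sum_div]
      exact Finset.sum_congr rfl fun j _ => by simp only [w]; ring
  have hcomp := hVlim.continuous_comp hg
  have hgV : ∀ n, g ∘ V n = fun x => bilinSum ζ a b (c n) x := by
    intro n
    ext x j
    simp [g, V, Complex.re_add_im]
  have hmb : ∀ n, Measurable fun x => bilinSum ζ a b (c n) x := fun n =>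
    measurable_pi_lambda _ fun j => h.measurable_bilinSum a b (hc n) j
  refine ⟨fun n => (hmb n).aemeasurable, aemeasurable_id, ?_⟩
  have htend := hcomp.tendsto
  simp only [hgV, Function.comp_id] at htend
  simp only [Measure.map_id]
  exact htend

end GaussianLimit

/-! ### Gaussian matrices and the concentration of their Gram matrices. -/

/-- The matrix with the entries `ζ (i, col k) / √m`. -/
def gaussMat {Ω' κ : Type*} {t : ℕ} (ζ : ℕ × κ → Ω' → ℂ) (col : Fin t → κ) (m : ℕ) (ω : Ω') :
    Matrix (Fin m) (Fin t) ℂ :=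
  Matrix.of fun i k => (((√(m : ℝ))⁻¹ : ℝ) : ℂ) * ζ ((i : ℕ), col k) ω

lemma sqrt_inv_mul_self (m : ℕ) :
    (((√(m : ℝ))⁻¹ : ℝ) : ℂ) * (((√(m : ℝ))⁻¹ : ℝ) : ℂ) = (m : ℂ)⁻¹ := by
  rw [← Complex.ofReal_mul, ← mul_inv, Real.mul_self_sqrt (Nat.cast_nonneg _)]
  simp

lemma sqrt_mul_sqrt_inv {m : ℕ} (hm : 0 < m) :
    ((√(m : ℝ) : ℝ) : ℂ) * (((√(m : ℝ))⁻¹ : ℝ) : ℂ) = 1 := by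
  rw [← Complex.ofReal_mul, mul_inv_cancel₀ (Real.sqrt_ne_zero'.2 (by exact_mod_cast hm))]
  simp

lemma norm_sqrt_inv_sq (m : ℕ) : ‖(((√(m : ℝ))⁻¹ : ℝ) : ℂ)‖ ^ 2 = (m : ℝ)⁻¹ := by
  rw [Complex.norm_real, Real.norm_eq_abs, sq_abs, inv_pow, Real.sq_sqrt (Nat.cast_nonneg _)]

lemma rowDev_add {Ω' κ : Type*} [DecidableEq κ] (ζ : ℕ × κ → Ω' → ℂ) (a b : κ) (i : ℕ) (ω : Ω') :
    star (ζ (i, a) ω) * ζ (i, b) ω = rowDev ζ a b i ω + if a = b then 1 else 0 := by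
  rw [rowDev, sub_add_cancel]

section GaussMat

variable {Ω Ω' κ : Type*} [MeasurableSpace Ω] [MeasurableSpace Ω'] {P : Measure Ω} {G : Measure Ω'}
  {t : ℕ} {ζ : ℕ × κ → Ω' → ℂ} {col : Fin t → κ}

lemma IsGaussianFamily.measurable_gaussMat (h : IsGaussianFamily ζ G) (col : Fin t → κ) (m : ℕ) :
    Measurable (gaussMat ζ col m) :=
  measurable_matrix_iff.2 fun i k => (h.measurable ((i : ℕ), col k)).const_mul _

lemma IsGaussianFamily.indepFun_gaussMat (h : IsGaussianFamily ζ G) {col col' : Fin t → κ}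
    (hcol : ∀ k l, col k ≠ col' l) (m m' : ℕ) :
    IndepFun (gaussMat ζ col m) (gaussMat ζ col' m') G := by
  have h1 := h.indepFun_disjoint (J₁ := Fin m × Fin t) (J₂ := Fin m' × Fin t)
    (fun j => ((j.1 : ℕ), col j.2)) (fun j => ((j.1 : ℕ), col' j.2))
    (fun i j hij => hcol _ _ (congrArg Prod.snd hij))
  have hφ : ∀ m : ℕ, Measurable fun (z : Fin m × Fin t → ℂ) =>
      (Matrix.of fun i k => (((√(m : ℝ))⁻¹ : ℝ) : ℂ) * z (i, k) : Matrix (Fin m) (Fin t) ℂ) := by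
    intro m
    refine measurable_matrix_iff.2 fun i k => ?_
    simp only [Matrix.of_apply]
    fun_prop
  exact h1.comp (hφ m) (hφ m')

lemma IsGaussianFamily.map_gaussMat_unitary [IsProbabilityMeasure G] (h : IsGaussianFamily ζ G)
    (hcol : Function.Injective col) (m : ℕ) (V : Matrix.unitaryGroup (Fin m) ℂ) :
    (G.map (gaussMat ζ col m)).map (fun y => (V : Matrix (Fin m) (Fin m) ℂ)ᴴ * y) =
      G.map (gaussMat ζ col m) :=
  h.map_unitary_mul (g := fun j : Fin m × Fin t => ((j.1 : ℕ), col j.2))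
    (fun i j hij => by
      simp only [Prod.mk.injEq] at hij
      exact Prod.ext (Fin.ext hij.1) (hcol hij.2)) _ V

variable [IsProbabilityMeasure P] [IsProbabilityMeasure G] [DecidableEq κ]

/-- The Gram matrix is within `O(1/√m)` of the identity. -/
lemma IsGaussianFamily.stochBdd_gram (h : IsGaussianFamily ζ G) (hcol : Function.Injective col)
    {m : ℕ → ℕ} (hm : ∀ᶠ n in atTop, 0 < m n) (k l : Fin t) :
    StochBdd (P.prod G) (fun n x => ((√(m n : ℝ) : ℝ) : ℂ) *
      (((gaussMat ζ col (m n) x.2)ᴴ * gaussMat ζ col (m n) x.2) k l -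
        (1 : Matrix (Fin t) (Fin t) ℂ) k l)) := by
  have hb := h.stochBdd_sum (P := P) (col k) (col l) (m := m) (θ := fun _ _ _ => 1)
    (fun n => measurable_const) (C := 1) (fun _ _ _ => by simp)
    (s := fun n => (((√(m n : ℝ))⁻¹ : ℝ) : ℂ)) (Eventually.of_forall fun n => by
      rw [norm_sqrt_inv_sq]; exact inv_mul_le_one)
  refine hb.of_norm_le ?_
  filter_upwards [hm] with n hn
  intro x
  refine le_of_eq (congrArg norm ?_)
  have h1 : (1 : Matrix (Fin t) (Fin t) ℂ) k l = if col k = col l then 1 else 0 := by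
    simp [Matrix.one_apply, hcol.eq_iff]
  have hm0 : (m n : ℂ) ≠ 0 := by exact_mod_cast hn.ne'
  have h2 : ((gaussMat ζ col (m n) x.2)ᴴ * gaussMat ζ col (m n) x.2) k l =
      (m n : ℂ)⁻¹ * ∑ i : Fin (m n), (rowDev ζ (col k) (col l) i x.2 +
        if col k = col l then 1 else 0) := by
    simp only [Matrix.mul_apply, Matrix.conjTranspose_apply, gaussMat, Matrix.of_apply,
      ← rowDev_add, Finset.mul_sum, ← sqrt_inv_mul_self]
    refine Finset.sum_congr rfl fun i _ => ?_
    simp only [star_mul', Complex.star_def, Complex.conj_ofReal]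
    ring
  rw [h1, h2, Finset.sum_add_distrib, mul_add]
  simp only [Finset.sum_const, Finset.card_univ, Fintype.card_fin, nsmul_eq_mul]
  rw [← mul_assoc _ (m n : ℂ), inv_mul_cancel₀ hm0, one_mul, add_sub_cancel_right, ← mul_assoc,
    ← sqrt_inv_mul_self, ← mul_assoc, sqrt_mul_sqrt_inv hn]
  simp

lemma IsGaussianFamily.stochNull_gram (h : IsGaussianFamily ζ G) (hcol : Function.Injective col)
    {m : ℕ → ℕ} (hm : Tendsto m atTop atTop) (k l : Fin t) :
    StochNull (P.prod G) (fun n x =>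
      ((gaussMat ζ col (m n) x.2)ᴴ * gaussMat ζ col (m n) x.2) k l -
        (1 : Matrix (Fin t) (Fin t) ℂ) k l) := by
  have hz : Tendsto (fun n => (((√(m n : ℝ))⁻¹ : ℝ) : ℂ)) atTop (𝓝 0) := by
    have h1 : Tendsto (fun n => (√(m n : ℝ))⁻¹) atTop (𝓝 0) :=
      tendsto_inv_atTop_zero.comp (Real.tendsto_sqrt_atTop.comp
        (tendsto_natCast_atTop_atTop.comp hm))
    exact_mod_cast (Complex.continuous_ofReal.tendsto 0).comp h1
  have h0 := hm.eventually_gt_atTop 0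
  have hn := (h.stochBdd_gram (P := P) hcol h0 k l).mul_stochNull
    (stochNull_of_tendsto (μ := P.prod G) hz)
  refine hn.congr (tendsto_const_nhds.congr' ?_)
  filter_upwards [h0] with n hn
  symm
  rw [measure_eq_zero_iff_ae_notMem]
  refine Eventually.of_forall fun x hx => hx ?_
  rw [mul_right_comm, sqrt_mul_sqrt_inv hn, one_mul]

/-- The square root of the Gram matrix is invertible with high probability, and its inverse tends to
the identity. -/
lemma IsGaussianFamily.gramSqrt_inv (h : IsGaussianFamily ζ G) (hcol : Function.Injective col)
    {m : ℕ → ℕ} (hm : Tendsto m atTop atTop) :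
    Tendsto (fun n => (P.prod G) {x | ¬ IsUnit (gramSqrt (gaussMat ζ col (m n) x.2)).det}) atTop
        (𝓝 0) ∧
      ∀ k l, StochNull (P.prod G) (fun n x => (gramSqrt (gaussMat ζ col (m n) x.2))⁻¹ k l -
        (1 : Matrix (Fin t) (Fin t) ℂ) k l) := by
  have hfar : ∀ δ > 0, Tendsto (fun n => (P.prod G) {x | ¬ ∀ k l,
      ‖((gaussMat ζ col (m n) x.2)ᴴ * gaussMat ζ col (m n) x.2) k l -
        (1 : Matrix (Fin t) (Fin t) ℂ) k l‖ < δ}) atTop (𝓝 0) := by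
    intro δ hδ
    have hsum := tendsto_finsetSum (Finset.univ : Finset (Fin t × Fin t)) fun kl _ =>
      h.stochNull_gram (P := P) hcol hm kl.1 kl.2 δ hδ
    simp only [Finset.sum_const_zero] at hsum
    refine tendsto_of_tendsto_of_tendsto_of_le_of_le tendsto_const_nhds hsum (fun _ => zero_le)
      fun n => (measure_mono fun x hx => ?_).trans (measure_iUnion_fintype_le _ _)
    simp only [Set.mem_ofPred_eq, not_forall, not_lt] at hx
    obtain ⟨k, l, hkl⟩ := hx
    exact Set.mem_iUnion.2 ⟨(k, l), hkl⟩
  constructor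
  · obtain ⟨δ, hδ, hh⟩ := exists_gramSqrt_inv_close t one_pos
    refine tendsto_of_tendsto_of_tendsto_of_le_of_le tendsto_const_nhds (hfar δ hδ)
      (fun _ => zero_le) fun n => measure_mono fun x hx hx' => hx (hh _ _ hx').1
  · intro k l ε hε
    obtain ⟨δ, hδ, hh⟩ := exists_gramSqrt_inv_close t hε
    refine tendsto_of_tendsto_of_tendsto_of_le_of_le tendsto_const_nhds (hfar δ hδ)
      (fun _ => zero_le) fun n => measure_mono fun x hx hx' =>
        absurd hx (not_le.2 ((hh _ _ hx').2 k l))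

end GaussMat

/-! ### Comparison of the three blocks with Gaussian forms. -/

/-- Undoing the multiplication by invertible matrices. -/
lemma eq_inv_mul_mul_inv {t : ℕ} {A A' M : Matrix (Fin t) (Fin t) ℂ} (hA : IsUnit A.det)
    (hA' : IsUnit A'.det) : M = (A⁻¹)ᴴ * (Aᴴ * M * A') * A'⁻¹ := by
  have h1 : (A⁻¹)ᴴ * Aᴴ = 1 := by
    rw [← Matrix.conjTranspose_mul, Matrix.mul_nonsing_inv _ hA, Matrix.conjTranspose_one]
  rw [Matrix.mul_assoc Aᴴ, ← Matrix.mul_assoc _ Aᴴ, h1, Matrix.one_mul, Matrix.mul_assoc,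
    Matrix.mul_nonsing_inv _ hA', Matrix.mul_one]

lemma measurable_form {α : Type*} [MeasurableSpace α] {p t : ℕ} {c : α → Fin p → ℝ}
    (hc : Measurable c) {a b : α → Matrix (Fin p) (Fin t) ℂ} (ha : Measurable a)
    (hb : Measurable b) : Measurable fun x => form (c x) (a x) (b x) := by
  have hd : Measurable fun x => (Matrix.diagonal fun i => (c x i : ℂ)) := by
    refine measurable_matrix_iff.2 fun i j => ?_
    simp only [Matrix.diagonal_apply]
    split_ifs
    · exact Complex.measurable_ofReal.comp ((measurable_pi_apply i).comp hc)
    · exact measurable_const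
  unfold form
  fun_prop

section Blocks

variable {Ω Ω' : Type*} [MeasurableSpace Ω] [MeasurableSpace Ω'] {P : Measure Ω} {G : Measure Ω'}
  [IsProbabilityMeasure P] [IsProbabilityMeasure G] {t : ℕ}
  {ζ : ℕ × (Fin t ⊕ Fin t) → Ω' → ℂ} {N : ℕ → ℕ} {hN : ∀ n, N n ≤ n}
  {Γ : (n : ℕ) → Ω → Fin (N n) → ℝ} {S St : (n : ℕ) → Ω → Matrix (Fin (N n)) (Fin t) ℂ}

/-- The matrices `S` and `St`, multiplied by the square roots of the Gram matrices of Gaussian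
matrices, are distributed as (submatrices of) these Gaussian matrices, jointly with `Γ`. -/
def IsWhitened (P : Measure Ω) (G : Measure Ω') (ζ : ℕ × (Fin t ⊕ Fin t) → Ω' → ℂ)
    (hN : ∀ n, N n ≤ n) (Γ : (n : ℕ) → Ω → Fin (N n) → ℝ)
    (S St : (n : ℕ) → Ω → Matrix (Fin (N n)) (Fin t) ℂ) : Prop :=
  ∀ᶠ n in atTop, IdentDistrib
    (fun x : Ω × Ω' => (Γ n x.1, S n x.1 * gramSqrt (gaussMat ζ Sum.inl (N n) x.2),
      St n x.1 * gramSqrt (gaussMat ζ Sum.inr n x.2)))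
    (fun x : Ω × Ω' => (Γ n x.1, gaussMat ζ Sum.inl (N n) x.2,
      (gaussMat ζ Sum.inr n x.2).submatrix (Fin.castLE (hN n)) id)) (P.prod G) (P.prod G)

lemma form_gaussMat_left {Ω' : Type*} (ζ : ℕ × (Fin t ⊕ Fin t) → Ω' → ℂ) {p : ℕ} (hp : 0 < p)
    (c : Fin p → ℝ)
    (k l : Fin t) (ω : Ω') :
    ((√(p : ℝ) : ℝ) : ℂ) * form c (gaussMat ζ Sum.inl p ω) (gaussMat ζ Sum.inl p ω) k l =
      (((√(p : ℝ))⁻¹ : ℝ) : ℂ) * ∑ i : Fin p, (c i : ℂ) *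
        (star (ζ (i, Sum.inl k) ω) * ζ (i, Sum.inl l) ω) := by
  rw [form_apply, Finset.mul_sum, Finset.mul_sum]
  refine Finset.sum_congr rfl fun i _ => ?_
  simp only [gaussMat, Matrix.of_apply, star_mul', Complex.star_def, Complex.conj_ofReal]
  linear_combination ((((√(p : ℝ))⁻¹ : ℝ) : ℂ) * (c i : ℂ) *
    (starRingEnd ℂ (ζ (i, Sum.inl k) ω) * ζ (i, Sum.inl l) ω)) * sqrt_mul_sqrt_inv hp

/-- The entries on the left carry `1/√p` and those on the right `1/√q`; the prefactor `√q` cancels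
the latter. The mixed block thus has the same normalization `1/√p` as the left one, where the
prefactor is `√p`. -/
lemma form_gaussMat_mixed {Ω' : Type*} (ζ : ℕ × (Fin t ⊕ Fin t) → Ω' → ℂ) {p q : ℕ} (hpq : p ≤ q)
    (hq : 0 < q)
    (c : Fin p → ℝ) (k l : Fin t) (ω : Ω') :
    ((√(q : ℝ) : ℝ) : ℂ) * form c (gaussMat ζ Sum.inl p ω)
        ((gaussMat ζ Sum.inr q ω).submatrix (Fin.castLE hpq) id) k l =
      (((√(p : ℝ))⁻¹ : ℝ) : ℂ) * ∑ i : Fin p, (c i : ℂ) *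
        (star (ζ (i, Sum.inl k) ω) * ζ (i, Sum.inr l) ω) := by
  rw [form_apply, Finset.mul_sum, Finset.mul_sum]
  refine Finset.sum_congr rfl fun i _ => ?_
  simp only [gaussMat, Matrix.of_apply, star_mul', Complex.star_def, Complex.conj_ofReal,
    Matrix.submatrix_apply, Fin.val_castLE, id]
  linear_combination ((((√(p : ℝ))⁻¹ : ℝ) : ℂ) * (c i : ℂ) *
    (starRingEnd ℂ (ζ (i, Sum.inl k) ω) * ζ (i, Sum.inr l) ω)) * sqrt_mul_sqrt_inv hq

lemma form_gaussMat_right {Ω' : Type*} (ζ : ℕ × (Fin t ⊕ Fin t) → Ω' → ℂ) {p q : ℕ} (hpq : p ≤ q)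
    (hq : 0 < q)
    (c : Fin p → ℝ) (k l : Fin t) (ω : Ω') :
    ((√(q : ℝ) : ℝ) : ℂ) * form c ((gaussMat ζ Sum.inr q ω).submatrix (Fin.castLE hpq) id)
        ((gaussMat ζ Sum.inr q ω).submatrix (Fin.castLE hpq) id) k l =
      (((√(q : ℝ))⁻¹ : ℝ) : ℂ) * ∑ i : Fin p, (c i : ℂ) *
        (star (ζ (i, Sum.inr k) ω) * ζ (i, Sum.inr l) ω) := by
  rw [form_apply, Finset.mul_sum, Finset.mul_sum]
  refine Finset.sum_congr rfl fun i _ => ?_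
  simp only [gaussMat, Matrix.of_apply, star_mul', Complex.star_def, Complex.conj_ofReal,
    Matrix.submatrix_apply, Fin.val_castLE, id]
  linear_combination ((((√(q : ℝ))⁻¹ : ℝ) : ℂ) * (c i : ℂ) *
    (starRingEnd ℂ (ζ (i, Sum.inr k) ω) * ζ (i, Sum.inr l) ω)) * sqrt_mul_sqrt_inv hq

/-- The left block: boundedness of the whitened form, and comparison with the form itself. -/
lemma left_block (h : IsGaussianFamily ζ G) (hw : IsWhitened P G ζ hN Γ S St)
    (hNlim : Tendsto N atTop atTop) (hΓ : ∀ n, Measurable (Γ n))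
    {c : (n : ℕ) → (Fin (N n) → ℝ) → Fin (N n) → ℝ} (hc : ∀ n, Measurable (c n)) {C : ℝ}
    (hC : ∀ n g i, |c n g i| ≤ C) (hsum : ∀ᶠ n in atTop, ∀ g, ∑ i, c n g i = 0) (k l : Fin t) :
    StochBdd (P.prod G) (fun n x => ((√(N n : ℝ) : ℝ) : ℂ) * form (c n (Γ n x.1))
        (S n x.1 * gramSqrt (gaussMat ζ Sum.inl (N n) x.2))
        (S n x.1 * gramSqrt (gaussMat ζ Sum.inl (N n) x.2)) k l) ∧
      StochNull (P.prod G) (fun n x =>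
        ((√(N n : ℝ) : ℝ) : ℂ) * form (c n (Γ n x.1)) (S n x.1) (S n x.1) k l -
        ((√(N n : ℝ) : ℝ) : ℂ) * form (c n (Γ n x.1))
          (S n x.1 * gramSqrt (gaussMat ζ Sum.inl (N n) x.2))
          (S n x.1 * gramSqrt (gaussMat ζ Sum.inl (N n) x.2)) k l) := by
  have hK : ∀ k l, StochBdd (P.prod G) (fun n x => ((√(N n : ℝ) : ℝ) : ℂ) * form (c n (Γ n x.1))
        (S n x.1 * gramSqrt (gaussMat ζ Sum.inl (N n) x.2))
        (S n x.1 * gramSqrt (gaussMat ζ Sum.inl (N n) x.2)) k l) := by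
    intro k l
    have hb := h.stochBdd_sum (P := P) (Sum.inl k) (Sum.inl l) (m := N)
      (θ := fun n ω => c n (Γ n ω)) (fun n => (hc n).comp (hΓ n)) (C := C) (fun _ _ _ => hC _ _ _)
      (s := fun n => (((√(N n : ℝ))⁻¹ : ℝ) : ℂ)) (Eventually.of_forall fun n => by
        rw [norm_sqrt_inv_sq]; exact inv_mul_le_one)
    have hb' : StochBdd (P.prod G) (fun n x => ((√(N n : ℝ) : ℝ) : ℂ) * form (c n (Γ n x.1))
        (gaussMat ζ Sum.inl (N n) x.2) (gaussMat ζ Sum.inl (N n) x.2) k l) := by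
      refine hb.of_norm_le ?_
      filter_upwards [hsum, hNlim.eventually_gt_atTop 0] with n hn hn0
      intro x
      rw [form_gaussMat_left ζ hn0]
      refine le_of_eq (congrArg norm ?_)
      congr 1
      -- The means of the products contribute a multiple of the sum of the weights, which is zero.
      simp only [rowDev_add, mul_add, Finset.sum_add_distrib, ← Finset.sum_mul]
      rw [← Complex.ofReal_sum, hn]
      simp
    refine hb'.of_identDistrib ?_
    filter_upwards [hw] with n hn
    refine hn.comp (u := fun z : (Fin (N n) → ℝ) × Matrix (Fin (N n)) (Fin t) ℂ ×
      Matrix (Fin (N n)) (Fin t) ℂ => ((√(N n : ℝ) : ℝ) : ℂ) * form (c n z.1) z.2.1 z.2.1 k l) ?_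
    exact (measurable_matrix_iff.1 (measurable_form ((hc n).comp measurable_fst) (by fun_prop)
      (by fun_prop)) k l).const_mul _
  refine ⟨hK k l, ?_⟩
  obtain ⟨hdet, hinv⟩ := h.gramSqrt_inv (P := P) Sum.inl_injective hNlim
  have := stochNull_sub_of_sandwich (μ := P.prod G)
    (M := fun n x => ((√(N n : ℝ) : ℝ) : ℂ) • form (c n (Γ n x.1)) (S n x.1) (S n x.1))
    (K := fun n x => ((√(N n : ℝ) : ℝ) : ℂ) • form (c n (Γ n x.1))
          (S n x.1 * gramSqrt (gaussMat ζ Sum.inl (N n) x.2))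
          (S n x.1 * gramSqrt (gaussMat ζ Sum.inl (N n) x.2)))
    (B := fun n x => (gramSqrt (gaussMat ζ Sum.inl (N n) x.2))⁻¹)
    (B' := fun n x => (gramSqrt (gaussMat ζ Sum.inl (N n) x.2))⁻¹)
    (fun k l => by simpa using hK k l) hinv hinv
    (tendsto_of_tendsto_of_tendsto_of_le_of_le tendsto_const_nhds hdet (fun _ => zero_le)
      fun n => measure_mono fun x hx hdet => hx (by
        rw [form_mul, Matrix.mul_smul, Matrix.smul_mul, ← eq_inv_mul_mul_inv hdet hdet])) k l
  simpa using this

/-- The mixed block: boundedness of the whitened form, and comparison with the form itself. -/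
lemma mixed_block (h : IsGaussianFamily ζ G) (hw : IsWhitened P G ζ hN Γ S St)
    (hNlim : Tendsto N atTop atTop) (hΓ : ∀ n, Measurable (Γ n))
    {c : (n : ℕ) → (Fin (N n) → ℝ) → Fin (N n) → ℝ} (hc : ∀ n, Measurable (c n)) {C : ℝ}
    (hC : ∀ n g i, |c n g i| ≤ C) (k l : Fin t) :
    StochBdd (P.prod G) (fun n x => ((√(n : ℝ) : ℝ) : ℂ) * form (c n (Γ n x.1))
        (S n x.1 * gramSqrt (gaussMat ζ Sum.inl (N n) x.2))
        (St n x.1 * gramSqrt (gaussMat ζ Sum.inr n x.2)) k l) ∧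
      StochNull (P.prod G) (fun n x =>
        ((√(n : ℝ) : ℝ) : ℂ) * form (c n (Γ n x.1)) (S n x.1) (St n x.1) k l -
        ((√(n : ℝ) : ℝ) : ℂ) * form (c n (Γ n x.1))
          (S n x.1 * gramSqrt (gaussMat ζ Sum.inl (N n) x.2))
          (St n x.1 * gramSqrt (gaussMat ζ Sum.inr n x.2)) k l) := by
  have hK : ∀ k l, StochBdd (P.prod G) (fun n x => ((√(n : ℝ) : ℝ) : ℂ) * form (c n (Γ n x.1))
        (S n x.1 * gramSqrt (gaussMat ζ Sum.inl (N n) x.2))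
        (St n x.1 * gramSqrt (gaussMat ζ Sum.inr n x.2)) k l) := by
    intro k l
    have hb := h.stochBdd_sum (P := P) (Sum.inl k) (Sum.inr l) (m := N)
      (θ := fun n ω => c n (Γ n ω)) (fun n => (hc n).comp (hΓ n)) (C := C) (fun _ _ _ => hC _ _ _)
      (s := fun n => (((√(N n : ℝ))⁻¹ : ℝ) : ℂ)) (Eventually.of_forall fun n => by
        rw [norm_sqrt_inv_sq]; exact inv_mul_le_one)
    have hb' : StochBdd (P.prod G) (fun n x => ((√(n : ℝ) : ℝ) : ℂ) * form (c n (Γ n x.1))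
        (gaussMat ζ Sum.inl (N n) x.2)
        ((gaussMat ζ Sum.inr n x.2).submatrix (Fin.castLE (hN n)) id) k l) := by
      refine hb.of_norm_le ?_
      filter_upwards [eventually_gt_atTop 0] with n hn0
      intro x
      rw [form_gaussMat_mixed ζ (hN n) hn0]
      -- The two columns come from different halves of the index set, so the products need no
      -- centring.
      simp [rowDev]
    refine hb'.of_identDistrib ?_
    filter_upwards [hw] with n hn
    refine hn.comp (u := fun z : (Fin (N n) → ℝ) × Matrix (Fin (N n)) (Fin t) ℂ ×
      Matrix (Fin (N n)) (Fin t) ℂ => ((√(n : ℝ) : ℝ) : ℂ) * form (c n z.1) z.2.1 z.2.2 k l) ?_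
    exact (measurable_matrix_iff.1 (measurable_form ((hc n).comp measurable_fst) (by fun_prop)
      (by fun_prop)) k l).const_mul _
  refine ⟨hK k l, ?_⟩
  obtain ⟨hdet, hinv⟩ := h.gramSqrt_inv (P := P) Sum.inl_injective hNlim
  obtain ⟨hdet', hinv'⟩ := h.gramSqrt_inv (P := P) Sum.inr_injective (m := fun n => n) tendsto_id
  have hdd := hdet.add hdet'
  rw [add_zero] at hdd
  have := stochNull_sub_of_sandwich (μ := P.prod G)
    (M := fun n x => ((√(n : ℝ) : ℝ) : ℂ) • form (c n (Γ n x.1)) (S n x.1) (St n x.1))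
    (K := fun n x => ((√(n : ℝ) : ℝ) : ℂ) • form (c n (Γ n x.1))
          (S n x.1 * gramSqrt (gaussMat ζ Sum.inl (N n) x.2))
          (St n x.1 * gramSqrt (gaussMat ζ Sum.inr n x.2)))
    (B := fun n x => (gramSqrt (gaussMat ζ Sum.inl (N n) x.2))⁻¹)
    (B' := fun n x => (gramSqrt (gaussMat ζ Sum.inr n x.2))⁻¹)
    (fun k l => by simpa using hK k l) hinv hinv'
    (tendsto_of_tendsto_of_tendsto_of_le_of_le tendsto_const_nhds hdd (fun _ => zero_le)
      fun n => (measure_mono fun x hx => by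
        by_contra hu
        simp only [Set.mem_union, Set.mem_ofPred_eq, not_or, not_not] at hu
        refine hx ?_
        rw [form_mul, Matrix.mul_smul, Matrix.smul_mul, ← eq_inv_mul_mul_inv hu.1 hu.2]).trans
          (measure_union_le _ _)) k l
  simpa using this

/-- The right block is bounded in probability. -/
lemma right_block (h : IsGaussianFamily ζ G) (hw : IsWhitened P G ζ hN Γ S St)
    (hΓ : ∀ n, Measurable (Γ n))
    {c : (n : ℕ) → (Fin (N n) → ℝ) → Fin (N n) → ℝ} (hc : ∀ n, Measurable (c n)) {C : ℝ}
    (hC : ∀ n g i, |c n g i| ≤ C) (k l : Fin t) :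
    StochBdd (P.prod G) (fun n x => ((√(n : ℝ) : ℝ) : ℂ) *
      (form (c n (Γ n x.1)) (St n x.1) (St n x.1) k l -
        (((n : ℝ)⁻¹ * ∑ i, c n (Γ n x.1) i : ℝ) : ℂ) * (1 : Matrix (Fin t) (Fin t) ℂ) k l)) := by
  let avg : (n : ℕ) → (Fin (N n) → ℝ) → ℂ := fun n g => (((n : ℝ)⁻¹ * ∑ i, c n g i : ℝ) : ℂ)
  have havg : ∀ n, Measurable (avg n) := fun n => Complex.measurable_ofReal.comp
    ((Finset.measurable_sum _ fun i _ => (measurable_pi_apply i).comp (hc n)).const_mul _)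
  have havgC : ∀ n g, ‖avg n g‖ ≤ |C| := by
    intro n g
    rw [Complex.norm_real, norm_mul, norm_inv, Real.norm_natCast]
    rcases Nat.eq_zero_or_pos n with h0 | h0
    · simp [h0]
    · have h0' : (0 : ℝ) < n := by exact_mod_cast h0
      rw [inv_mul_le_iff₀ h0']
      refine (norm_sum_le _ _).trans ((Finset.sum_le_sum fun i _ =>
        (hC n g i).trans (le_abs_self C)).trans ?_)
      simp only [Finset.sum_const, Finset.card_univ, Fintype.card_fin, nsmul_eq_mul]
      exact mul_le_mul_of_nonneg_right (by exact_mod_cast hN n) (abs_nonneg _)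
  let A : ℕ → Ω × Ω' → Matrix (Fin t) (Fin t) ℂ := fun n x => gramSqrt (gaussMat ζ Sum.inr n x.2)
  have hK₁ : ∀ k l, StochBdd (P.prod G) (fun n x => ((√(n : ℝ) : ℝ) : ℂ) *
      (form (c n (Γ n x.1)) (St n x.1 * A n x) (St n x.1 * A n x) k l -
        avg n (Γ n x.1) * (1 : Matrix (Fin t) (Fin t) ℂ) k l)) := by
    intro k l
    have hb := h.stochBdd_sum (P := P) (Sum.inr k) (Sum.inr l) (m := N)
      (θ := fun n ω => c n (Γ n ω)) (fun n => (hc n).comp (hΓ n)) (C := C) (fun _ _ _ => hC _ _ _)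
      (s := fun n => (((√(n : ℝ))⁻¹ : ℝ) : ℂ)) (Eventually.of_forall fun n => by
        rw [norm_sqrt_inv_sq]
        exact (mul_le_mul_of_nonneg_left (by exact_mod_cast hN n) (by positivity)).trans
          inv_mul_le_one)
    have hb' : StochBdd (P.prod G) (fun n x => ((√(n : ℝ) : ℝ) : ℂ) *
        (form (c n (Γ n x.1)) ((gaussMat ζ Sum.inr n x.2).submatrix (Fin.castLE (hN n)) id)
          ((gaussMat ζ Sum.inr n x.2).submatrix (Fin.castLE (hN n)) id) k l -
        avg n (Γ n x.1) * (1 : Matrix (Fin t) (Fin t) ℂ) k l)) := by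
      refine hb.of_norm_le ?_
      filter_upwards [eventually_gt_atTop 0] with n hn0
      intro x
      refine le_of_eq (congrArg norm ?_)
      have h1 : (1 : Matrix (Fin t) (Fin t) ℂ) k l =
          if (Sum.inr k : Fin t ⊕ Fin t) = Sum.inr l then 1 else 0 := by
        simp [Matrix.one_apply]
      have h2 : ((√(n : ℝ) : ℝ) : ℂ) * avg n (Γ n x.1) =
          (((√(n : ℝ))⁻¹ : ℝ) : ℂ) * ∑ i, (c n (Γ n x.1) i : ℂ) := by
        simp only [avg]
        push_cast
        have h3 := sqrt_inv_mul_self n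
        have h4 := sqrt_mul_sqrt_inv hn0
        push_cast at h3 h4
        rw [← h3]
        linear_combination ((((√(n : ℝ)) : ℝ) : ℂ)⁻¹ * ∑ i, (c n (Γ n x.1) i : ℂ)) * h4
      rw [mul_sub, form_gaussMat_right ζ (hN n) hn0, ← mul_assoc, h2, h1]
      simp only [rowDev_add, mul_add, Finset.sum_add_distrib, ← Finset.sum_mul]
      ring
    refine hb'.of_identDistrib ?_
    filter_upwards [hw] with n hn
    refine hn.comp (u := fun z : (Fin (N n) → ℝ) × Matrix (Fin (N n)) (Fin t) ℂ ×
      Matrix (Fin (N n)) (Fin t) ℂ => ((√(n : ℝ) : ℝ) : ℂ) * (form (c n z.1) z.2.2 z.2.2 k l -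
        avg n z.1 * (1 : Matrix (Fin t) (Fin t) ℂ) k l)) ?_
    exact ((measurable_matrix_iff.1 (measurable_form ((hc n).comp measurable_fst) (by fun_prop)
      (by fun_prop)) k l).sub (((havg n).comp measurable_fst).mul_const _)).const_mul _
  -- Conjugation by `A` turns the centring term into `avg` times the Gram matrix instead of the
  -- identity. The discrepancy is of order `1/√n`, hence bounded after multiplication by `√n`.
  have hK₂ : ∀ k l, StochBdd (P.prod G) (fun n x => -avg n (Γ n x.1) * (((√(n : ℝ) : ℝ) : ℂ) *
      (((gaussMat ζ Sum.inr n x.2)ᴴ * gaussMat ζ Sum.inr n x.2) k l -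
        (1 : Matrix (Fin t) (Fin t) ℂ) k l))) := fun k l =>
    (h.stochBdd_gram (P := P) Sum.inr_injective (m := fun n => n) (eventually_gt_atTop 0)
      k l).bdd_mul (Eventually.of_forall fun n x => by rw [norm_neg]; exact havgC n _)
  let M : ℕ → Ω × Ω' → Matrix (Fin t) (Fin t) ℂ := fun n x => ((√(n : ℝ) : ℝ) : ℂ) •
      (form (c n (Γ n x.1)) (St n x.1) (St n x.1) -
        avg n (Γ n x.1) • (1 : Matrix (Fin t) (Fin t) ℂ))
  have hK : ∀ k l, StochBdd (P.prod G) (fun n x => ((A n x)ᴴ * M n x * A n x) k l) := by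
    intro k l
    refine ((hK₁ k l).add (hK₂ k l)).of_norm_le (Eventually.of_forall fun n x =>
      le_of_eq (congrArg norm ?_))
    have hAA : (A n x)ᴴ * A n x = (gaussMat ζ Sum.inr n x.2)ᴴ * gaussMat ζ Sum.inr n x.2 :=
      gramSqrt_mul_self _
    simp only [M]
    rw [Matrix.mul_smul, Matrix.smul_mul, Matrix.mul_sub, Matrix.sub_mul, Matrix.mul_smul,
      Matrix.mul_one, Matrix.smul_mul, hAA, form_mul]
    simp only [Matrix.smul_apply, Matrix.sub_apply, smul_eq_mul]
    ring
  obtain ⟨hdet, hinv⟩ := h.gramSqrt_inv (P := P) Sum.inr_injective (m := fun n => n) tendsto_id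
  -- `M` is recovered from the bounded matrix `A* M A` by means of `A⁻¹`, which is close to the
  -- identity.
  have hnull := stochNull_sub_of_sandwich (μ := P.prod G) (M := M)
    (K := fun n x => (A n x)ᴴ * M n x * A n x) (B := fun n x => (A n x)⁻¹)
    (B' := fun n x => (A n x)⁻¹) hK hinv hinv
    (tendsto_of_tendsto_of_tendsto_of_le_of_le tendsto_const_nhds hdet (fun _ => zero_le)
      fun n => measure_mono fun x hx hdet => hx (eq_inv_mul_mul_inv hdet hdet)) k l
  refine (hnull.stochBdd.add (hK k l)).of_norm_le (Eventually.of_forall fun n x =>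
    le_of_eq (congrArg norm ?_))
  simp [M, avg]

end Blocks

/-! ### Cut-off weights: bounds and mean squares. -/

section Weights

/-- The function `x ↦ 1 / (x - ρ)`, cut off above `b`. -/
def cutInv (b ρ x : ℝ) : ℝ := if x ≤ b then (x - ρ)⁻¹ else 0

lemma measurable_cutInv (b ρ : ℝ) : Measurable (cutInv b ρ) :=
  Measurable.ite measurableSet_Iic (by fun_prop) measurable_const

/-- The cut-off makes the bound valid for every `x`, as the moment estimates require; it changes
nothing when all `g i ^ 2 ≤ b`. -/
lemma abs_cutInv_le {b ρ : ℝ} (hb : b < ρ) (x : ℝ) : |cutInv b ρ x| ≤ (ρ - b)⁻¹ := by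
  have h0 : 0 < ρ - b := by linarith
  unfold cutInv
  split_ifs with h
  · rw [abs_inv, abs_sub_comm]
    exact inv_anti₀ h0 ((by linarith : ρ - b ≤ ρ - x).trans (le_abs_self _))
  · simpa using h0.le

/-- Diagonal weights of the left block. -/
def leftWeight (b ρ : ℝ) {p : ℕ} (g : Fin p → ℝ) (i : Fin p) : ℝ :=
  cutInv b ρ (g i ^ 2) - (p : ℝ)⁻¹ * ∑ j, cutInv b ρ (g j ^ 2)

/-- Diagonal weights of the right block. -/
def rightWeight (b ρ : ℝ) {p : ℕ} (g : Fin p → ℝ) (i : Fin p) : ℝ := cutInv b ρ (g i ^ 2) + ρ⁻¹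

/-- Diagonal weights of the mixed block. -/
def mixedWeight (b ρ : ℝ) {p : ℕ} (g : Fin p → ℝ) (i : Fin p) : ℝ := g i * cutInv b ρ (g i ^ 2)

variable {b ρ : ℝ} {p : ℕ}

lemma measurable_cutInv_sq (b ρ : ℝ) (i : Fin p) :
    Measurable fun g : Fin p → ℝ => cutInv b ρ (g i ^ 2) :=
  (measurable_cutInv b ρ).comp (by fun_prop)

lemma measurable_leftWeight (b ρ : ℝ) (p : ℕ) :
    Measurable (leftWeight b ρ : (Fin p → ℝ) → Fin p → ℝ) :=
  measurable_pi_lambda _ fun i => (measurable_cutInv_sq b ρ i).sub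
    ((Finset.measurable_sum _ fun j _ => measurable_cutInv_sq b ρ j).const_mul _)

lemma measurable_rightWeight (b ρ : ℝ) (p : ℕ) :
    Measurable (rightWeight b ρ : (Fin p → ℝ) → Fin p → ℝ) :=
  measurable_pi_lambda _ fun i => (measurable_cutInv_sq b ρ i).add_const _

lemma measurable_mixedWeight (b ρ : ℝ) (p : ℕ) :
    Measurable (mixedWeight b ρ : (Fin p → ℝ) → Fin p → ℝ) :=
  measurable_pi_lambda _ fun i => (measurable_pi_apply i).mul (measurable_cutInv_sq b ρ i)

lemma abs_leftWeight_le (hb : b < ρ) (g : Fin p → ℝ) (i : Fin p) :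
    |leftWeight b ρ g i| ≤ 2 * (ρ - b)⁻¹ := by
  have hp : (0 : ℝ) < p := by exact_mod_cast i.pos
  have h1 : |(p : ℝ)⁻¹ * ∑ j, cutInv b ρ (g j ^ 2)| ≤ (ρ - b)⁻¹ := by
    rw [abs_mul, abs_of_pos (inv_pos.2 hp), inv_mul_le_iff₀ hp]
    refine (Finset.abs_sum_le_sum_abs _ _).trans
      ((Finset.sum_le_sum fun j _ => abs_cutInv_le hb _).trans ?_)
    simp
  unfold leftWeight
  refine (abs_sub _ _).trans ?_
  linarith [abs_cutInv_le hb (g i ^ 2)]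

lemma abs_rightWeight_le (hb : b < ρ) (g : Fin p → ℝ) (i : Fin p) :
    |rightWeight b ρ g i| ≤ (ρ - b)⁻¹ + |ρ⁻¹| :=
  (abs_add_le _ _).trans (add_le_add (abs_cutInv_le hb _) le_rfl)

/-- The cut-off also controls the factor `g i`, which is at most `√b` in modulus wherever the weight
is nonzero. -/
lemma abs_mixedWeight_le (hb : b < ρ) (g : Fin p → ℝ) (i : Fin p) :
    |mixedWeight b ρ g i| ≤ √b * (ρ - b)⁻¹ := by
  have h0 : 0 < (ρ - b)⁻¹ := inv_pos.2 (by linarith)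
  by_cases h : g i ^ 2 ≤ b
  · rw [mixedWeight, abs_mul]
    exact mul_le_mul (Real.abs_le_sqrt h) (abs_cutInv_le hb _) (abs_nonneg _) (Real.sqrt_nonneg _)
  · simp only [mixedWeight, cutInv, if_neg h, mul_zero, abs_zero]
    positivity

lemma sum_leftWeight (hp : 0 < p) (g : Fin p → ℝ) : ∑ i, leftWeight b ρ g i = 0 := by
  have hp' : (p : ℝ) ≠ 0 := by exact_mod_cast hp.ne'
  simp only [leftWeight, Finset.sum_sub_distrib, Finset.sum_const, Finset.card_univ,
    Fintype.card_fin, nsmul_eq_mul]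
  rw [← mul_assoc, mul_inv_cancel₀ hp', one_mul, sub_self]

/-- Mean of the squares minus square of the mean; in the limit this becomes `m' - m²`. -/
lemma average_leftWeight_sq (hp : 0 < p) {g : Fin p → ℝ} (hg : ∀ i, g i ^ 2 ≤ b) :
    (p : ℝ)⁻¹ * ∑ i, leftWeight b ρ g i ^ 2 =
      (p : ℝ)⁻¹ * ∑ i, ((g i ^ 2 - ρ)⁻¹) ^ 2 - ((p : ℝ)⁻¹ * ∑ i, (g i ^ 2 - ρ)⁻¹) ^ 2 := by
  have hp' : (p : ℝ) ≠ 0 := by exact_mod_cast hp.ne'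
  simp only [leftWeight, cutInv, hg, if_true, sub_sq, Finset.sum_add_distrib,
    Finset.sum_sub_distrib, Finset.sum_const, Finset.card_univ, Fintype.card_fin, nsmul_eq_mul,
    ← Finset.sum_mul, ← Finset.mul_sum]
  field_simp
  ring

/-- With `x = g i ^ 2`, `x / (x - ρ)² = 1 / (x - ρ) + ρ / (x - ρ)²`; in the limit this becomes `m +
ρ m'`. -/
lemma average_mixedWeight_sq (hb : b < ρ) {g : Fin p → ℝ} (hg : ∀ i, g i ^ 2 ≤ b) :
    (p : ℝ)⁻¹ * ∑ i, mixedWeight b ρ g i ^ 2 =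
      (p : ℝ)⁻¹ * ∑ i, (g i ^ 2 - ρ)⁻¹ + ρ * ((p : ℝ)⁻¹ * ∑ i, ((g i ^ 2 - ρ)⁻¹) ^ 2) := by
  rw [mul_left_comm, ← mul_add]
  congr 1
  rw [Finset.mul_sum, ← Finset.sum_add_distrib]
  refine Finset.sum_congr rfl fun i _ => ?_
  have : g i ^ 2 - ρ ≠ 0 := by linarith [hg i] |> fun h : g i ^ 2 - ρ < 0 => h.ne
  simp only [mixedWeight, cutInv, hg, if_true]
  field_simp
  ring

end Weights

/-! ### Removal of the auxiliary Gaussian factor. -/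

section Transfer

variable {Ω Ω' : Type*} [MeasurableSpace Ω] [MeasurableSpace Ω'] {P : Measure Ω} {G : Measure Ω'}
  [IsProbabilityMeasure G]

lemma prod_setOf_fst [SFinite P] (p : Ω → Prop) : (P.prod G) {x | p x.1} = P {ω | p ω} := by
  have : {x : Ω × Ω' | p x.1} = {ω | p ω} ×ˢ Set.univ := by ext; simp
  rw [this, Measure.prod_prod]
  simp

lemma StochBdd.of_fst [SFinite P] {E : Type*} [Norm E] {Y : ℕ → Ω → E}
    (h : StochBdd (P.prod G) (fun n x => Y n x.1)) : StochBdd P Y := by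
  intro ε hε
  obtain ⟨C, hC⟩ := h ε hε
  refine ⟨C, hC.mono fun n hn => ?_⟩
  rwa [prod_setOf_fst (fun ω => C < ‖Y n ω‖)] at hn

/-- Dominated convergence for the indicators of the complements. -/
lemma tendsto_measure_not_of_ae_eventually {Ω : Type*} [MeasurableSpace Ω] {P : Measure Ω}
    [IsFiniteMeasure P] {p : ℕ → Ω → Prop}
    (hm : ∀ n, MeasurableSet {ω | p n ω}) (h : ∀ᵐ ω ∂P, ∀ᶠ n in atTop, p n ω) :
    Tendsto (fun n => P {ω | ¬ p n ω}) atTop (𝓝 0) := by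
  have := tendsto_measure_of_ae_tendsto_indicator_of_isFiniteMeasure (μ := P) atTop
    (A := (∅ : Set Ω)) (As := fun n => {ω | ¬ p n ω}) MeasurableSet.empty (fun n => (hm n).compl)
    (h.mono fun ω hω => hω.mono fun n hn => by simp [hn])
  simpa using this

lemma TendstoInDistribution.of_fst [IsProbabilityMeasure P] {E E' : Type*} [TopologicalSpace E]
    [MeasurableSpace E]
    [OpensMeasurableSpace E] {mE' : MeasurableSpace E'} {Y : ℕ → Ω → E}
    (hY : ∀ n, Measurable (Y n)) {Z : E' → E}
    {ν : Measure E'} [IsProbabilityMeasure ν]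
    (h : TendstoInDistribution (fun n (x : Ω × Ω') => Y n x.1) atTop Z (fun _ => P.prod G) ν) :
    TendstoInDistribution Y atTop Z (fun _ => P) ν := by
  refine ⟨fun n => (hY n).aemeasurable, h.aemeasurable_limit, ?_⟩
  have hmap : ∀ n, (P.prod G).map (fun x => Y n x.1) = P.map (Y n) := by
    intro n
    rw [← Function.comp_def (Y n) Prod.fst, ← Measure.map_map (hY n) measurable_fst,
      Measure.map_fst_prod]
    simp
  have := h.tendsto
  simp only [hmap] at this
  exact this

end Transfer

/-! ### Measurability of resolvents, of `xi` and of `eta`. -/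

section MatrixMeasurability

variable {α : Type*} [MeasurableSpace α] {p q t : ℕ}

lemma measurable_matrix_inv {f : α → Matrix (Fin p) (Fin p) ℂ} (hf : Measurable f) :
    Measurable fun x => (f x)⁻¹ := by
  have h1 : Measurable fun a : Matrix (Fin p) (Fin p) ℂ => a⁻¹ := by
    refine measurable_matrix_iff.2 fun i j => ?_
    simp only [Matrix.inv_def, Matrix.smul_apply, smul_eq_mul, Ring.inverse_eq_inv']
    have hd : Continuous fun a : Matrix (Fin p) (Fin p) ℂ => a.det := by fun_prop
    have ha : Continuous fun a : Matrix (Fin p) (Fin p) ℂ => a.adjugate i j :=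
      (Continuous.matrix_adjugate continuous_id).matrix_elem i j
    exact hd.measurable.inv.mul ha.measurable
  exact h1.comp hf

lemma measurable_matrix_sub {f g : α → Matrix (Fin p) (Fin q) ℂ} (hf : Measurable f)
    (hg : Measurable g) : Measurable fun x => f x - g x :=
  measurable_matrix_iff.2 fun i j =>
    (measurable_matrix_iff.1 hf i j).sub (measurable_matrix_iff.1 hg i j)

lemma measurable_matrix_smul {c : α → ℂ} {g : α → Matrix (Fin p) (Fin q) ℂ} (hc : Measurable c)
    (hg : Measurable g) : Measurable fun x => c x • g x :=
  measurable_matrix_iff.2 fun i j => hc.mul (measurable_matrix_iff.1 hg i j)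

lemma measurable_matrix_trace {f : α → Matrix (Fin p) (Fin p) ℂ} (hf : Measurable f) :
    Measurable fun x => (f x).trace :=
  Finset.measurable_sum _ fun i _ => measurable_matrix_iff.1 hf i i

variable {X : α → Matrix (Fin p) (Fin q) ℂ}

lemma measurable_Q (hX : Measurable X) (z : ℂ) : Measurable fun x => Q (X x) z :=
  measurable_matrix_inv (measurable_matrix_sub (by fun_prop) measurable_const)

lemma measurable_Qt (hX : Measurable X) (z : ℂ) : Measurable fun x => Qt (X x) z :=
  measurable_matrix_inv (measurable_matrix_sub (by fun_prop) measurable_const)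

lemma measurable_xi (hX : Measurable X) (W : Matrix (Fin p) (Fin t) ℂ)
    (Wt : Matrix (Fin q) (Fin t) ℂ) (ρ : ℝ) : Measurable fun x => xi (X x) W Wt ρ := by
  have hQ := measurable_Q hX ρ
  have hQt := measurable_Qt hX ρ
  have h1 : Measurable fun x => Q (X x) ρ - alpha (X x) ρ • (1 : Matrix (Fin p) (Fin p) ℂ) :=
    measurable_matrix_sub hQ (measurable_matrix_smul ((measurable_matrix_trace hQ).const_mul _)
      measurable_const)
  have h2 : Measurable fun x => Qt (X x) ρ - alphat (X x) ρ • (1 : Matrix (Fin q) (Fin q) ℂ) :=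
    measurable_matrix_sub hQt (measurable_matrix_smul ((measurable_matrix_trace hQt).const_mul _)
      measurable_const)
  have h3 := measurable_matrix_mul (measurable_matrix_mul (measurable_const (a := Wᴴ)) h1)
    (measurable_const (a := W))
  have h4 := measurable_matrix_mul (measurable_matrix_mul (measurable_const (a := Wtᴴ)) h2)
    (measurable_const (a := Wt))
  have h5 := measurable_matrix_mul (measurable_matrix_mul (measurable_matrix_mul
    (measurable_const (a := Wᴴ)) hX) hQt) (measurable_const (a := Wt))
  exact (measurable_matrix_smul measurable_const h3).prodMk
    ((measurable_matrix_smul measurable_const h4).prodMk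
      (measurable_matrix_smul measurable_const h5))

lemma measurable_eta (hX : Measurable X) (W : Matrix (Fin p) (Fin t) ℂ)
    (Wt : Matrix (Fin q) (Fin t) ℂ) (ρ : Fin (t / 2) → ℝ) :
    Measurable fun x => eta (X x) W Wt ρ := by
  refine measurable_pi_lambda _ fun j => ?_
  rcases j with k | k
  · have hQ := measurable_Q hX (ρ k)
    have hm : Measurable fun x => Wᴴ * Q (X x) (ρ k) * W := by fun_prop
    exact (measurable_matrix_iff.1 hm _ _).const_mul _
  · have hQt := measurable_Qt hX (ρ k)
    have hm : Measurable fun x => Wᴴ * X x * Qt (X x) (ρ k) * Wt := by fun_prop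
    exact (measurable_matrix_iff.1 hm _ _).const_mul _

end MatrixMeasurability

/-! ### From the cut-off forms to the blocks of the model. -/

lemma tendsto_measure_ne_of_good {Ω E : Type*} [MeasurableSpace Ω] {μ : Measure Ω}
    {good : ℕ → Ω → Prop} (hg : Tendsto (fun n => μ {ω | ¬ good n ω}) atTop (𝓝 0))
    {Y Z : ℕ → Ω → E} (h : ∀ᶠ n in atTop, ∀ ω, good n ω → Z n ω = Y n ω) :
    Tendsto (fun n => μ {ω | Z n ω ≠ Y n ω}) atTop (𝓝 0) := by
  refine tendsto_of_tendsto_of_tendsto_of_le_of_le' tendsto_const_nhds hg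
    (Eventually.of_forall fun _ => zero_le) ?_
  filter_upwards [h] with n hn
  exact measure_mono fun ω hω hgood => hω (hn ω hgood)

lemma TendstoInDistribution.of_eventually_identDistrib {Ω E E' : Type*} [MeasurableSpace Ω]
    {μ : Measure Ω} [IsProbabilityMeasure μ] [TopologicalSpace E] [MeasurableSpace E]
    [OpensMeasurableSpace E] {mE' : MeasurableSpace E'} {ν : Measure E'} [IsProbabilityMeasure ν]
    {V : E' → E} {Y Z : ℕ → Ω → E} (hY : TendstoInDistribution Y atTop V (fun _ => μ) ν)
    (hm : ∀ n, AEMeasurable (Z n) μ) (h : ∀ᶠ n in atTop, IdentDistrib (Z n) (Y n) μ μ) :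
    TendstoInDistribution Z atTop V (fun _ => μ) ν := by
  refine ⟨hm, hY.aemeasurable_limit, hY.tendsto.congr' ?_⟩
  filter_upwards [h] with n hn
  exact Subtype.ext hn.map_eq.symm

/-- The matrices `X n` have the singular value decompositions `L Γ R*`. -/
def IsSVD {Ω : Type*} {p q : ℕ} (X : Ω → Matrix (Fin p) (Fin q) ℂ)
    (L : Ω → Matrix.unitaryGroup (Fin p) ℂ) (Γ : Ω → Fin p → ℝ) (R : Ω → Matrix (Fin q) (Fin p) ℂ)
    (ω : Ω) : Prop :=
  (R ω)ᴴ * R ω = 1 ∧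
    X ω = (L ω : Matrix (Fin p) (Fin p) ℂ) * Matrix.diagonal (fun i => (Γ ω i : ℂ)) * (R ω)ᴴ

lemma unitary_conjTranspose_mul_self {p : ℕ} (L : Matrix.unitaryGroup (Fin p) ℂ) :
    (L : Matrix (Fin p) (Fin p) ℂ)ᴴ * (L : Matrix (Fin p) (Fin p) ℂ) = 1 :=
  Matrix.mem_unitaryGroup_iff'.1 L.2

section Model

variable {Ω : Type*} [MeasurableSpace Ω] {P : Measure Ω} {N : ℕ → ℕ}
  {X : (n : ℕ) → Ω → Matrix (Fin (N n)) (Fin n) ℂ}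
  {L : (n : ℕ) → Ω → Matrix.unitaryGroup (Fin (N n)) ℂ} {Γ : (n : ℕ) → Ω → Fin (N n) → ℝ}
  {R : (n : ℕ) → Ω → Matrix (Fin n) (Fin (N n)) ℂ} {lamPlus : ℝ}

lemma ae_eventually_sq_le (hsvd : ∀ n, ∀ᵐ ω ∂P, IsSVD (X n) (L n) (Γ n) (R n) ω)
    (hnorm : ∀ᵐ ω ∂P, Tendsto (fun n => spectralNorm (X n ω * (X n ω)ᴴ)) atTop (𝓝 lamPlus))
    {b : ℝ} (hb : lamPlus < b) : ∀ᵐ ω ∂P, ∀ᶠ n in atTop, ∀ i, Γ n ω i ^ 2 ≤ b := by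
  filter_upwards [ae_all_iff.2 hsvd, hnorm] with ω h1 h2
  filter_upwards [h2.eventually (gt_mem_nhds hb)] with n hn
  exact fun i => (spectralNorm_ge_of_svd (unitary_conjTranspose_mul_self _) (h1 n).1 (h1 n).2
    i).trans hn.le

/-- The decomposition holds almost surely for each `n`, so only the bound on the singular values
costs probability. -/
lemma tendsto_measure_not_svd_le [IsFiniteMeasure P]
    (hsvd : ∀ n, ∀ᵐ ω ∂P, IsSVD (X n) (L n) (Γ n) (R n) ω) (hΓ : ∀ n, Measurable (Γ n))
    (hnorm : ∀ᵐ ω ∂P, Tendsto (fun n => spectralNorm (X n ω * (X n ω)ᴴ)) atTop (𝓝 lamPlus))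
    {b : ℝ} (hb : lamPlus < b) :
    Tendsto (fun n => P {ω | ¬ (IsSVD (X n) (L n) (Γ n) (R n) ω ∧ ∀ i, Γ n ω i ^ 2 ≤ b)}) atTop
      (𝓝 0) := by
  have h1 := tendsto_measure_not_of_ae_eventually (p := fun n ω => ∀ i, Γ n ω i ^ 2 ≤ b)
    (fun n => by
      rw [Set.ofPred_forall]
      exact MeasurableSet.iInter fun i => measurableSet_le
        (((measurable_pi_apply i).comp (hΓ n)).pow_const 2) measurable_const)
    (ae_eventually_sq_le hsvd hnorm hb)
  refine h1.congr fun n => measure_congr ?_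
  filter_upwards [hsvd n] with ω hω
  exact propext (not_congr ⟨fun h => ⟨hω, h⟩, fun h => h.2⟩)

/-- Convergence of the averages of the resolvents at a point outside the support. -/
lemma ae_tendsto_average (hsvd : ∀ n, ∀ᵐ ω ∂P, IsSVD (X n) (L n) (Γ n) (R n) ω)
    (hnorm : ∀ᵐ ω ∂P, Tendsto (fun n => spectralNorm (X n ω * (X n ω)ᴴ)) atTop (𝓝 lamPlus))
    {π : Measure ℝ} [IsProbabilityMeasure π]
    (hα : ∀ z : ℂ, 0 < z.im →
      ∀ᵐ ω ∂P, Tendsto (fun n => alpha (X n ω) z) atTop (𝓝 (stieltjes π z)))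
    {b ρ : ℝ} (hb : lamPlus < b) (hbρ : b < ρ) (hπ : ∀ᵐ y ∂π, y ≤ b) :
    ∀ᵐ ω ∂P,
      Tendsto (fun n => (N n : ℝ)⁻¹ * ∑ i, (Γ n ω i ^ 2 - ρ)⁻¹) atTop
        (𝓝 (∫ y, (y - ρ)⁻¹ ∂π)) ∧
      Tendsto (fun n => (N n : ℝ)⁻¹ * ∑ i, ((Γ n ω i ^ 2 - ρ)⁻¹) ^ 2) atTop
        (𝓝 (∫ y, ((y - ρ)⁻¹) ^ 2 ∂π)) := by
  have him : ∀ r : ℚ, ((ρ : ℂ) + (r : ℝ) * Complex.I).im = r := fun r => by simp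
  -- The exceptional null set in the hypothesis depends on `z`; countably many heights allow a
  -- common one.
  have h1 : ∀ᵐ ω ∂P, ∀ r : ℚ, 0 < r → Tendsto (fun n => alpha (X n ω)
      (ρ + (r : ℝ) * Complex.I)) atTop (𝓝 (stieltjes π (ρ + (r : ℝ) * Complex.I))) := by
    refine ae_all_iff.2 fun r => ?_
    by_cases hr : 0 < r
    · filter_upwards [hα (ρ + (r : ℝ) * Complex.I) (by rw [him]; exact_mod_cast hr)] with ω h _
      exact h
    · exact Eventually.of_forall fun ω h => absurd h hr
  filter_upwards [h1, ae_all_iff.2 hsvd, ae_eventually_sq_le hsvd hnorm hb] with ω h2 h3 h4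
  refine tendsto_average_resolvent (x := fun n i => Γ n ω i ^ 2) hbρ h4 hπ fun r hr => ?_
  refine (h2 r hr).congr fun n => ?_
  refine alpha_eq_of_svd (unitary_conjTranspose_mul_self _) (h3 n).1 (h3 n).2 fun i h => ?_
  have h5 := congrArg Complex.im h
  rw [him, Complex.ofReal_im] at h5
  exact hr.ne' (by exact_mod_cast h5.symm)

section Entries

variable [IsProbabilityMeasure P] {Ω' : Type*} [MeasurableSpace Ω'] {G : Measure Ω'}
  [IsProbabilityMeasure G] {t : ℕ} {ζ : ℕ × (Fin t ⊕ Fin t) → Ω' → ℂ} {hN : ∀ n, N n ≤ n}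
  {W : (n : ℕ) → Matrix (Fin (N n)) (Fin t) ℂ} {Wt : (n : ℕ) → Matrix (Fin n) (Fin t) ℂ}

lemma cutInv_of_le {b ρ x : ℝ} (h : x ≤ b) : cutInv b ρ x = (x - ρ)⁻¹ := if_pos h

/-- When the decomposition holds and all `Γ i ^ 2 ≤ b`, the cut-off is inactive and the entry equals
the form treated in `left_block`. This event has probability tending to one, and neither conclusion
sees the rest. -/
lemma left_entry (h : IsGaussianFamily ζ G)
    (hw : IsWhitened P G ζ hN Γ (fun n ω => (L n ω : Matrix (Fin (N n)) (Fin (N n)) ℂ)ᴴ * W n)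
      (fun n ω => (R n ω)ᴴ * Wt n))
    (hNlim : Tendsto N atTop atTop) (hΓ : ∀ n, Measurable (Γ n)) {b ρ : ℝ} (hb : b < ρ)
    (hgood : Tendsto (fun n => (P.prod G)
      {x | ¬ (IsSVD (X n) (L n) (Γ n) (R n) x.1 ∧ ∀ i, Γ n x.1 i ^ 2 ≤ b)}) atTop (𝓝 0))
    (k l : Fin t) :
    StochBdd (P.prod G) (fun n x => ((√(N n : ℝ) : ℝ) : ℂ) * ((W n)ᴴ * (Q (X n x.1) ρ -
        alpha (X n x.1) ρ • (1 : Matrix (Fin (N n)) (Fin (N n)) ℂ)) * W n) k l) ∧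
      StochNull (P.prod G) (fun n x => ((√(N n : ℝ) : ℝ) : ℂ) * ((W n)ᴴ * (Q (X n x.1) ρ -
        alpha (X n x.1) ρ • (1 : Matrix (Fin (N n)) (Fin (N n)) ℂ)) * W n) k l -
        ((√(N n : ℝ) : ℝ) : ℂ) * form (leftWeight b ρ (Γ n x.1))
          ((L n x.1 : Matrix (Fin (N n)) (Fin (N n)) ℂ)ᴴ * W n *
            gramSqrt (gaussMat ζ Sum.inl (N n) x.2))
          ((L n x.1 : Matrix (Fin (N n)) (Fin (N n)) ℂ)ᴴ * W n *
            gramSqrt (gaussMat ζ Sum.inl (N n) x.2)) k l) := by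
  obtain ⟨h1, h2⟩ := left_block h hw hNlim hΓ (c := fun n => leftWeight b ρ)
    (fun n => measurable_leftWeight b ρ _) (fun n g i => abs_leftWeight_le hb g i)
    ((hNlim.eventually_gt_atTop 0).mono fun n hn g => sum_leftWeight hn g) k l
  have hnull := h2.congr (tendsto_measure_ne_of_good hgood (Z := fun n x =>
      ((√(N n : ℝ) : ℝ) : ℂ) * ((W n)ᴴ * (Q (X n x.1) ρ -
        alpha (X n x.1) ρ • (1 : Matrix (Fin (N n)) (Fin (N n)) ℂ)) * W n) k l -
        ((√(N n : ℝ) : ℝ) : ℂ) * form (leftWeight b ρ (Γ n x.1))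
          ((L n x.1 : Matrix (Fin (N n)) (Fin (N n)) ℂ)ᴴ * W n *
            gramSqrt (gaussMat ζ Sum.inl (N n) x.2))
          ((L n x.1 : Matrix (Fin (N n)) (Fin (N n)) ℂ)ᴴ * W n *
            gramSqrt (gaussMat ζ Sum.inl (N n) x.2)) k l)
    (Eventually.of_forall fun n x hx => by
      rw [block_left_of_svd (unitary_conjTranspose_mul_self _) hx.1.1 hx.1.2
        (fun i => (lt_of_le_of_lt (hx.2 i) hb).ne)]
      have : leftWeight b ρ (Γ n x.1) = fun i => (Γ n x.1 i ^ 2 - ρ)⁻¹ -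
          (N n : ℝ)⁻¹ * ∑ j, (Γ n x.1 j ^ 2 - ρ)⁻¹ := by
        funext i
        simp only [leftWeight, cutInv_of_le (hx.2 _)]
      rw [this]))
  refine ⟨(hnull.stochBdd.add h1).of_norm_le (Eventually.of_forall fun n x => ?_), hnull⟩
  rw [sub_add_cancel]

lemma mixed_entry (h : IsGaussianFamily ζ G)
    (hw : IsWhitened P G ζ hN Γ (fun n ω => (L n ω : Matrix (Fin (N n)) (Fin (N n)) ℂ)ᴴ * W n)
      (fun n ω => (R n ω)ᴴ * Wt n))
    (hNlim : Tendsto N atTop atTop) (hΓ : ∀ n, Measurable (Γ n)) {b ρ : ℝ} (hb : b < ρ)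
    (hρ : ρ ≠ 0) (hgood : Tendsto (fun n => (P.prod G)
      {x | ¬ (IsSVD (X n) (L n) (Γ n) (R n) x.1 ∧ ∀ i, Γ n x.1 i ^ 2 ≤ b)}) atTop (𝓝 0))
    (k l : Fin t) :
    StochBdd (P.prod G) (fun n x => ((√(n : ℝ) : ℝ) : ℂ) *
        ((W n)ᴴ * X n x.1 * Qt (X n x.1) ρ * Wt n) k l) ∧
      StochNull (P.prod G) (fun n x => ((√(n : ℝ) : ℝ) : ℂ) *
        ((W n)ᴴ * X n x.1 * Qt (X n x.1) ρ * Wt n) k l -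
        ((√(n : ℝ) : ℝ) : ℂ) * form (mixedWeight b ρ (Γ n x.1))
          ((L n x.1 : Matrix (Fin (N n)) (Fin (N n)) ℂ)ᴴ * W n *
            gramSqrt (gaussMat ζ Sum.inl (N n) x.2))
          ((R n x.1)ᴴ * Wt n * gramSqrt (gaussMat ζ Sum.inr n x.2)) k l) := by
  obtain ⟨h1, h2⟩ := mixed_block h hw hNlim hΓ (c := fun n => mixedWeight b ρ)
    (fun n => measurable_mixedWeight b ρ _) (fun n g i => abs_mixedWeight_le hb g i) k l
  have hnull := h2.congr (tendsto_measure_ne_of_good hgood (Z := fun n x =>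
      ((√(n : ℝ) : ℝ) : ℂ) * ((W n)ᴴ * X n x.1 * Qt (X n x.1) ρ * Wt n) k l -
        ((√(n : ℝ) : ℝ) : ℂ) * form (mixedWeight b ρ (Γ n x.1))
          ((L n x.1 : Matrix (Fin (N n)) (Fin (N n)) ℂ)ᴴ * W n *
            gramSqrt (gaussMat ζ Sum.inl (N n) x.2))
          ((R n x.1)ᴴ * Wt n * gramSqrt (gaussMat ζ Sum.inr n x.2)) k l)
    (Eventually.of_forall fun n x hx => by
      rw [block_mixed_of_svd (unitary_conjTranspose_mul_self _) hx.1.1 hx.1.2 hρ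
        (fun i => (lt_of_le_of_lt (hx.2 i) hb).ne)]
      have : mixedWeight b ρ (Γ n x.1) = fun i => Γ n x.1 i * (Γ n x.1 i ^ 2 - ρ)⁻¹ := by
        funext i
        simp only [mixedWeight, cutInv_of_le (hx.2 _)]
      rw [this]))
  refine ⟨(hnull.stochBdd.add h1).of_norm_le (Eventually.of_forall fun n x => ?_), hnull⟩
  rw [sub_add_cancel]

lemma right_entry (h : IsGaussianFamily ζ G)
    (hw : IsWhitened P G ζ hN Γ (fun n ω => (L n ω : Matrix (Fin (N n)) (Fin (N n)) ℂ)ᴴ * W n)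
      (fun n ω => (R n ω)ᴴ * Wt n))
    (hWt : ∀ᶠ n in atTop, (Wt n)ᴴ * Wt n = 1) (hΓ : ∀ n, Measurable (Γ n)) {b ρ : ℝ} (hb : b < ρ)
    (hρ : ρ ≠ 0) (hgood : Tendsto (fun n => (P.prod G)
      {x | ¬ (IsSVD (X n) (L n) (Γ n) (R n) x.1 ∧ ∀ i, Γ n x.1 i ^ 2 ≤ b)}) atTop (𝓝 0))
    (k l : Fin t) :
    StochBdd (P.prod G) (fun n x => ((√(n : ℝ) : ℝ) : ℂ) * ((Wt n)ᴴ * (Qt (X n x.1) ρ -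
        alphat (X n x.1) ρ • (1 : Matrix (Fin n) (Fin n) ℂ)) * Wt n) k l) := by
  have h1 := right_block h hw hΓ (c := fun n => rightWeight b ρ)
    (fun n => measurable_rightWeight b ρ _) (fun n g i => abs_rightWeight_le hb g i) k l
  refine h1.congr (tendsto_measure_ne_of_good hgood ?_)
  filter_upwards [hWt, eventually_gt_atTop 0] with n hWn hn
  intro x hx
  rw [block_right_of_svd (unitary_conjTranspose_mul_self _) hx.1.1 hx.1.2 hρ
    (fun i => (lt_of_le_of_lt (hx.2 i) hb).ne) hn.ne' hWn]
  have : rightWeight b ρ (Γ n x.1) = fun i => (Γ n x.1 i ^ 2 - ρ)⁻¹ + ρ⁻¹ := by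
    funext i
    simp only [rightWeight, cutInv_of_le (hx.2 _)]
  rw [this]
  simp

end Entries

end Model


/-! ### Dimensions, whitening of the model, and tightness from entrywise bounds. -/

lemma tendsto_nat_of_ratio {N : ℕ → ℕ} {c : ℝ} (hc : 0 < c)
    (hNc : Tendsto (fun n : ℕ => (N n : ℝ) / (n : ℝ)) atTop (𝓝 c)) : Tendsto N atTop atTop := by
  have h1 := hNc.pos_mul_atTop hc tendsto_natCast_atTop_atTop
  rw [← tendsto_natCast_atTop_iff (R := ℝ)]
  refine h1.congr' ?_
  filter_upwards [eventually_gt_atTop 0] with n hn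
  exact div_mul_cancel₀ _ (by exact_mod_cast hn.ne')

/-- The left block is naturally scaled by `√N`, whereas `xi` uses `√n`; since `c > 0`, the ratio of
the two stays bounded. -/
lemma exists_sqrt_ratio_le {N : ℕ → ℕ} {c : ℝ} (hc : 0 < c)
    (hNc : Tendsto (fun n : ℕ => (N n : ℝ) / (n : ℝ)) atTop (𝓝 c)) :
    ∃ K : ℝ, ∀ᶠ n : ℕ in atTop, √(n : ℝ) * (√(N n : ℝ))⁻¹ ≤ K := by
  refine ⟨√(c⁻¹ + 1), ?_⟩
  have h1 := (hNc.inv₀ hc.ne').eventually (gt_mem_nhds (lt_add_one c⁻¹))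
  filter_upwards [h1] with n hn
  rw [inv_div] at hn
  rw [← Real.sqrt_inv, ← Real.sqrt_mul (Nat.cast_nonneg _), ← div_eq_mul_inv]
  exact Real.sqrt_le_sqrt hn.le

/-- This guarantees `ρ ≠ 0` whenever `ρ > lamPlus`, as the formula for `Q̃(ρ)` requires. -/
lemma nonneg_of_tendsto_spectralNorm {Ω : Type*} [MeasurableSpace Ω] {P : Measure Ω}
    [IsProbabilityMeasure P] {N : ℕ → ℕ} {X : (n : ℕ) → Ω → Matrix (Fin (N n)) (Fin n) ℂ}
    {lamPlus : ℝ}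
    (hnorm : ∀ᵐ ω ∂P, Tendsto (fun n => spectralNorm (X n ω * (X n ω)ᴴ)) atTop (𝓝 lamPlus)) :
    0 ≤ lamPlus := by
  obtain ⟨ω, hω⟩ := hnorm.exists
  exact ge_of_tendsto' hω fun n => norm_nonneg _

lemma isWhitened_of_haar {Ω Ω' : Type*} [MeasurableSpace Ω] [MeasurableSpace Ω'] {P : Measure Ω}
    [IsProbabilityMeasure P] {G : Measure Ω'} [IsProbabilityMeasure G] {N : ℕ → ℕ} {t : ℕ}
    {ζ : ℕ × (Fin t ⊕ Fin t) → Ω' → ℂ} (hN : ∀ n, N n ≤ n)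
    {L : (n : ℕ) → Ω → Matrix.unitaryGroup (Fin (N n)) ℂ} {Γ : (n : ℕ) → Ω → Fin (N n) → ℝ}
    {R : (n : ℕ) → Ω → Matrix (Fin n) (Fin (N n)) ℂ}
    {W : (n : ℕ) → Matrix (Fin (N n)) (Fin t) ℂ} {Wt : (n : ℕ) → Matrix (Fin n) (Fin t) ℂ}
    {haarq : (n : ℕ) → Measure (Matrix.unitaryGroup (Fin n) ℂ)}
    (h : IsGaussianFamily ζ G) (hL : ∀ n, Measurable (L n)) (hΓ : ∀ n, Measurable (Γ n))
    (hR : ∀ n, Measurable (R n)) (hLhaar : ∀ n, (P.map (L n)).IsHaarMeasure)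
    (hhaar : ∀ n, (haarq n).IsHaarMeasure) (hprob : ∀ n, IsProbabilityMeasure (haarq n))
    (hRlaw : ∀ n, P.map (R n) = (haarq n).map (fun V : Matrix.unitaryGroup (Fin n) ℂ =>
      (V : Matrix (Fin n) (Fin n) ℂ).submatrix id (Fin.castLE (hN n))))
    (hind : ∀ n, IndepFun (L n) (fun ω => (Γ n ω, R n ω)) P)
    (hind' : ∀ n, IndepFun (Γ n) (R n) P)
    (hW : ∀ᶠ n in atTop, (W n)ᴴ * W n = 1) (hWt : ∀ᶠ n in atTop, (Wt n)ᴴ * Wt n = 1) :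
    IsWhitened P G ζ hN Γ (fun n ω => (L n ω : Matrix (Fin (N n)) (Fin (N n)) ℂ)ᴴ * W n)
      (fun n ω => (R n ω)ᴴ * Wt n) := by
  unfold IsWhitened
  filter_upwards [hW, hWt] with n hWn hWtn
  have := hLhaar n
  have := hhaar n
  have := hprob n
  have hY := h.measurable_gaussMat Sum.inl (N n)
  have hYt := h.measurable_gaussMat Sum.inr n
  have hcoe : Measurable fun V : Matrix.unitaryGroup (Fin (N n)) ℂ =>
    (V : Matrix (Fin (N n)) (Fin (N n)) ℂ) := measurable_subtype_coe
  have hLn := hcoe.comp (hL n)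
  have hRn := hR n
  have hΓn := hΓ n
  refine ⟨Measurable.aemeasurable ?_, Measurable.aemeasurable ?_,
    map_haar_mul_gramSqrt_eq P G (hN n) (hL n) (hΓ n) (hR n) (hRlaw n) (hind n) (hind' n) hY hYt
      (h.indepFun_gaussMat (fun k l => Sum.inl_ne_inr) _ _)
      (h.map_gaussMat_unitary Sum.inl_injective _) (h.map_gaussMat_unitary Sum.inr_injective _)
      hWn hWtn⟩
  · have h1 : Measurable fun x : Ω × Ω' => (L n x.1 : Matrix (Fin (N n)) (Fin (N n)) ℂ)ᴴ * W n *
        gramSqrt (gaussMat ζ Sum.inl (N n) x.2) :=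
      measurable_matrix_mul (measurable_matrix_mul (measurable_matrix_conjTranspose
        (hLn.comp measurable_fst)) measurable_const)
        ((measurable_gramSqrt _ _).comp (hY.comp measurable_snd))
    have h2 : Measurable fun x : Ω × Ω' => (R n x.1)ᴴ * Wt n *
        gramSqrt (gaussMat ζ Sum.inr n x.2) :=
      measurable_matrix_mul (measurable_matrix_mul (measurable_matrix_conjTranspose
        (hRn.comp measurable_fst)) measurable_const)
        ((measurable_gramSqrt _ _).comp (hYt.comp measurable_snd))
    exact (hΓn.comp measurable_fst).prodMk (h1.prodMk h2)
  · exact (hΓn.comp measurable_fst).prodMk ((hY.comp measurable_snd).prodMk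
      (measurable_matrix_submatrix _ _ (hYt.comp measurable_snd)))

lemma StochBdd.isTightMeasureSet_matrices {Ω : Type*} [MeasurableSpace Ω] {P : Measure Ω}
    [IsProbabilityMeasure P] {t : ℕ}
    {Y : ℕ → Ω → Matrix (Fin t) (Fin t) ℂ × Matrix (Fin t) (Fin t) ℂ × Matrix (Fin t) (Fin t) ℂ}
    (hm : ∀ n, AEMeasurable (Y n) P)
    (h1 : ∀ k l, StochBdd P (fun n ω => (Y n ω).1 k l))
    (h2 : ∀ k l, StochBdd P (fun n ω => (Y n ω).2.1 k l))
    (h3 : ∀ k l, StochBdd P (fun n ω => (Y n ω).2.2 k l)) :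
    IsTightMeasureSet (Set.range fun n => P.map (Y n)) := by
  -- The triple of matrices is read in a product of function spaces, where the sup norm gives a
  -- proper normed space and is controlled entry by entry.
  let F := (Fin t → Fin t → ℂ) × (Fin t → Fin t → ℂ) × (Fin t → Fin t → ℂ)
  refine isTightMeasureSet_of_stochBdd (F := F) (Y := Y) hm ?_
  refine StochBdd.of_forall_finite (E := ℂ) (F := F)
    (ι := (Fin t × Fin t) ⊕ (Fin t × Fin t) ⊕ (Fin t × Fin t))
    (Y := fun i n ω => match i with
      | .inl (k, l) => (Y n ω).1 k l
      | .inr (.inl (k, l)) => (Y n ω).2.1 k l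
      | .inr (.inr (k, l)) => (Y n ω).2.2 k l) ?_ ?_
  · rintro (⟨k, l⟩ | ⟨k, l⟩ | ⟨k, l⟩)
    · exact h1 k l
    · exact h2 k l
    · exact h3 k l
  · intro C n ω hC h
    have hpi : ∀ f : Fin t → Fin t → ℂ, (∀ k l, ‖f k l‖ ≤ C) → ‖f‖ ≤ C := fun f hf =>
      (pi_norm_le_iff_of_nonneg hC).2 fun k => (pi_norm_le_iff_of_nonneg hC).2 fun l => hf k l
    have hF : ∀ z : F, ‖z.1‖ ≤ C → ‖z.2.1‖ ≤ C → ‖z.2.2‖ ≤ C → ‖z‖ ≤ C := fun z h1 h2 h3 =>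
      norm_prod_le_iff.2 ⟨h1, norm_prod_le_iff.2 ⟨h2, h3⟩⟩
    exact hF (Y n ω) (hpi _ fun k l => h (.inl (k, l))) (hpi _ fun k l => h (.inr (.inl (k, l))))
      (hpi _ fun k l => h (.inr (.inr (k, l))))

/-! ### Limit law of `eta` and tightness of `xi`. -/

lemma limitCov_stieltjes {π : Measure ℝ} [IsProbabilityMeasure π] {s : ℕ} {ρ b : Fin s → ℝ}
    (hb : ∀ k, b k < ρ k) (hπ : ∀ k, ∀ᵐ y ∂π, y ≤ b k) :
    limitCov (stieltjes π) ρ = Matrix.diagonal (fun j => ((Sum.elim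
      (fun k => ∫ y, ((y - ρ k)⁻¹) ^ 2 ∂π - (∫ y, (y - ρ k)⁻¹ ∂π) ^ 2)
      (fun k => ∫ y, (y - ρ k)⁻¹ ∂π + ρ k * ∫ y, ((y - ρ k)⁻¹) ^ 2 ∂π) j : ℝ) : ℂ)) := by
  rw [limitCov, Matrix.fromBlocks_diagonal]
  congr 1
  funext j
  rcases j with k | k
  · simp only [Sum.elim_inl, deriv_stieltjes_ofReal (hb k) (hπ k), stieltjes_ofReal]
    push_cast
    rfl
  · simp only [Sum.elim_inr, deriv_stieltjes_ofReal (hb k) (hπ k), stieltjes_ofReal]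
    push_cast
    rfl

/-- Diagonal weights of the components of `eta`. -/
def etaWeight {s p : ℕ} (b ρ : Fin s → ℝ) (g : Fin p → ℝ) : Fin s ⊕ Fin s → Fin p → ℝ :=
  Sum.elim (fun k => leftWeight (b k) (ρ k) g) (fun k => mixedWeight (b k) (ρ k) g)

/-- Limits of the averages of the squares of the weights. -/
def etaVar {s : ℕ} (π : Measure ℝ) (ρ : Fin s → ℝ) : Fin s ⊕ Fin s → ℝ :=
  Sum.elim (fun k => ∫ y, ((y - ρ k)⁻¹) ^ 2 ∂π - (∫ y, (y - ρ k)⁻¹ ∂π) ^ 2)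
    (fun k => ∫ y, (y - ρ k)⁻¹ ∂π + ρ k * ∫ y, ((y - ρ k)⁻¹) ^ 2 ∂π)

lemma measurable_etaWeight {s : ℕ} (b ρ : Fin s → ℝ) (p : ℕ) (j : Fin s ⊕ Fin s) :
    Measurable fun g : Fin p → ℝ => etaWeight b ρ g j := by
  rcases j with k | k
  · exact measurable_leftWeight _ _ _
  · exact measurable_mixedWeight _ _ _

lemma exists_abs_etaWeight_le {s : ℕ} {b ρ : Fin s → ℝ} (hb : ∀ k, b k < ρ k) :
    ∃ C : ℝ, ∀ (p : ℕ) (g : Fin p → ℝ) j i, |etaWeight b ρ g j i| ≤ C := by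
  let B : Fin s ⊕ Fin s → ℝ := Sum.elim (fun k => 2 * (ρ k - b k)⁻¹)
    (fun k => √(b k) * (ρ k - b k)⁻¹)
  have hB : ∀ (p : ℕ) (g : Fin p → ℝ) j i, |etaWeight b ρ g j i| ≤ B j := by
    rintro p g (k | k) i
    · exact abs_leftWeight_le (hb k) g i
    · exact abs_mixedWeight_le (hb k) g i
  refine ⟨∑ j, |B j|, fun p g j i => (hB p g j i).trans ((le_abs_self _).trans ?_)⟩
  exact Finset.single_le_sum (f := fun j => |B j|) (fun _ _ => abs_nonneg _) (Finset.mem_univ j)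

lemma stochNull_pi {Ω ι : Type*} [MeasurableSpace Ω] [Fintype ι] {μ : Measure Ω}
    {Y : ℕ → Ω → ι → ℂ} (h : ∀ j, StochNull μ (fun n ω => Y n ω j)) : StochNull μ Y := by
  have hsum := StochNull.sum (μ := μ) Finset.univ fun j _ =>
    (h j).norm_le (Z := fun n ω => ‖Y n ω j‖) (fun n ω => by simp)
  refine hsum.norm_le fun n ω => ?_
  refine le_trans ?_ (Real.le_norm_self _)
  exact (pi_norm_le_iff_of_nonneg (Finset.sum_nonneg fun _ _ => norm_nonneg _)).2 fun j =>
    Finset.single_le_sum (f := fun j => ‖Y n ω j‖) (fun _ _ => norm_nonneg _) (Finset.mem_univ j)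

section Limit

variable {Ω : Type*} [MeasurableSpace Ω] {P : Measure Ω} {N : ℕ → ℕ}
  {Γ : (n : ℕ) → Ω → Fin (N n) → ℝ} {s : ℕ} {b ρ : Fin s → ℝ}

lemma ae_tendsto_average_etaWeight_sq {π : Measure ℝ} (hNlim : Tendsto N atTop atTop)
    (hb : ∀ k, b k < ρ k) (hle : ∀ k, ∀ᵐ ω ∂P, ∀ᶠ n in atTop, ∀ i, Γ n ω i ^ 2 ≤ b k)
    (hav : ∀ k, ∀ᵐ ω ∂P,
      Tendsto (fun n => (N n : ℝ)⁻¹ * ∑ i, (Γ n ω i ^ 2 - ρ k)⁻¹) atTop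
        (𝓝 (∫ y, (y - ρ k)⁻¹ ∂π)) ∧
      Tendsto (fun n => (N n : ℝ)⁻¹ * ∑ i, ((Γ n ω i ^ 2 - ρ k)⁻¹) ^ 2) atTop
        (𝓝 (∫ y, ((y - ρ k)⁻¹) ^ 2 ∂π))) (j : Fin s ⊕ Fin s) :
    ∀ᵐ ω ∂P, Tendsto (fun n => (N n : ℝ)⁻¹ * ∑ i, etaWeight b ρ (Γ n ω) j i ^ 2) atTop
      (𝓝 (etaVar π ρ j)) := by
  rcases j with k | k
  · filter_upwards [hle k, hav k] with ω h1 h2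
    refine (h2.2.sub (h2.1.pow 2)).congr' ?_
    filter_upwards [h1, hNlim.eventually_gt_atTop 0] with n hn hn0
    exact (average_leftWeight_sq hn0 hn).symm
  · filter_upwards [hle k, hav k] with ω h1 h2
    refine (h2.1.add (h2.2.const_mul (ρ k))).congr' ?_
    filter_upwards [h1] with n hn
    exact (average_mixedWeight_sq (hb k) hn).symm

lemma nonneg_of_ae_tendsto_average [IsProbabilityMeasure P] {ι : Type*}
    {c : (n : ℕ) → Ω → ι → Fin (N n) → ℝ} {j : ι}
    {r : ℝ} (h : ∀ᵐ ω ∂P, Tendsto (fun n => (N n : ℝ)⁻¹ * ∑ i, c n ω j i ^ 2) atTop (𝓝 r)) :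
    0 ≤ r := by
  obtain ⟨ω, hω⟩ := h.exists
  exact ge_of_tendsto' hω fun n =>
    mul_nonneg (by positivity) (Finset.sum_nonneg fun _ _ => sq_nonneg _)

end Limit

/-- The forms that approximate the components of `eta`. -/
def etaForm {t p : ℕ} (q : ℕ) (b ρ : Fin (t / 2) → ℝ)
    (z : (Fin p → ℝ) × Matrix (Fin p) (Fin t) ℂ × Matrix (Fin p) (Fin t) ℂ) :
    Fin (t / 2) ⊕ Fin (t / 2) → ℂ :=
  Sum.elim
    (fun k => ((√(p : ℝ) : ℝ) : ℂ) *
      form (leftWeight (b k) (ρ k) z.1) z.2.1 z.2.1 (fstIdx k) (sndIdx k))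
    (fun k => ((√(q : ℝ) : ℝ) : ℂ) *
      form (mixedWeight (b k) (ρ k) z.1) z.2.1 z.2.2 (fstIdx k) (fstIdx k))

lemma measurable_etaForm {t : ℕ} (p q : ℕ) (b ρ : Fin (t / 2) → ℝ) :
    Measurable (etaForm (p := p) q b ρ) := by
  refine measurable_pi_lambda _ fun j => ?_
  rcases j with k | k
  · exact (measurable_matrix_iff.1 (measurable_form ((measurable_leftWeight _ _ _).comp
      measurable_fst) (by fun_prop) (by fun_prop)) _ _).const_mul _
  · exact (measurable_matrix_iff.1 (measurable_form ((measurable_mixedWeight _ _ _).comp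
      measurable_fst) (by fun_prop) (by fun_prop)) _ _).const_mul _

/-- The column of the first factor of a component of `eta`. -/
def fstCol {t : ℕ} : Fin (t / 2) ⊕ Fin (t / 2) → Fin t ⊕ Fin t :=
  Sum.elim (fun k => Sum.inl (fstIdx k)) (fun k => Sum.inl (fstIdx k))

/-- The column of the second factor of a component of `eta`. -/
def sndCol {t : ℕ} : Fin (t / 2) ⊕ Fin (t / 2) → Fin t ⊕ Fin t :=
  Sum.elim (fun k => Sum.inl (sndIdx k)) (fun k => Sum.inr (fstIdx k))

lemma fstIdx_ne_sndIdx {t : ℕ} (k l : Fin (t / 2)) : fstIdx k ≠ sndIdx l := by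
  intro h
  have := congrArg Fin.val h
  simp only [fstIdx, sndIdx] at this
  omega

/-- The second columns carry the randomness left after conditioning, so they must be distinct; the
first ones need not be, and `fstCol` does take each of its values twice. -/
lemma sndCol_injective {t : ℕ} : Function.Injective (sndCol (t := t)) := by
  rintro (k | k) (l | l) h
  · have := congrArg Fin.val (Sum.inl_injective h)
    simp only [sndIdx] at this
    exact congrArg _ (Fin.ext (by omega))
  · exact absurd h Sum.inl_ne_inr
  · exact absurd h Sum.inr_ne_inl
  · have := congrArg Fin.val (Sum.inr_injective h)
    exact congrArg _ (Fin.ext this)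

lemma fstCol_ne_sndCol {t : ℕ} (i j : Fin (t / 2) ⊕ Fin (t / 2)) : fstCol i ≠ sndCol j := by
  rcases i with k | k <;> rcases j with l | l <;>
    simp [fstCol, sndCol, fstIdx_ne_sndIdx]

lemma etaForm_gaussMat {Ω Ω' : Type*} {t p q : ℕ} (hpq : p ≤ q) (hp : 0 < p)
    (ζ : ℕ × (Fin t ⊕ Fin t) → Ω' → ℂ) (b ρ : Fin (t / 2) → ℝ) (g : Ω → Fin p → ℝ) (x : Ω × Ω') :
    etaForm q b ρ (g x.1, gaussMat ζ Sum.inl p x.2,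
      (gaussMat ζ Sum.inr q x.2).submatrix (Fin.castLE hpq) id) =
    bilinSum ζ fstCol sndCol (fun ω => etaWeight b ρ (g ω)) x := by
  funext j
  rcases j with k | k
  · exact form_gaussMat_left ζ hp _ _ _ _
  · exact form_gaussMat_mixed ζ hpq (hp.trans_le hpq) _ _ _ _

section Eta

variable {Ω : Type*} [MeasurableSpace Ω] {P : Measure Ω} [IsProbabilityMeasure P] {N : ℕ → ℕ}
  {X : (n : ℕ) → Ω → Matrix (Fin (N n)) (Fin n) ℂ}
  {L : (n : ℕ) → Ω → Matrix.unitaryGroup (Fin (N n)) ℂ} {Γ : (n : ℕ) → Ω → Fin (N n) → ℝ}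
  {R : (n : ℕ) → Ω → Matrix (Fin n) (Fin (N n)) ℂ}
  {Ω' : Type*} [MeasurableSpace Ω'] {G : Measure Ω'}
  [IsProbabilityMeasure G] {t : ℕ} {ζ : ℕ × (Fin t ⊕ Fin t) → Ω' → ℂ} {hN : ∀ n, N n ≤ n}
  {W : (n : ℕ) → Matrix (Fin (N n)) (Fin t) ℂ} {Wt : (n : ℕ) → Matrix (Fin n) (Fin t) ℂ}
  {b ρ : Fin (t / 2) → ℝ}

lemma tendstoInDistribution_etaForm {S St : (n : ℕ) → Ω → Matrix (Fin (N n)) (Fin t) ℂ}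
    (h : IsGaussianFamily ζ G) (hw : IsWhitened P G ζ hN Γ S St)
    (hNlim : Tendsto N atTop atTop) (hΓ : ∀ n, Measurable (Γ n)) (hS : ∀ n, Measurable (S n))
    (hSt : ∀ n, Measurable (St n)) (hb : ∀ k, b k < ρ k)
    {r : Fin (t / 2) ⊕ Fin (t / 2) → ℝ}
    (hr : ∀ j, ∀ᵐ ω ∂P, Tendsto (fun n => (N n : ℝ)⁻¹ * ∑ i, etaWeight b ρ (Γ n ω) j i ^ 2) atTop
      (𝓝 (r j))) :
    TendstoInDistribution (fun n (x : Ω × Ω') => etaForm n b ρ (Γ n x.1,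
        S n x.1 * gramSqrt (gaussMat ζ Sum.inl (N n) x.2),
        St n x.1 * gramSqrt (gaussMat ζ Sum.inr n x.2))) atTop id (fun _ => P.prod G)
      (complexGaussian (Matrix.diagonal fun j => (r j : ℂ))) := by
  obtain ⟨C, hC⟩ := exists_abs_etaWeight_le hb
  have h1 := h.tendstoInDistribution_bilinSum (P := P) sndCol_injective fstCol_ne_sndCol hNlim
    (c := fun n ω => etaWeight b ρ (Γ n ω)) (fun n j => (measurable_etaWeight b ρ _ j).comp (hΓ n))
    (fun n ω j i => hC _ _ j i) hr
    (fun j => nonneg_of_ae_tendsto_average (c := fun n ω => etaWeight b ρ (Γ n ω)) (hr j))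
  refine TendstoInDistribution.of_eventually_identDistrib h1 (fun n => ?_) ?_
  · have hA : Measurable fun x : Ω × Ω' => gramSqrt (gaussMat ζ Sum.inl (N n) x.2) :=
      (measurable_gramSqrt _ _).comp ((h.measurable_gaussMat Sum.inl (N n)).comp measurable_snd)
    have hA' : Measurable fun x : Ω × Ω' => gramSqrt (gaussMat ζ Sum.inr n x.2) :=
      (measurable_gramSqrt _ _).comp ((h.measurable_gaussMat Sum.inr n).comp measurable_snd)
    exact ((measurable_etaForm _ n b ρ).comp (((hΓ n).comp measurable_fst).prodMk
      ((measurable_matrix_mul ((hS n).comp measurable_fst) hA).prodMk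
        (measurable_matrix_mul ((hSt n).comp measurable_fst) hA')))).aemeasurable
  · filter_upwards [hw, hNlim.eventually_gt_atTop 0] with n hn hn0
    have h2 := hn.comp (measurable_etaForm _ n b ρ)
    have h3 : etaForm n b ρ ∘ (fun x : Ω × Ω' => (Γ n x.1, gaussMat ζ Sum.inl (N n) x.2,
        (gaussMat ζ Sum.inr n x.2).submatrix (Fin.castLE (hN n)) id)) =
        fun x => bilinSum ζ fstCol sndCol (fun ω => etaWeight b ρ (Γ n ω)) x :=
      funext fun x => etaForm_gaussMat (hN n) hn0 ζ b ρ (Γ n) x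
    rw [h3] at h2
    exact h2

lemma tendstoInDistribution_eta (h : IsGaussianFamily ζ G)
    (hw : IsWhitened P G ζ hN Γ (fun n ω => (L n ω : Matrix (Fin (N n)) (Fin (N n)) ℂ)ᴴ * W n)
      (fun n ω => (R n ω)ᴴ * Wt n))
    (hNlim : Tendsto N atTop atTop) (hX : ∀ n, Measurable (X n)) (hL : ∀ n, Measurable (L n))
    (hΓ : ∀ n, Measurable (Γ n)) (hR : ∀ n, Measurable (R n))
    (hW : ∀ᶠ n in atTop, (W n)ᴴ * W n = 1) (hb : ∀ k, b k < ρ k) (hρ : ∀ k, ρ k ≠ 0)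
    (hgood : ∀ k, Tendsto (fun n => (P.prod G)
      {x | ¬ (IsSVD (X n) (L n) (Γ n) (R n) x.1 ∧ ∀ i, Γ n x.1 i ^ 2 ≤ b k)}) atTop (𝓝 0))
    {r : Fin (t / 2) ⊕ Fin (t / 2) → ℝ}
    (hr : ∀ j, ∀ᵐ ω ∂P, Tendsto (fun n => (N n : ℝ)⁻¹ * ∑ i, etaWeight b ρ (Γ n ω) j i ^ 2) atTop
      (𝓝 (r j))) :
    TendstoInDistribution (fun n ω => eta (X n ω) (W n) (Wt n) ρ) atTop
      (id : (Fin (t / 2) ⊕ Fin (t / 2) → ℂ) → (Fin (t / 2) ⊕ Fin (t / 2) → ℂ)) (fun _ => P)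
      (complexGaussian (Matrix.diagonal fun j => (r j : ℂ))) := by
  have hS : ∀ n, Measurable fun ω => (L n ω : Matrix (Fin (N n)) (Fin (N n)) ℂ)ᴴ * W n := fun n =>
    measurable_matrix_mul (measurable_matrix_conjTranspose (measurable_subtype_coe.comp (hL n)))
      measurable_const
  have hSt : ∀ n, Measurable fun ω => (R n ω)ᴴ * Wt n := fun n =>
    measurable_matrix_mul (measurable_matrix_conjTranspose (hR n)) measurable_const
  have hκ := tendstoInDistribution_etaForm h hw hNlim hΓ hS hSt hb hr
  have hηm : ∀ n, Measurable fun ω => eta (X n ω) (W n) (Wt n) ρ := fun n =>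
    measurable_eta (hX n) _ _ _
  -- Slutsky's theorem: it remains to show that `eta` and the whitened forms differ by a sequence
  -- that tends to zero in probability.
  refine TendstoInDistribution.of_fst (G := G) hηm
    (tendstoInDistribution_of_tendstoInMeasure_sub _ _ hκ ?_
      fun n => ((hηm n).comp measurable_fst).aemeasurable)
  rw [← stochNull_iff_tendstoInMeasure]
  have hcomp : ∀ j, StochNull (P.prod G) (fun n x => eta (X n x.1) (W n) (Wt n) ρ j -
      etaForm n b ρ (Γ n x.1, (L n x.1 : Matrix (Fin (N n)) (Fin (N n)) ℂ)ᴴ * W n *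
          gramSqrt (gaussMat ζ Sum.inl (N n) x.2),
        (R n x.1)ᴴ * Wt n * gramSqrt (gaussMat ζ Sum.inr n x.2)) j) := by
    rintro (k | k)
    · have h1 := (left_entry h hw hNlim hΓ (hb k) (hgood k) (fstIdx k) (sndIdx k)).2
      refine h1.congr (tendsto_const_nhds.congr' ?_)
      filter_upwards [hW] with n hn
      symm
      rw [measure_eq_zero_iff_ae_notMem]
      refine Eventually.of_forall fun x hx => hx ?_
      -- The columns `w_k` and `w_{t/2+k}` are orthogonal, so the centring by `α` does not
      -- contribute to this entry.
      have h2 : ((W n)ᴴ * (Q (X n x.1) (ρ k) - alpha (X n x.1) (ρ k) •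
          (1 : Matrix (Fin (N n)) (Fin (N n)) ℂ)) * W n) (fstIdx k) (sndIdx k) =
          ((W n)ᴴ * Q (X n x.1) (ρ k) * W n) (fstIdx k) (sndIdx k) := by
        rw [Matrix.mul_sub, Matrix.sub_mul, Matrix.mul_smul, Matrix.mul_one, Matrix.smul_mul, hn]
        simp [Matrix.one_apply_ne (fstIdx_ne_sndIdx k k)]
      rw [h2]
      rfl
    · exact (mixed_entry h hw hNlim hΓ (hb k) (hρ k) (hgood k) (fstIdx k) (fstIdx k)).2
  exact stochNull_pi hcomp

lemma isTightSeq_xi {c ρ' b' : ℝ} (h : IsGaussianFamily ζ G)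
    (hw : IsWhitened P G ζ hN Γ (fun n ω => (L n ω : Matrix (Fin (N n)) (Fin (N n)) ℂ)ᴴ * W n)
      (fun n ω => (R n ω)ᴴ * Wt n))
    (hc : 0 < c) (hNc : Tendsto (fun n : ℕ => (N n : ℝ) / (n : ℝ)) atTop (𝓝 c))
    (hX : ∀ n, Measurable (X n)) (hΓ : ∀ n, Measurable (Γ n))
    (hWt : ∀ᶠ n in atTop, (Wt n)ᴴ * Wt n = 1) (hb : b' < ρ') (hρ : ρ' ≠ 0)
    (hgood : Tendsto (fun n => (P.prod G)
      {x | ¬ (IsSVD (X n) (L n) (Γ n) (R n) x.1 ∧ ∀ i, Γ n x.1 i ^ 2 ≤ b')}) atTop (𝓝 0)) :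
    IsTightSeq P (fun n ω => xi (X n ω) (W n) (Wt n) ρ') := by
  have hm : ∀ n, AEMeasurable (fun ω => xi (X n ω) (W n) (Wt n) ρ') P := fun n =>
    (measurable_xi (hX n) _ _ _).aemeasurable
  have hNlim := tendsto_nat_of_ratio hc hNc
  refine ⟨hm, StochBdd.isTightMeasureSet_matrices hm (fun k l => ?_) (fun k l => ?_) fun k l => ?_⟩
  · obtain ⟨K, hK⟩ := exists_sqrt_ratio_le hc hNc
    have h1 := (left_entry h hw hNlim hΓ hb hgood k l).1.bdd_mul
      (U := fun n _ => ((√(n : ℝ) * (√(N n : ℝ))⁻¹ : ℝ) : ℂ)) (C := K) (hK.mono fun n hn _ => by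
        rwa [Complex.norm_real, Real.norm_eq_abs, abs_of_nonneg (by positivity)])
    refine StochBdd.of_fst (G := G) (h1.of_norm_le ?_)
    filter_upwards [hNlim.eventually_gt_atTop 0] with n hn x
    refine le_of_eq (congrArg norm ?_)
    have h2 := sqrt_mul_sqrt_inv hn
    simp only [xi, Matrix.smul_apply, smul_eq_mul]
    rw [Complex.ofReal_mul, ← mul_assoc, mul_assoc ((√(n : ℝ) : ℝ) : ℂ),
      mul_comm _ ((√(N n : ℝ) : ℝ) : ℂ), h2, mul_one]
  · exact StochBdd.of_fst (G := G) (right_entry h hw hWt hΓ hb hρ hgood k l)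
  · exact StochBdd.of_fst (G := G) (mixed_entry h hw hNlim hΓ hb hρ hgood k l).1

end Eta

end SpikedHaar

end

/-! ### The main theorem. -/

open SpikedHaar

theorem mainTheorem6 {Ω : Type*} [MeasurableSpace Ω] (P : Measure Ω) [IsProbabilityMeasure P]
    -- the dimensions `N = N n ≤ n`, with `N / n → c ∈ (0, 1]`
    (N : ℕ → ℕ) (hN : ∀ n, N n ≤ n) (c : ℝ) (hc : c ∈ Set.Ioc (0 : ℝ) 1)
    (hNc : Tendsto (fun n : ℕ => (N n : ℝ) / (n : ℝ)) atTop (𝓝 c))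
    -- the bi-unitarily invariant random matrices
    (X : (n : ℕ) → Ω → Matrix (Fin (N n)) (Fin n) ℂ) (hXm : ∀ n, Measurable (X n))
    (hX : ∀ n, SpikedHaar.IsBiUnitarilyInvariant P (hN n) (X n))
    -- convergence of the normalized trace of the resolvent
    (π : Measure ℝ) [IsProbabilityMeasure π] (lamMinus lamPlus : ℝ)
    (hπ : π (Set.Icc lamMinus lamPlus)ᶜ = 0)
    (hα : ∀ z : ℂ, 0 < z.im →
      ∀ᵐ ω ∂P, Tendsto (fun n => SpikedHaar.alpha (X n ω) z) atTop (𝓝 (SpikedHaar.stieltjes π z)))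
    -- convergence of the largest eigenvalue
    (hnorm : ∀ᵐ ω ∂P,
      Tendsto (fun n => SpikedHaar.spectralNorm (X n ω * (X n ω)ᴴ)) atTop (𝓝 lamPlus))
    -- deterministic isometries, for the `n` large enough for these to exist
    (t : ℕ) (W : (n : ℕ) → Matrix (Fin (N n)) (Fin t) ℂ) (Wt : (n : ℕ) → Matrix (Fin n) (Fin t) ℂ)
    (hW : ∀ᶠ n in atTop, (W n)ᴴ * W n = 1) (hWt : ∀ᶠ n in atTop, (Wt n)ᴴ * Wt n = 1) :
    (∀ ρ : ℝ, lamPlus < ρ →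
      SpikedHaar.IsTightSeq P (fun n ω => SpikedHaar.xi (X n ω) (W n) (Wt n) ρ)) ∧
    (Even t → ∀ ρ : Fin (t / 2) → ℝ, (∀ k, lamPlus < ρ k) →
      (SpikedHaar.limitCov (SpikedHaar.stieltjes π) ρ).PosSemidef ∧
      TendstoInDistribution (fun n ω => SpikedHaar.eta (X n ω) (W n) (Wt n) ρ) atTop
        (id : (Fin (t / 2) ⊕ Fin (t / 2) → ℂ) → (Fin (t / 2) ⊕ Fin (t / 2) → ℂ)) (fun _ => P)
        (SpikedHaar.complexGaussian (SpikedHaar.limitCov (SpikedHaar.stieltjes π) ρ))) := by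
  choose L Γ R haarq hL hΓ hR hLhaar _ hhaar hprob hRlaw hind hind' hdecomp using hX
  have hsvd : ∀ n, ∀ᵐ ω ∂P, IsSVD (X n) (L n) (Γ n) (R n) ω := by
    intro n
    filter_upwards [ae_conjTranspose_mul_self_eq_one (hN n) (hR n) (hRlaw n), hdecomp n]
      with ω h1 h2 using ⟨h1, h2⟩
  -- One infinite Gaussian array, on a separate probability space, serves all `n`; the labels `Fin t
  -- ⊕ Fin t` are the columns of `Y` and of `Ỹ`.
  obtain ⟨Ω', _, G, ζ, hζm, hζlaw, hζind, _⟩ := exists_iid (ℕ × (Fin t ⊕ Fin t)) cgauss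
  have hζ : IsGaussianFamily ζ G := ⟨hζm, hζlaw, hζind⟩
  have hw := isWhitened_of_haar hN hζ hL hΓ hR hLhaar hhaar hprob hRlaw hind hind' hW hWt
  have hlam := nonneg_of_tendsto_spectralNorm hnorm
  have hNlim := tendsto_nat_of_ratio hc.1 hNc
  have hgood : ∀ b, lamPlus < b → Tendsto (fun n => (P.prod G)
      {x | ¬ (IsSVD (X n) (L n) (Γ n) (R n) x.1 ∧ ∀ i, Γ n x.1 i ^ 2 ≤ b)}) atTop (𝓝 0) := by
    intro b hb
    refine (tendsto_measure_not_svd_le hsvd hΓ hnorm hb).congr fun n => ?_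
    exact (prod_setOf_fst (fun ω => ¬ (IsSVD (X n) (L n) (Γ n) (R n) ω ∧
      ∀ i, Γ n ω i ^ 2 ≤ b))).symm
  refine ⟨fun ρ hρ => ?_, fun _ ρ hρ => ?_⟩
  · obtain ⟨b, hb, hbρ⟩ := exists_between hρ
    exact isTightSeq_xi hζ hw hc.1 hNc hXm hΓ hWt hbρ (hlam.trans_lt hρ).ne' (hgood b hb)
  · choose b hb hbρ using fun k => exists_between (hρ k)
    have hπb : ∀ k, ∀ᵐ y ∂π, y ≤ b k := fun k => by
      filter_upwards [compl_mem_ae_iff.2 hπ] with y hy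
      exact (not_not.1 hy).2.trans (hb k).le
    have hr := ae_tendsto_average_etaWeight_sq hNlim hbρ
      (fun k => ae_eventually_sq_le hsvd hnorm (hb k))
      (fun k => ae_tendsto_average hsvd hnorm hα (hb k) (hbρ k) (hπb k))
    have hcov : limitCov (stieltjes π) ρ = Matrix.diagonal fun j => (etaVar π ρ j : ℂ) :=
      limitCov_stieltjes hbρ hπb
    rw [hcov]
    refine ⟨Matrix.posSemidef_diagonal_iff.2 fun j => ?_, tendstoInDistribution_eta hζ hw hNlim hXm
      hL hΓ hR hW hbρ (fun k => (hlam.trans_lt (hρ k)).ne') (fun k => hgood _ (hb k)) hr⟩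
    -- The diagonal entries are limits of averages of squares.
    exact_mod_cast nonneg_of_ae_tendsto_average (c := fun n ω => etaWeight b ρ (Γ n ω)) (hr j)
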